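/- Let $d\ge 3$, let $\mu$ and $\nu$ be the uniform probability measures on the unit sphere $\mathbb S^{d-1}$ and on the unit ball $B^d\subset\mathbb R^d$, and set $$p=\tfrac{2(d-1)}{d-2},\quad q=\tfrac{2d}{d-2},\quad p'=\tfrac{2(d-1)}{d},\quad q'=\tfrac{2d}{d+2}.$$ Let $Q(y,\omega)=\frac{1-|y|^2}{|y-\omega|^d}$ be the Poisson kernel of $B^d$, $(Qu)(y)=\int_{\mathbb S^{d-1}}Q(y,\omega)u(\omega)\,d\mu(\omega)$ for $y\in B^d$ and $(Sv)(\omega)=\int_{B^d}Q(y,\omega)v(y)\,d\nu(y)$ for $\omega\in\mathbb S^{d-1}$. Norms $\|\cdot\|_r$ are those of $L^r(\mathbb S^{d-1},\mu)$ or $L^r(B^d,\nu)$. A Möbius transformation of $\mathbb R^m\cup\{\infty\}$ is a finite composition of reflections in spheres and hyperplanes; a Möbius transformation $\Psi$ of $\mathbb S^{d-1}$ is a map that stereographic projection turns into a Möbius transformation of $\mathbb R^{d-1}\cup\{\infty\}$; a Möbius transformation $\Phi$ of $B^d$ is the restriction of one of $\mathbb R^d\cup\{\infty\}$ that maps $B^d$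 onto itself. With $J$ denoting Jacobians, set $(u)_\Psi=J_\Psi^{\frac{d-2}{2(d-1)}}\,u\circ\Psi$ and $[v]_\Phi=J_\Phi^{\frac{d+2}{2d}}\,v\circ\Phi$. For $\eta\in B^d$ let $$\Psi_\eta(\omega)=\frac{(1-|\eta|^2)(\omega-\eta)-(1-2\eta\cdot\omega+|\eta|^2)\eta}{1-2\eta\cdot\omega+|\eta|^2},\qquad \Phi_\eta(y)=\frac{(1-|\eta|^2)(y-\eta)-|y-\eta|^2\eta}{1-2\eta\cdot y+|\eta|^2|y|^2}.$$ The stability exponents cannot be lowered, in the following sense. **(1) Primal inequality.** For each $r\in\{2,p\}$ there is a sequence $(u_j)\subset L^p(\mathbb S^{d-1})$ with $\|u_j\|_p=1$ such that $\inf_\Psi\|(u_j)_\Psi-1\|_p\to0$, $\inf_\Psi\|(u_j)_\Psi-1\|_r^r>0$ for all large $j$, and $$\limsup_{j\to\infty}\frac{\|u_j\|_p^p-\|Qu_j\|_q^p}{\inf_\Psi\|(u_j)_\Psi-1\|_r^r}<\infty .$$ In particular, for all $0<s<r$ and $c>0$, $\ \|u_j\|_p^p-\|Qu_j\|_q^p<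 c\,\inf_\Psi\|(u_j)_\Psi-1\|_r^s$ for all large $j$. More precisely: * For $r=2$ one can take $u_j=\lambda_j(1+\varepsilon_j\phi)$, where $0\not\equiv\phi\in C^\infty(\mathbb S^{d-1})$ is any function with $\int\phi\,d\mu=\int\phi\,\omega_i\,d\mu=0$ for $i=1,\dots,d$ (such functions exist), $(\varepsilon_j)$ is any sequence of nonzero reals with $\varepsilon_j\to0$, and $\lambda_j>0$ is chosen such that $\|u_j\|_p=1$. * For $r=p$ and any $\eta_*\in\mathbb S^{d-1}$ and any sequence $\delta_j>0$ with $\delta_j\to0$, there are $\eta_j\in B^d$ with $\eta_j\to\eta_*$ such that one can take the two-bubble functions $u_j=\lambda_j(1+\delta_j(1)_{\Psi_{\eta_j}})$, with $\lambda_j>0$ such that $\|u_j\|_p=1$. **(2) Dual inequality.** There is a sequence $(v_j)\subset L^{q'}(B^d)$ with $\|v_j\|_{q'}=1$ such that $\inf_\Phi\|[v_j]_\Phi-1\|_{q'}\to0$, $\inf_\Phi\|[v_j]_\Phi-1\|_{q'}^2>0$ for all large $j$, and $$\limsup_{j\to\infty}\frac{\|v_j\|_{q'}^{q'}-\|Sv_j\|_{p'}^{q'}}{\inf_\Phi\|[v_j]_\Phi-1\|_{q'}^2}<\infty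 .$$ In particular, for all $0<s<2$ and $c>0$, $\ \|v_j\|_{q'}^{q'}-\|Sv_j\|_{p'}^{q'}<c\,\inf_\Phi\|[v_j]_\Phi-1\|_{q'}^{s}$ for all large $j$. More precisely, for any fixed $\eta\in B^d\setminus\{0\}$ and any sequence $\delta_j>0$ with $\delta_j\to0$, one can take the two-bubble functions $v_j=\lambda_j(1+\delta_j[1]_{\Phi_\eta})$, with $\lambda_j>0$ such that $\|v_j\|_{q'}=1$. -/

import Mathlib

open MeasureTheory Filter Topology Metric
open scoped ENNReal Manifold

noncomputable section

namespace HWY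

/-! Throughout `n = d - 1`, so that `d = n + 1` is the dimension of the ambient space. -/

/-- The Euclidean space `ℝ^m`. -/
abbrev Euc (m : ℕ) : Type := EuclideanSpace ℝ (Fin m)

/-- The unit sphere `𝕊^{d-1}` of `ℝ^d`, with `d = n + 1`. -/
abbrev Sph (n : ℕ) : Type := sphere (0 : Euc (n + 1)) 1

/-- The uniform probability measure `μ` on `𝕊^{d-1}`. -/
def sphereMeasure (n : ℕ) : Measure (Sph n) :=
  ((volume : Measure (Euc (n + 1))).toSphere Set.univ)⁻¹ •
    (volume : Measure (Euc (n + 1))).toSphere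

/-- The uniform probability measure `ν` on the unit ball `B^d`, as a measure on `ℝ^d`. -/
def ballMeasure (n : ℕ) : Measure (Euc (n + 1)) :=
  (volume (ball (0 : Euc (n + 1)) 1))⁻¹ • volume.restrict (ball (0 : Euc (n + 1)) 1)

/-- The dimension `d = n + 1` as a real number. -/
def dim (n : ℕ) : ℝ := ((n + 1 : ℕ) : ℝ)

/-- `p = 2(d-1)/(d-2)`. -/
def expP (n : ℕ) : ℝ := 2 * (dim n - 1) / (dim n - 2)

/-- `q = 2d/(d-2)`. -/
def expQ (n : ℕ) : ℝ := 2 * dim n / (dim n - 2)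

/-- `p' = 2(d-1)/d`. -/
def expP' (n : ℕ) : ℝ := 2 * (dim n - 1) / dim n

/-- `q' = 2d/(d+2)`. -/
def expQ' (n : ℕ) : ℝ := 2 * dim n / (dim n + 2)

/-- The norm of `L^r(𝕊^{d-1}, μ)`, for a real exponent `r`. -/
def sphereNorm (n : ℕ) (r : ℝ) (u : Sph n → ℝ) : ℝ :=
  lpNorm u (ENNReal.ofReal r) (sphereMeasure n)

/-- The norm of `L^r(B^d, ν)`, for a real exponent `r`. -/
def ballNorm (n : ℕ) (r : ℝ) (v : Euc (n + 1) → ℝ) : ℝ :=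
  lpNorm v (ENNReal.ofReal r) (ballMeasure n)

/-- The Poisson kernel `Q(y, ω) = (1 - |y|²) / |y - ω|^d` of the unit ball. -/
def poissonKernel (n : ℕ) (y : Euc (n + 1)) (ω : Sph n) : ℝ :=
  (1 - ‖y‖ ^ 2) / ‖y - (ω : Euc (n + 1))‖ ^ (n + 1)

/-- The harmonic extension `(Qu)(y) = ∫ Q(y, ω) u(ω) dμ(ω)`. -/
def poissonExt (n : ℕ) (u : Sph n → ℝ) (y : Euc (n + 1)) : ℝ :=
  ∫ ω, poissonKernel n y ω * u ω ∂(sphereMeasure n)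

/-- The dual operator `(Sv)(ω) = ∫ Q(y, ω) v(y) dν(y)`. -/
def dualPoisson (n : ℕ) (v : Euc (n + 1) → ℝ) (ω : Sph n) : ℝ :=
  ∫ y, poissonKernel n y ω * v y ∂(ballMeasure n)

/-! ### Möbius transformations -/

section Moebius

variable {E : Type} [NormedAddCommGroup E] [InnerProductSpace ℝ E]

/-- Reflection of `E ∪ {∞}` in the hyperplane `{x | ⟪a, x⟫ = t}`, for a unit vector `a`. -/
def hyperplaneReflection (a : E) (t : ℝ) : OnePoint E → OnePoint E :=
  OnePoint.map fun x => x - (2 * (inner ℝ a x - t)) • a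

open scoped Classical in
/-- Reflection of `E ∪ {∞}` in the sphere of centre `a` and radius `R`; it exchanges `a` and `∞`. -/
def sphereReflection (a : E) (R : ℝ) (x : OnePoint E) : OnePoint E :=
  x.elim (a : OnePoint E) fun y =>
    if y = a then OnePoint.infty else ((EuclideanGeometry.inversion a R y : E) : OnePoint E)

/-- Möbius transformations of `E ∪ {∞}`: finite compositions of reflections in
hyperplanes and in spheres. -/
inductive IsMoebius : (OnePoint E → OnePoint E) → Prop
  | id : IsMoebius id
  | hyperplane (a : E) (t : ℝ) (ha : ‖a‖ = 1) (ψ : OnePoint E → OnePoint E) (hψ : IsMoebius ψ) :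
      IsMoebius (hyperplaneReflection a t ∘ ψ)
  | sphere (a : E) (R : ℝ) (hR : 0 < R) (ψ : OnePoint E → OnePoint E) (hψ : IsMoebius ψ) :
      IsMoebius (sphereReflection a R ∘ ψ)

end Moebius

/-- Inverse stereographic projection of `ξ ∈ ℝ^{d-1}`:
`(2ξ / (1 + |ξ|²), (1 - |ξ|²) / (1 + |ξ|²))`. -/
def stereoVec (n : ℕ) (ξ : Euc n) : Euc (n + 1) :=
  WithLp.toLp 2 (Fin.snoc (α := fun _ => ℝ) (fun i => 2 * ξ i / (1 + ‖ξ‖ ^ 2))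
    ((1 - ‖ξ‖ ^ 2) / (1 + ‖ξ‖ ^ 2)))

theorem norm_stereoVec (n : ℕ) (ξ : Euc n) : ‖stereoVec n ξ‖ = 1 := by
  have h0 : (1 + ‖ξ‖ ^ 2) ≠ 0 := by positivity
  have h1 : ∑ i, ξ i ^ 2 = ‖ξ‖ ^ 2 := by
    rw [EuclideanSpace.norm_sq_eq]
    simp
  have h2 : ‖stereoVec n ξ‖ ^ 2 = 1 := by
    rw [EuclideanSpace.norm_sq_eq, Fin.sum_univ_castSucc]
    simp only [stereoVec, Fin.snoc_castSucc, Fin.snoc_last, Real.norm_eq_abs, sq_abs, div_pow,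
      mul_pow]
    rw [← Finset.sum_div, ← Finset.mul_sum, h1]
    field_simp
    ring
  nlinarith [norm_nonneg (stereoVec n ξ)]

/-- Inverse stereographic projection `𝒮 : ℝ^{d-1} ∪ {∞} → 𝕊^{d-1}`, with `𝒮(∞) = -e_d`. -/
def stereo (n : ℕ) (x : OnePoint (Euc n)) : Sph n :=
  x.elim ⟨-EuclideanSpace.single (Fin.last n) 1, by simp⟩
    fun ξ => ⟨stereoVec n ξ, by simp [norm_stereoVec]⟩

/-- `Ψ : 𝕊^{d-1} → 𝕊^{d-1}` is a Möbius transformation: `𝒮⁻¹ ∘ Ψ ∘ 𝒮` is a Möbius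
transformation of `ℝ^{d-1} ∪ {∞}`. -/
def IsMoebiusSphere (n : ℕ) (Ψ : Sph n → Sph n) : Prop :=
  ∃ ψ : OnePoint (Euc n) → OnePoint (Euc n), IsMoebius ψ ∧ ∀ x, Ψ (stereo n x) = stereo n (ψ x)

/-- `Φ` is, on the unit ball `B^d`, a Möbius transformation of `B^d`, that is, the restriction
of a Möbius transformation of `ℝ^d ∪ {∞}` that maps `B^d` onto itself.
The values of `Φ` outside the ball are irrelevant. -/
def IsMoebiusBall (n : ℕ) (Φ : Euc (n + 1) → Euc (n + 1)) : Prop :=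
  ∃ φ : OnePoint (Euc (n + 1)) → OnePoint (Euc (n + 1)), IsMoebius φ ∧
    φ '' ((↑) '' ball (0 : Euc (n + 1)) 1) = (↑) '' ball (0 : Euc (n + 1)) 1 ∧
    ∀ y ∈ ball (0 : Euc (n + 1)) 1, φ (y : OnePoint (Euc (n + 1))) = (Φ y : OnePoint (Euc (n + 1)))

/-- The extension of `Ψ : 𝕊^{d-1} → 𝕊^{d-1}` to `ℝ^d` that is homogeneous of degree one,
`x ↦ |x| Ψ(x/|x|)`. -/
def radialExt (n : ℕ) (Ψ : Sph n → Sph n) (x : Euc (n + 1)) : Euc (n + 1) :=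
  if hx : x = 0 then 0
  else ‖x‖ • (Ψ ⟨‖x‖⁻¹ • x, by simp [norm_smul, norm_ne_zero_iff.mpr hx]⟩ : Euc (n + 1))

/-- The Jacobian `J_Ψ(ω)` of `Ψ : 𝕊^{d-1} → 𝕊^{d-1}`, i.e. the absolute value of the determinant
(in orthonormal bases) of the differential `T_ω → T_{Ψ(ω)}`. The differential of the radial
extension at `ω` is this differential on the tangent space and maps the unit normal `ω`
to the unit normal `Ψ(ω)`, so its determinant has the same absolute value. -/
def sphereJac (n : ℕ) (Ψ : Sph n → Sph n) (ω : Sph n) : ℝ :=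
  |(fderiv ℝ (radialExt n Ψ) (ω : Euc (n + 1))).det|

/-- The Jacobian `J_Φ(y) = |det DΦ(y)|`. -/
def ballJac (n : ℕ) (Φ : Euc (n + 1) → Euc (n + 1)) (y : Euc (n + 1)) : ℝ :=
  |(fderiv ℝ Φ y).det|

/-- `(u)_Ψ = J_Ψ^{(d-2)/(2(d-1))} u ∘ Ψ`. -/
def sphereAct (n : ℕ) (Ψ : Sph n → Sph n) (u : Sph n → ℝ) (ω : Sph n) : ℝ :=
  sphereJac n Ψ ω ^ ((dim n - 2) / (2 * (dim n - 1))) * u (Ψ ω)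

/-- `[v]_Φ = J_Φ^{(d+2)/(2d)} v ∘ Φ`. -/
def ballAct (n : ℕ) (Φ : Euc (n + 1) → Euc (n + 1)) (v : Euc (n + 1) → ℝ) (y : Euc (n + 1)) : ℝ :=
  ballJac n Φ y ^ ((dim n + 2) / (2 * dim n)) * v (Φ y)

/-- The vector `Ψ_η(ω)`. -/
def psiVec (n : ℕ) (η ω : Euc (n + 1)) : Euc (n + 1) :=
  (1 - 2 * inner ℝ η ω + ‖η‖ ^ 2)⁻¹ •
    ((1 - ‖η‖ ^ 2) • (ω - η) - (1 - 2 * inner ℝ η ω + ‖η‖ ^ 2) • η)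

theorem norm_psiVec (n : ℕ) (η ω : Euc (n + 1)) (hη : ‖η‖ < 1) (hω : ‖ω‖ = 1) :
    ‖psiVec n η ω‖ = 1 := by
  have hs : inner ℝ η ω ≤ ‖η‖ := by simpa [hω] using real_inner_le_norm η ω
  have hD : 0 < 1 - 2 * inner ℝ η ω + ‖η‖ ^ 2 := by nlinarith
  have h2 : ‖(1 - ‖η‖ ^ 2) • (ω - η) - (1 - 2 * inner ℝ η ω + ‖η‖ ^ 2) • η‖ ^ 2
      = (1 - 2 * inner ℝ η ω + ‖η‖ ^ 2) ^ 2 := by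
    have e : ‖ω - η‖ ^ 2 = 1 - 2 * inner ℝ η ω + ‖η‖ ^ 2 := by
      rw [norm_sub_sq_real, hω, real_inner_comm]
      ring
    rw [norm_sub_sq_real, norm_smul, norm_smul, real_inner_smul_left, real_inner_smul_right,
      inner_sub_left, real_inner_self_eq_norm_sq, mul_pow, mul_pow, e, Real.norm_eq_abs,
      Real.norm_eq_abs, sq_abs, sq_abs, real_inner_comm η ω]
    ring
  rw [psiVec, norm_smul, norm_inv, Real.norm_of_nonneg hD.le,
    (sq_eq_sq₀ (norm_nonneg _) hD.le).mp h2, inv_mul_cancel₀ hD.ne']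

/-- The Möbius transformation `Ψ_η` of `𝕊^{d-1}`, for `η ∈ B^d`:
`Ψ_η(ω) = ((1-|η|²)(ω-η) - (1-2η·ω+|η|²)η) / (1-2η·ω+|η|²)`. -/
def psiEta (n : ℕ) (η : ball (0 : Euc (n + 1)) 1) (ω : Sph n) : Sph n :=
  ⟨psiVec n η ω, by
    simpa using norm_psiVec n η ω (mem_ball_zero_iff.mp η.2) (by simp)⟩

/-- The Möbius transformation `Φ_η` of `B^d`, for `η ∈ B^d`:
`Φ_η(y) = ((1-|η|²)(y-η) - |y-η|²η) / (1-2η·y+|η|²|y|²)`. -/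
def phiEta (n : ℕ) (η y : Euc (n + 1)) : Euc (n + 1) :=
  (1 - 2 * inner ℝ η y + ‖η‖ ^ 2 * ‖y‖ ^ 2)⁻¹ • ((1 - ‖η‖ ^ 2) • (y - η) - ‖y - η‖ ^ 2 • η)

/-! ### Deficits, distances, and sharpness of the exponents -/

/-- The deficit `‖u‖_p^p - ‖Qu‖_q^p`. -/
def sphereDeficit (n : ℕ) (u : Sph n → ℝ) : ℝ :=
  sphereNorm n (expP n) u ^ expP n - ballNorm n (expQ n) (poissonExt n u) ^ expP n

/-- The dual deficit `‖v‖_{q'}^{q'} - ‖Sv‖_{p'}^{q'}`. -/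
def ballDeficit (n : ℕ) (v : Euc (n + 1) → ℝ) : ℝ :=
  ballNorm n (expQ' n) v ^ expQ' n - sphereNorm n (expP' n) (dualPoisson n v) ^ expQ' n

/-- `inf_Ψ ‖(u)_Ψ - 1‖_r^s`, over all Möbius transformations `Ψ` of `𝕊^{d-1}`. -/
def sphereDist (n : ℕ) (r s : ℝ) (u : Sph n → ℝ) : ℝ :=
  ⨅ Ψ : {Ψ : Sph n → Sph n // IsMoebiusSphere n Ψ},
    sphereNorm n r (fun ω => sphereAct n Ψ u ω - 1) ^ s

/-- `inf_Φ ‖[v]_Φ - 1‖_r^s`, over all Möbius transformations `Φ` of `B^d`. -/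
def ballDist (n : ℕ) (r s : ℝ) (v : Euc (n + 1) → ℝ) : ℝ :=
  ⨅ Φ : {Φ : Euc (n + 1) → Euc (n + 1) // IsMoebiusBall n Φ},
    ballNorm n r (fun y => ballAct n Φ v y - 1) ^ s

/-- A sequence with deficits `D j`, whose distance to the optimizers, raised to the power `s`, is
`dist s j`, shows that the stability exponent `r` cannot be lowered: the quotient of
`D j` by `dist r j` has a positive denominator for large `j` and its limes superior is finite, and
for `0 < s < r` and any `c > 0` the bound `D j ≥ c * dist s j` fails for all large `j`. -/
def ExponentSharp (D : ℕ → ℝ) (dist : ℝ → ℕ → ℝ) (r : ℝ) : Prop :=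
  (∀ᶠ j in atTop, 0 < dist r j) ∧
  limsup (fun j => ((D j / dist r j : ℝ) : EReal)) atTop < ⊤ ∧
  ∀ s, 0 < s → s < r → ∀ c, 0 < c → ∀ᶠ j in atTop, D j < c * dist s j

/-- `u_j ∈ L^p` with `‖u_j‖_p = 1` and `inf_Ψ ‖(u_j)_Ψ - 1‖_p → 0`, for which the deficit is
bounded by a constant times `inf_Ψ ‖(u_j)_Ψ - 1‖_r^r`. -/
def SphereSharp (n : ℕ) (r : ℝ) (u : ℕ → Sph n → ℝ) : Prop :=
  (∀ j, MemLp (u j) (ENNReal.ofReal (expP n)) (sphereMeasure n) ∧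
    sphereNorm n (expP n) (u j) = 1) ∧
  Tendsto (fun j => sphereDist n (expP n) 1 (u j)) atTop (𝓝 0) ∧
  ExponentSharp (fun j => sphereDeficit n (u j)) (fun s j => sphereDist n r s (u j)) r

/-- `v_j ∈ L^{q'}` with `‖v_j‖_{q'} = 1` and `inf_Φ ‖[v_j]_Φ - 1‖_{q'} → 0`, for which the dual
deficit is bounded by a constant times `inf_Φ ‖[v_j]_Φ - 1‖_{q'}^2`. -/
def BallSharp (n : ℕ) (v : ℕ → Euc (n + 1) → ℝ) : Prop :=
  (∀ j, MemLp (v j) (ENNReal.ofReal (expQ' n)) (ballMeasure n) ∧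
    ballNorm n (expQ' n) (v j) = 1) ∧
  Tendsto (fun j => ballDist n (expQ' n) 1 (v j)) atTop (𝓝 0) ∧
  ExponentSharp (fun j => ballDeficit n (v j)) (fun s j => ballDist n (expQ' n) s (v j)) 2

/-- `φ ∈ C^∞(𝕊^{d-1})` is not identically zero and satisfies `∫ φ dμ = ∫ φ ω_i dμ = 0` for
`i = 1, …, d`. -/
def IsAdmissible (n : ℕ) (φ : Sph n → ℝ) : Prop :=
  ContMDiff (𝓡 n) 𝓘(ℝ, ℝ) ((⊤ : ℕ∞) : WithTop ℕ∞) φ ∧ φ ≠ 0 ∧ ∫ ω, φ ω ∂(sphereMeasure n) = 0 ∧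
  ∀ i, ∫ ω : Sph n, φ ω * (ω : Euc (n + 1)) i ∂(sphereMeasure n) = 0

/-- `u / ‖u‖_p`. -/
def sphereNormalize (n : ℕ) (u : Sph n → ℝ) (ω : Sph n) : ℝ :=
  (sphereNorm n (expP n) u)⁻¹ * u ω

/-- `v / ‖v‖_{q'}`. -/
def ballNormalize (n : ℕ) (v : Euc (n + 1) → ℝ) (y : Euc (n + 1)) : ℝ :=
  (ballNorm n (expQ' n) v)⁻¹ * v y

/-- The second-order perturbation `λ (1 + ε φ)` of the optimizer `1`, normalized in `L^p`. -/
def perturbation (n : ℕ) (φ : Sph n → ℝ) (ε : ℝ) : Sph n → ℝ :=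
  sphereNormalize n fun ω => 1 + ε * φ ω

/-- The two-bubble function `λ (1 + δ (1)_{Ψ_η})`, normalized in `L^p`. -/
def sphereTwoBubble (n : ℕ) (δ : ℝ) (η : ball (0 : Euc (n + 1)) 1) : Sph n → ℝ :=
  sphereNormalize n fun ω => 1 + δ * sphereAct n (psiEta n η) (fun _ => 1) ω

/-- The two-bubble function `λ (1 + δ [1]_{Φ_η})`, normalized in `L^{q'}`. -/
def ballTwoBubble (n : ℕ) (δ : ℝ) (η : Euc (n + 1)) : Euc (n + 1) → ℝ :=
  ballNormalize n fun y => 1 + δ * ballAct n (phiEta n η) (fun _ => 1) y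

end HWY

end

/-!
All three families of functions are explicit, and the exponents are read off from two estimates: an
upper bound for the deficit, and a lower bound for the distance to *every* optimizer.

*Deficits.* The sharp inequality itself is not needed. The Poisson kernel has mass one in either
variable (`integral_poissonKernel`, `integral_ball_poissonKernel`), so `Q` and `S` preserve means,
and Jensen's inequality gives `‖Qu‖_q ≥ ∫ u dμ` and `‖Sv‖_{p'} ≥ ∫ v dν`. Hence the deficit of a
normalized function is at most the defect in Jensen's inequality
(`sphereDeficit_normalize_le`, `ballDeficit_normalize_le`). That defect is `O(ε²)` for a bounded
perturbation of `1` of size `ε` (`integral_one_add_mul_rpow_le`), and `O(δ ^ p)` for two bubbles on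
the sphere whose interaction is made negligible by the concentration of the second one
(`integral_twoBubble_rpow_le`).

*Optimizers.* Möbius transformations act on the light cone over `E ∪ {∞}` by Lorentz
transformations (`IsMoebius.isLorentz`). If the sphere or the ball is preserved, this gives
`|Ψ x - Ψ z|² = g(Ψ x) g(Ψ z) |x - z|²` with an explicit positive function `g = confFactor b`
depending on a vector `b` only (`IsMoebiusSphere.exists_confFactor`,
`IsMoebiusBall.exists_confFactor`). Consequently the Jacobian is a power of `g ∘ Ψ`, and by the
change of variables `inf_Ψ ‖(u)_Ψ - 1‖_p` becomes a distance from `u` to the family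
`confPow k b = g ^ (-k)`, indexed by `b` (`IsMoebiusSphere.exists_sphereNorm_eq`,
`IsMoebiusBall.exists_le_ballNorm`).

*Distances.* If `b` is large compared to the perturbation, `confPow k b` is too far from `1` in
`L¹` (`le_integral_abs_one_sub_confPow`). If `b` is of the order of the perturbation,
`confPow k b` is affine in the space variable up to higher order terms. For a bounded perturbation
one then integrates against a function orthogonal to all affine functions but not to the
perturbation (`exists_le_integral_abs_sub_confPow`): this is `φ` itself on the sphere, and a second
difference quotient in the ball, where the bubble is not affine (`exists_secondDiff`). For two
bubbles on the sphere one integrates against the power `w ^ (p - 1)` of the concentrated bubble,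
which hardly sees the bounded difference `1 - confPow k b`
(`exists_le_sphereNorm_twoBubble_sub`).
-/

namespace HWY

/-! ### Light cone coordinates and Möbius transformations -/

section LightCone

variable {E : Type} [NormedAddCommGroup E]

/-- The light cone embedding `y ↦ (y, 1, |y|²)`, `∞ ↦ (0, 0, 1)` of `E ∪ {∞}`. -/
noncomputable def lightLift (x : OnePoint E) : E × ℝ × ℝ :=
  x.elim (0, 0, 1) fun y => (y, 1, ‖y‖ ^ 2)

@[simp] lemma lightLift_coe (y : E) : lightLift (y : OnePoint E) = (y, 1, ‖y‖ ^ 2) := rfl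

@[simp] lemma lightLift_infty : lightLift (OnePoint.infty : OnePoint E) = (0, 0, 1) := rfl

variable [InnerProductSpace ℝ E]

/-- The Lorentzian form `x · x' - (s t' + t s') / 2` on `E × ℝ × ℝ`, in null coordinates `s`, `t`. -/
noncomputable def lightForm (X Y : E × ℝ × ℝ) : ℝ :=
  inner ℝ X.1 Y.1 - (X.2.1 * Y.2.2 + X.2.2 * Y.2.1) / 2

lemma lightForm_comm (X Y : E × ℝ × ℝ) : lightForm X Y = lightForm Y X := by
  simp only [lightForm, real_inner_comm]
  ring

lemma lightForm_add_left (X X' Y : E × ℝ × ℝ) :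
    lightForm (X + X') Y = lightForm X Y + lightForm X' Y := by
  simp only [lightForm, Prod.fst_add, Prod.snd_add, inner_add_left]
  ring

lemma lightForm_smul_left (c : ℝ) (X Y : E × ℝ × ℝ) :
    lightForm (c • X) Y = c * lightForm X Y := by
  simp only [lightForm, Prod.smul_fst, Prod.smul_snd, real_inner_smul_left, smul_eq_mul]
  ring

lemma lightForm_smul_right (c : ℝ) (X Y : E × ℝ × ℝ) :
    lightForm X (c • Y) = c * lightForm X Y := by
  rw [lightForm_comm, lightForm_smul_left, lightForm_comm]

lemma lightLift_eq_of_eq_smul {x y : OnePoint E} {c : ℝ} (h : lightLift x = c • lightLift y) :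
    x = y := by
  induction x using OnePoint.rec with
  | infty =>
    induction y using OnePoint.rec with
    | infty => rfl
    | coe y =>
      simp only [lightLift_infty, lightLift_coe, Prod.smul_mk, Prod.mk.injEq, smul_eq_mul] at h
      obtain ⟨-, h1, h2⟩ := h
      rw [mul_one] at h1
      simp [← h1] at h2
  | coe x =>
    induction y using OnePoint.rec with
    | infty =>
      simp at h
    | coe y =>
      simp only [lightLift_coe, Prod.smul_mk, Prod.mk.injEq, smul_eq_mul, mul_one] at h
      obtain ⟨h0, h1, -⟩ := h
      rw [h0, ← h1, one_smul]

/-- The reflection `X ↦ X - 2 ⟨X, N⟩ N` in the hyperplane orthogonal to a unit spacelike `N`. -/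
noncomputable def lightReflection (N : E × ℝ × ℝ) (hN : lightForm N N = 1) :
    (E × ℝ × ℝ) ≃ₗ[ℝ] (E × ℝ × ℝ) :=
  LinearEquiv.ofInvolutive
    { toFun := fun X => X - (2 * lightForm X N) • N
      map_add' := fun X Y => by rw [lightForm_add_left]; module
      map_smul' := fun c X => by rw [lightForm_smul_left, RingHom.id_apply]; module }
    (fun X => by
      have h : lightForm (X - (2 * lightForm X N) • N) N = - lightForm X N := by
        rw [sub_eq_add_neg, ← neg_smul, lightForm_add_left, lightForm_smul_left, hN]
        ring
      simp only [LinearMap.coe_mk, AddHom.coe_mk, h]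
      module)

lemma lightReflection_apply (N : E × ℝ × ℝ) (hN : lightForm N N = 1) (X : E × ℝ × ℝ) :
    lightReflection N hN X = X - (2 * lightForm X N) • N := rfl

lemma lightReflection_lightReflection (N : E × ℝ × ℝ) (hN : lightForm N N = 1) (X : E × ℝ × ℝ) :
    lightReflection N hN (lightReflection N hN X) = X :=
  (lightReflection N hN).left_inv X

lemma lightForm_lightReflection (N : E × ℝ × ℝ) (hN : lightForm N N = 1) (X Y : E × ℝ × ℝ) :
    lightForm (lightReflection N hN X) (lightReflection N hN Y) = lightForm X Y := by
  simp only [lightReflection_apply, sub_eq_add_neg, ← neg_smul, lightForm_add_left,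
    lightForm_smul_left]
  rw [lightForm_comm X, lightForm_comm N]
  simp only [lightForm_add_left, lightForm_smul_left, hN]
  rw [lightForm_comm Y X, lightForm_comm N X]
  ring

/-- `ψ` is covered by a Lorentz transformation of the light cone. -/
def IsLorentz (ψ : OnePoint E → OnePoint E) : Prop :=
  Function.Bijective ψ ∧ ∃ L : (E × ℝ × ℝ) ≃ₗ[ℝ] (E × ℝ × ℝ),
    (∀ X Y, lightForm (L X) (L Y) = lightForm X Y) ∧
    ∀ x, ∃ σ : ℝ, 0 < σ ∧ L (lightLift x) = σ • lightLift (ψ x)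

lemma IsLorentz.reflection_comp {ψ g : OnePoint E → OnePoint E} (hψ : IsLorentz ψ)
    (N : E × ℝ × ℝ) (hN : lightForm N N = 1)
    (hg : ∀ x, ∃ σ : ℝ, 0 < σ ∧ lightReflection N hN (lightLift x) = σ • lightLift (g x)) :
    IsLorentz (g ∘ ψ) := by
  obtain ⟨hb, L, hL, hLψ⟩ := hψ
  have hinv : Function.Involutive g := by
    intro x
    obtain ⟨σ, hσ, h1⟩ := hg x
    obtain ⟨σ', hσ', h2⟩ := hg (g x)
    have h3 := lightReflection_lightReflection N hN (lightLift x)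
    rw [h1, map_smul, h2, smul_smul] at h3
    exact (lightLift_eq_of_eq_smul h3.symm).symm
  refine ⟨hinv.bijective.comp hb, L.trans (lightReflection N hN), fun X Y => ?_, fun x => ?_⟩
  · simp only [LinearEquiv.trans_apply, lightForm_lightReflection, hL]
  · obtain ⟨σ, hσ, h1⟩ := hLψ x
    obtain ⟨σ', hσ', h2⟩ := hg (ψ x)
    refine ⟨σ * σ', mul_pos hσ hσ', ?_⟩
    rw [LinearEquiv.trans_apply, h1, map_smul, h2, smul_smul, Function.comp]

theorem IsMoebius.isLorentz {ψ : OnePoint E → OnePoint E} (h : IsMoebius ψ) : IsLorentz ψ := by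
  induction h with
  | id =>
    exact ⟨Function.bijective_id, LinearEquiv.refl ℝ _, fun _ _ => rfl,
      fun x => ⟨1, one_pos, by simp⟩⟩
  | hyperplane a t ha ψ _ ih =>
    have hN : lightForm ((a, 0, 2 * t) : E × ℝ × ℝ) (a, 0, 2 * t) = 1 := by
      simp [lightForm, ha]
    refine ih.reflection_comp _ hN fun x => ⟨1, one_pos, ?_⟩
    rw [one_smul, lightReflection_apply]
    induction x using OnePoint.rec with
    | infty =>
      simp [hyperplaneReflection, lightForm]
    | coe y =>
      simp only [hyperplaneReflection, OnePoint.map_some, lightLift_coe, lightForm,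
        Prod.smul_mk, Prod.mk_sub_mk, smul_eq_mul, Prod.mk.injEq]
      refine ⟨?_, by ring, ?_⟩
      · rw [real_inner_comm]
        congr 2
        ring
      · rw [norm_sub_sq_real, norm_smul, ha, real_inner_smul_right, real_inner_comm,
          Real.norm_eq_abs, mul_one, sq_abs]
        ring
  | sphere a R hR ψ _ ih =>
    have hN : lightForm ((R⁻¹ • a, R⁻¹, R⁻¹ * (‖a‖ ^ 2 - R ^ 2)) : E × ℝ × ℝ)
        (R⁻¹ • a, R⁻¹, R⁻¹ * (‖a‖ ^ 2 - R ^ 2)) = 1 := by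
      simp only [lightForm, real_inner_self_eq_norm_sq, norm_smul, norm_inv,
        Real.norm_of_nonneg hR.le]
      field_simp
      ring
    refine ih.reflection_comp _ hN fun x => ?_
    rw [lightReflection_apply]
    induction x using OnePoint.rec with
    | infty =>
      refine ⟨(R ^ 2)⁻¹, by positivity, ?_⟩
      simp only [sphereReflection, OnePoint.elim_infty, lightLift_infty, lightLift_coe, lightForm,
        Prod.smul_mk, Prod.mk_sub_mk, smul_eq_mul, Prod.mk.injEq, inner_zero_left]
      refine ⟨?_, by field_simp; ring, by field_simp; ring⟩
      rw [smul_smul, zero_sub, ← neg_smul]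
      congr 1
      field_simp
      ring
    | coe y =>
      have hB : lightForm ((y, 1, ‖y‖ ^ 2) : E × ℝ × ℝ)
          (R⁻¹ • a, R⁻¹, R⁻¹ * (‖a‖ ^ 2 - R ^ 2)) = R⁻¹ * ((R ^ 2 - ‖y - a‖ ^ 2) / 2) := by
        simp only [lightForm, real_inner_smul_right, norm_sub_sq_real]
        ring
      by_cases hy : y = a
      · refine ⟨R ^ 2, by positivity, ?_⟩
        have hs : sphereReflection a R (y : OnePoint E) = OnePoint.infty := by
          simp [sphereReflection, hy]
        rw [hs, lightLift_infty, lightLift_coe, hB, hy]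
        simp only [Prod.smul_mk, Prod.mk_sub_mk, smul_eq_mul, Prod.mk.injEq, sub_self, norm_zero]
        refine ⟨?_, by field_simp; ring, by field_simp; ring⟩
        rw [smul_smul, smul_zero, sub_eq_zero]
        conv_lhs => rw [← one_smul ℝ a]
        congr 1
        field_simp
        ring
      · have hne : ‖y - a‖ ≠ 0 := norm_ne_zero_iff.mpr (sub_ne_zero.mpr hy)
        refine ⟨‖y - a‖ ^ 2 / R ^ 2, by positivity, ?_⟩
        have hs : sphereReflection a R (y : OnePoint E) =
            (((R / ‖y - a‖) ^ 2 • (y - a) + a : E) : OnePoint E) := by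
          simp [sphereReflection, hy, EuclideanGeometry.inversion, dist_eq_norm]
        rw [hs, lightLift_coe, lightLift_coe, hB]
        simp only [Prod.smul_mk, Prod.mk_sub_mk, smul_eq_mul, Prod.mk.injEq]
        refine ⟨?_, by field_simp; ring, ?_⟩
        · rw [smul_add, smul_smul, smul_smul]
          have e1 : ‖y - a‖ ^ 2 / R ^ 2 * (R / ‖y - a‖) ^ 2 = 1 := by field_simp
          have e2 : 2 * (R⁻¹ * ((R ^ 2 - ‖y - a‖ ^ 2) / 2)) * R⁻¹ = 1 - ‖y - a‖ ^ 2 / R ^ 2 := by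
            field_simp
          rw [e1, e2]
          module
        · have e3 : ‖y‖ ^ 2 = ‖y - a‖ ^ 2 + 2 * inner ℝ (y - a) a + ‖a‖ ^ 2 := by
            rw [← norm_add_sq_real, sub_add_cancel]
          rw [norm_add_sq_real ((R / ‖y - a‖) ^ 2 • (y - a)) a, norm_smul, real_inner_smul_left, e3,
            Real.norm_of_nonneg (by positivity)]
          field_simp
          ring

end LightCone

/-! ### Conformal factors of Möbius transformations of the sphere and of the ball -/

section ConfFactor

variable {E : Type*} [NormedAddCommGroup E]

lemma sq_sqrt_one_add (b : E) : √(1 + ‖b‖ ^ 2) ^ 2 = 1 + ‖b‖ ^ 2 :=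
  Real.sq_sqrt (by positivity)

lemma one_le_sqrt_one_add (b : E) : 1 ≤ √(1 + ‖b‖ ^ 2) :=
  Real.one_le_sqrt.mpr (by nlinarith [sq_nonneg ‖b‖])

lemma norm_lt_sqrt_one_add (b : E) : ‖b‖ < √(1 + ‖b‖ ^ 2) := by
  apply Real.lt_sqrt_of_sq_lt
  linarith

variable [InnerProductSpace ℝ E]

/-- The function `(γ + 1) / 2 + b · y + (γ - 1) |y|² / 2` with `γ = √(1 + |b|²)`. With
`ζ = -b / (1 + γ)`, a point of the unit ball, it equals
`(1 - 2 ζ · y + |ζ|² |y|²) / (1 - |ζ|²)`, the reciprocal of the conformal factor of a Möbius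
transformation of the ball; on the unit sphere it reduces to `γ + b · y`. The parameter `b` ranges
over the whole space. -/
noncomputable def confFactor (b y : E) : ℝ :=
  (√(1 + ‖b‖ ^ 2) + 1) / 2 + inner ℝ b y + (√(1 + ‖b‖ ^ 2) - 1) / 2 * ‖y‖ ^ 2

lemma confFactor_pos (b : E) {y : E} (hy : ‖y‖ ≤ 1) : 0 < confFactor b y := by
  have h1 := sq_sqrt_one_add b
  have h2 := norm_lt_sqrt_one_add b
  have h3 := one_le_sqrt_one_add b
  have h4 : -(‖b‖ * ‖y‖) ≤ inner ℝ b y := neg_le_of_abs_le (abs_real_inner_le_norm b y)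
  have h5 : ‖b‖ * ‖y‖ ≤ ‖b‖ := mul_le_of_le_one_right (norm_nonneg b) hy
  have h6 : 0 < (√(1 + ‖b‖ ^ 2) + 1) * 2 * confFactor b y := by
    have : (√(1 + ‖b‖ ^ 2) + 1) * 2 * confFactor b y =
        (√(1 + ‖b‖ ^ 2) + 1) ^ 2 + 2 * (√(1 + ‖b‖ ^ 2) + 1) * inner ℝ b y
          + (‖b‖ * ‖y‖) ^ 2 := by
      rw [confFactor, mul_pow, show ‖b‖ ^ 2 = √(1 + ‖b‖ ^ 2) ^ 2 - 1 by linarith]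
      rw [show 1 + (√(1 + ‖b‖ ^ 2) ^ 2 - 1) = 1 + ‖b‖ ^ 2 by linarith]
      ring
    rw [this]
    nlinarith [sq_nonneg (√(1 + ‖b‖ ^ 2) + 1 - ‖b‖ * ‖y‖)]
  exact pos_of_mul_pos_right h6 (by positivity)

lemma confFactor_le (b : E) {y : E} (hy : ‖y‖ ≤ 1) : confFactor b y ≤ √(1 + ‖b‖ ^ 2) + ‖b‖ := by
  have h3 := one_le_sqrt_one_add b
  have h4 : inner ℝ b y ≤ ‖b‖ * ‖y‖ := real_inner_le_norm b y
  have h5 : ‖b‖ * ‖y‖ ≤ ‖b‖ := mul_le_of_le_one_right (norm_nonneg b) hy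
  have h6 : ‖y‖ ^ 2 ≤ 1 := pow_le_one₀ (norm_nonneg y) hy
  rw [confFactor]
  nlinarith

lemma confFactor_of_norm_eq_one (b : E) {y : E} (hy : ‖y‖ = 1) :
    confFactor b y = √(1 + ‖b‖ ^ 2) + inner ℝ b y := by
  rw [confFactor, hy]
  ring

@[fun_prop]
lemma continuous_confFactor (b : E) : Continuous (confFactor b) := by
  unfold confFactor
  fun_prop

end ConfFactor

section Sphere

/-- The linear isomorphism `(x, ρ) ↦ (x', ρ + x_d, ρ - x_d)`, with `x = (x', x_d)`, between
Minkowski space `ℝ^{n+1} × ℝ` and `ℝ^n × ℝ × ℝ` with null coordinates. -/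
noncomputable def minkowskiEquiv (n : ℕ) : (Euc (n + 1) × ℝ) ≃ₗ[ℝ] (Euc n × ℝ × ℝ) where
  toFun X := (WithLp.toLp 2 fun i => X.1 i.castSucc, X.2 + X.1 (Fin.last n), X.2 - X.1 (Fin.last n))
  invFun Y := (WithLp.toLp 2 (Fin.snoc (α := fun _ => ℝ) (fun i => Y.1 i) ((Y.2.1 - Y.2.2) / 2)),
    (Y.2.1 + Y.2.2) / 2)
  map_add' X Y := by
    ext i <;> simp <;> ring
  map_smul' c X := by
    ext i <;> simp <;> ring
  left_inv X := by
    ext i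
    · refine Fin.lastCases ?_ (fun j => ?_) i <;> simp
    · simp
  right_inv Y := by
    ext i
    · simp
    · simp
      ring
    · simp
      ring

lemma lightForm_minkowskiEquiv (n : ℕ) (X Y : Euc (n + 1) × ℝ) :
    lightForm (minkowskiEquiv n X) (minkowskiEquiv n Y) = inner ℝ X.1 Y.1 - X.2 * Y.2 := by
  have h : inner ℝ X.1 Y.1 = (∑ i : Fin n, Y.1 i.castSucc * X.1 i.castSucc) +
      Y.1 (Fin.last n) * X.1 (Fin.last n) := by
    rw [PiLp.inner_apply, Fin.sum_univ_castSucc]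
    rfl
  have h2 : inner ℝ (minkowskiEquiv n X).1 (minkowskiEquiv n Y).1 =
      ∑ i : Fin n, Y.1 i.castSucc * X.1 i.castSucc := by
    rw [PiLp.inner_apply]
    rfl
  rw [lightForm, h, h2]
  simp only [minkowskiEquiv, LinearEquiv.coe_mk, LinearMap.coe_mk, AddHom.coe_mk]
  ring

lemma minkowskiEquiv_stereo (n : ℕ) (x : OnePoint (Euc n)) :
    ∃ c : ℝ, 0 < c ∧ minkowskiEquiv n ((stereo n x : Euc (n + 1)), 1) = c • lightLift x := by
  induction x using OnePoint.rec with
  | infty =>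
    refine ⟨2, by norm_num, ?_⟩
    ext i
    · simp [minkowskiEquiv, stereo]
    · simp [minkowskiEquiv, stereo]
    · simp [minkowskiEquiv, stereo]
      norm_num
  | coe ξ =>
    have h : (1 + ‖ξ‖ ^ 2) ≠ 0 := by positivity
    refine ⟨2 / (1 + ‖ξ‖ ^ 2), by positivity, ?_⟩
    ext i
    · simp [minkowskiEquiv, stereo, stereoVec]
      ring
    · simp [minkowskiEquiv, stereo, stereoVec]
      field_simp
      ring
    · simp [minkowskiEquiv, stereo, stereoVec]
      field_simp
      ring

lemma exists_minkowskiEquiv_eq_smul (n : ℕ) (x : Sph n) :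
    ∃ (y : OnePoint (Euc n)) (c : ℝ), 0 < c ∧
      minkowskiEquiv n ((x : Euc (n + 1)), 1) = c • lightLift y := by
  have hx : ‖(x : Euc (n + 1))‖ = 1 := by simp
  have h0 : lightForm (minkowskiEquiv n ((x : Euc (n + 1)), 1))
      (minkowskiEquiv n ((x : Euc (n + 1)), 1)) = 0 := by
    rw [lightForm_minkowskiEquiv, real_inner_self_eq_norm_sq, hx]
    norm_num
  set P := minkowskiEquiv n ((x : Euc (n + 1)), 1) with hP
  have hst : P.2.1 + P.2.2 = 2 := by
    simp only [hP, minkowskiEquiv, LinearEquiv.coe_mk, LinearMap.coe_mk, AddHom.coe_mk]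
    ring
  rw [lightForm, real_inner_self_eq_norm_sq] at h0
  have h1 : ‖P.1‖ ^ 2 = P.2.1 * P.2.2 := by linarith
  by_cases hs : P.2.1 = 0
  · refine ⟨OnePoint.infty, 2, by norm_num, ?_⟩
    have h2 : P.1 = 0 := by
      rw [hs, zero_mul] at h1
      simpa using h1
    ext i
    · simp [h2]
    · simp [hs]
    · simp
      linarith
  · refine ⟨((P.2.1⁻¹ • P.1 : Euc n) : OnePoint (Euc n)), P.2.1, ?_, ?_⟩
    · rcases lt_or_gt_of_ne hs with h | h
      · nlinarith [sq_nonneg ‖P.1‖]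
      · exact h
    · have h3 : P.2.1 * ‖P.2.1⁻¹ • P.1‖ ^ 2 = P.2.2 := by
        rw [norm_smul, mul_pow, h1, norm_inv, inv_pow, Real.norm_eq_abs, sq_abs]
        field_simp
      ext i
      · simp [hs]
      · simp
      · simp only [lightLift_coe, Prod.smul_mk, smul_eq_mul]
        exact h3.symm

lemma minkowskiEquiv_smul_eq {n : ℕ} {x z : Euc (n + 1)} {c : ℝ}
    (h : minkowskiEquiv n (x, 1) = c • minkowskiEquiv n (z, 1)) : x = z := by
  rw [← map_smul] at h
  have := (minkowskiEquiv n).injective h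
  simp only [Prod.smul_mk, smul_eq_mul, mul_one, Prod.mk.injEq] at this
  rw [this.1, ← this.2, one_smul]

lemma stereo_bijective (n : ℕ) : Function.Bijective (stereo n) := by
  constructor
  · intro x y h
    obtain ⟨c, hc, h1⟩ := minkowskiEquiv_stereo n x
    obtain ⟨c', hc', h2⟩ := minkowskiEquiv_stereo n y
    rw [h, h2] at h1
    refine lightLift_eq_of_eq_smul (c := c⁻¹ * c') ?_
    rw [mul_smul, h1, smul_smul, inv_mul_cancel₀ hc.ne', one_smul]
  · intro x
    obtain ⟨y, c, hc, h1⟩ := exists_minkowskiEquiv_eq_smul n x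
    obtain ⟨c', hc', h2⟩ := minkowskiEquiv_stereo n y
    refine ⟨y, Subtype.ext (minkowskiEquiv_smul_eq (c := c' * c⁻¹) ?_)⟩
    rw [h2, h1, smul_smul, mul_assoc, inv_mul_cancel₀ hc.ne', mul_one]

/-- A Möbius transformation of the sphere is a bijection, it is smooth, and it distorts distances
by the conformal factor `confFactor b` in the image variable, for a suitable vector `b`. -/
theorem IsMoebiusSphere.exists_confFactor {n : ℕ} {Ψ : Sph n → Sph n} (h : IsMoebiusSphere n Ψ) :
    Function.Bijective Ψ ∧ (∀ x ≠ 0, DifferentiableAt ℝ (radialExt n Ψ) x) ∧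
    ∃ b : Euc (n + 1), ∀ x z : Sph n, ‖(Ψ x : Euc (n + 1)) - Ψ z‖ ^ 2 =
      confFactor b (Ψ x : Euc (n + 1)) * confFactor b (Ψ z : Euc (n + 1)) *
        ‖(x : Euc (n + 1)) - z‖ ^ 2 := by
  obtain ⟨ψ, hψ, hΨ⟩ := h
  obtain ⟨hbij, L, hL, hLψ⟩ := hψ.isLorentz
  have hSb := stereo_bijective n
  have hΨb : Function.Bijective Ψ := by
    have : Ψ ∘ stereo n = stereo n ∘ ψ := funext hΨ
    rw [← Function.Bijective.of_comp_iff Ψ hSb, this]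
    exact hSb.comp hbij
  -- the lift of `Ψ` to Minkowski space
  let A : (Euc (n + 1) × ℝ) ≃ₗ[ℝ] (Euc (n + 1) × ℝ) :=
    (minkowskiEquiv n).trans (L.trans (minkowskiEquiv n).symm)
  have hAform : ∀ X Y, inner ℝ (A X).1 (A Y).1 - (A X).2 * (A Y).2 =
      inner ℝ X.1 Y.1 - X.2 * Y.2 := by
    intro X Y
    rw [← lightForm_minkowskiEquiv, ← lightForm_minkowskiEquiv,
      ← hL (minkowskiEquiv n X) (minkowskiEquiv n Y)]
    simp [A]
  have hA : ∀ x : Sph n, ∃ σ : ℝ, 0 < σ ∧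
      A ((x : Euc (n + 1)), 1) = σ • ((Ψ x : Euc (n + 1)), (1 : ℝ)) := by
    intro x
    obtain ⟨y, rfl⟩ := hSb.2 x
    obtain ⟨c, hc, h1⟩ := minkowskiEquiv_stereo n y
    obtain ⟨c', hc', h2⟩ := minkowskiEquiv_stereo n (ψ y)
    obtain ⟨σ, hσ, h3⟩ := hLψ y
    refine ⟨c * σ * c'⁻¹, by positivity, (minkowskiEquiv n).injective ?_⟩
    rw [map_smul, hΨ, h2]
    simp only [A, LinearEquiv.trans_apply, LinearEquiv.apply_symm_apply]
    rw [h1, map_smul, h3, smul_smul, smul_smul, mul_assoc (c * σ), inv_mul_cancel₀ hc'.ne', mul_one]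
  choose σ hσ hAσ using hA
  have hA1 : ∀ x : Sph n, (A ((x : Euc (n + 1)), 1)).1 = σ x • (Ψ x : Euc (n + 1)) :=
    fun x => by rw [hAσ]; rfl
  have hA2 : ∀ x : Sph n, (A ((x : Euc (n + 1)), 1)).2 = σ x := fun x => by rw [hAσ]; simp
  -- distances are governed by `σ`
  have hdist : ∀ x z : Sph n, σ x * σ z * ‖(Ψ x : Euc (n + 1)) - Ψ z‖ ^ 2 =
      ‖(x : Euc (n + 1)) - z‖ ^ 2 := by
    intro x z
    have h1 := hAform ((x : Euc (n + 1)), 1) ((z : Euc (n + 1)), 1)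
    rw [hA1, hA1, hA2, hA2, real_inner_smul_left, real_inner_smul_right] at h1
    rw [norm_sub_sq_real, norm_sub_sq_real]
    simp only [norm_eq_of_mem_sphere]
    linarith
  -- `1 / σ` is the time component of the inverse lift, an affine function of `Ψ x`
  set P := A (0, 1) with hP
  have hσinv : ∀ x : Sph n, σ x * (P.2 - inner ℝ P.1 (Ψ x : Euc (n + 1))) = 1 := by
    intro x
    have h1 := hAform ((x : Euc (n + 1)), 1) (0, 1)
    rw [hA1, hA2, real_inner_smul_left, inner_zero_right, ← hP, real_inner_comm] at h1
    linarith
  have hPnorm : P.2 ^ 2 = 1 + ‖P.1‖ ^ 2 := by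
    have h1 := hAform (0, 1) (0, 1)
    rw [← hP, real_inner_self_eq_norm_sq, inner_zero_right] at h1
    linarith
  have hg : ∀ x : Sph n, 0 < P.2 - inner ℝ P.1 (x : Euc (n + 1)) := by
    intro x
    obtain ⟨z, rfl⟩ := hΨb.2 x
    exact pos_of_mul_pos_right (by rw [hσinv]; exact one_pos) (hσ z).le
  have hPpos : 0 < P.2 := by
    let e : Sph n := stereo n OnePoint.infty
    have h1 := hg e
    have h2 := hg (-e)
    rw [coe_neg_sphere, inner_neg_right] at h2
    linarith
  have hb : ∀ x : Sph n, confFactor (-P.1) (x : Euc (n + 1)) =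
      P.2 - inner ℝ P.1 (x : Euc (n + 1)) := by
    intro x
    rw [confFactor_of_norm_eq_one _ (by simp), norm_neg, ← hPnorm, Real.sqrt_sq hPpos.le,
      inner_neg_left]
    ring
  refine ⟨hΨb, fun x hx => ?_, -P.1, fun x z => ?_⟩
  · -- the radial extension is a quotient of linear maps applied to `(x, |x|)`
    let A' : (Euc (n + 1) × ℝ) →L[ℝ] (Euc (n + 1) × ℝ) := A.toLinearMap.toContinuousLinearMap
    have hA'0 : ∀ y : Euc (n + 1), ∀ hy : y ≠ 0, ∃ s : Sph n,
        (s : Euc (n + 1)) = ‖y‖⁻¹ • y ∧ radialExt n Ψ y = ‖y‖ • (Ψ s : Euc (n + 1)) ∧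
        A (y, ‖y‖) = ‖y‖ • A ((s : Euc (n + 1)), 1) := by
      intro y hy
      have hy' : ‖y‖ ≠ 0 := norm_ne_zero_iff.mpr hy
      refine ⟨⟨‖y‖⁻¹ • y, by simp [norm_smul, hy']⟩, rfl, by simp [radialExt, hy], ?_⟩
      rw [← map_smul]
      simp [hy']
    have hev : radialExt n Ψ =ᶠ[𝓝 x] fun y => (‖y‖ * ((A' (y, ‖y‖)).2)⁻¹) • (A' (y, ‖y‖)).1 := by
      filter_upwards [isOpen_ne.mem_nhds hx] with y hy
      obtain ⟨s, -, h2, h3⟩ := hA'0 y hy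
      have hy' : ‖y‖ ≠ 0 := norm_ne_zero_iff.mpr hy
      change _ = (‖y‖ * (A (y, ‖y‖)).2⁻¹) • (A (y, ‖y‖)).1
      rw [h2, h3, Prod.smul_fst, Prod.smul_snd, hA1, hA2, smul_smul, smul_smul, smul_eq_mul]
      congr 1
      have := (hσ s).ne'
      field_simp
    refine DifferentiableAt.congr_of_eventuallyEq ?_ hev
    have hn : DifferentiableAt ℝ (fun y : Euc (n + 1) => ‖y‖) x :=
      differentiableAt_id.norm ℝ hx
    have hpair : DifferentiableAt ℝ (fun y : Euc (n + 1) => A' (y, ‖y‖)) x :=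
      A'.differentiableAt.comp x (differentiableAt_id.prodMk hn)
    have hne : (A' (x, ‖x‖)).2 ≠ 0 := by
      obtain ⟨s, -, -, h3⟩ := hA'0 x hx
      change (A (x, ‖x‖)).2 ≠ 0
      rw [h3, Prod.smul_snd, hA2]
      exact mul_ne_zero (norm_ne_zero_iff.mpr hx) (hσ s).ne'
    exact (hn.mul (hpair.snd.inv hne)).smul hpair.fst
  · rw [hb, hb, ← hdist x z]
    have h1 := hσinv x
    have h2 := hσinv z
    calc ‖(Ψ x : Euc (n + 1)) - Ψ z‖ ^ 2
        = (σ x * (P.2 - inner ℝ P.1 (Ψ x : Euc (n + 1)))) *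
          (σ z * (P.2 - inner ℝ P.1 (Ψ z : Euc (n + 1)))) *
            ‖(Ψ x : Euc (n + 1)) - Ψ z‖ ^ 2 := by rw [h1, h2]; ring
      _ = _ := by ring

end Sphere

section Ball

/-- A Möbius transformation of the ball is a bijection of the ball, it is smooth there, and it
distorts distances by the conformal factor `confFactor b` in the image variable, for a suitable
vector `b`. -/
theorem IsMoebiusBall.exists_confFactor {n : ℕ} {Φ : Euc (n + 1) → Euc (n + 1)}
    (h : IsMoebiusBall n Φ) :
    Φ '' ball 0 1 = ball 0 1 ∧ Set.InjOn Φ (ball 0 1) ∧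
    (∀ y ∈ ball (0 : Euc (n + 1)) 1, DifferentiableAt ℝ Φ y) ∧
    ∃ b : Euc (n + 1), ∀ y ∈ ball (0 : Euc (n + 1)) 1, ∀ z ∈ ball (0 : Euc (n + 1)) 1,
      ‖Φ y - Φ z‖ ^ 2 = confFactor b (Φ y) * confFactor b (Φ z) * ‖y - z‖ ^ 2 := by
  obtain ⟨φ, hφ, himg, hφΦ⟩ := h
  obtain ⟨hbij, L, hL, hLφ⟩ := hφ.isLorentz
  have hinj : Function.Injective ((↑) : Euc (n + 1) → OnePoint (Euc (n + 1))) :=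
    OnePoint.coe_injective
  have hΦimg : Φ '' ball 0 1 = ball 0 1 := by
    apply hinj.image_injective
    beta_reduce
    rw [← himg, Set.image_image, Set.image_image]
    exact Set.image_congr fun y hy => (hφΦ y hy).symm
  have hΦinj : Set.InjOn Φ (ball 0 1) := by
    intro y hy z hz hyz
    apply hinj
    apply hbij.1
    rw [hφΦ y hy, hφΦ z hz, hyz]
  have hσ' : ∀ y : Euc (n + 1), ∃ σ : ℝ, y ∈ ball (0 : Euc (n + 1)) 1 →
      0 < σ ∧ L (lightLift (y : OnePoint (Euc (n + 1)))) = σ • (Φ y, (1 : ℝ), ‖Φ y‖ ^ 2) := by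
    intro y
    obtain ⟨σ, h1, h2⟩ := hLφ y
    refine ⟨σ, fun hy => ⟨h1, ?_⟩⟩
    rw [h2, hφΦ y hy]
    rfl
  choose σ hσ using hσ'
  have hσpos : ∀ y ∈ ball (0 : Euc (n + 1)) 1, 0 < σ y := fun y hy => (hσ y hy).1
  have hLσ : ∀ y ∈ ball (0 : Euc (n + 1)) 1,
      L (y, 1, ‖y‖ ^ 2) = σ y • (Φ y, (1 : ℝ), ‖Φ y‖ ^ 2) := fun y hy => (hσ y hy).2
  have hdist : ∀ y ∈ ball (0 : Euc (n + 1)) 1, ∀ z ∈ ball (0 : Euc (n + 1)) 1,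
      σ y * σ z * ‖Φ y - Φ z‖ ^ 2 = ‖y - z‖ ^ 2 := by
    intro y hy z hz
    have h1 := hL (y, 1, ‖y‖ ^ 2) (z, 1, ‖z‖ ^ 2)
    rw [hLσ y hy, hLσ z hz, lightForm_smul_left, lightForm_smul_right] at h1
    simp only [lightForm] at h1
    rw [norm_sub_sq_real, norm_sub_sq_real]
    linarith
  -- `N₀` represents the unit sphere; the ball being preserved, `N₀` is fixed
  set N₀ : Euc (n + 1) × ℝ × ℝ := (0, 1, -1) with hN₀
  obtain ⟨N₁, hN₁⟩ := L.surjective N₀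
  have hform : ∀ y : Euc (n + 1), ∃ τ : ℝ, 0 < τ ∧
      lightForm (lightLift (y : OnePoint (Euc (n + 1)))) N₁ =
        τ * lightForm (lightLift (φ y)) N₀ := by
    intro y
    obtain ⟨τ, h1, h2⟩ := hLφ y
    refine ⟨τ, h1, ?_⟩
    rw [← hL, h2, hN₁, lightForm_smul_left]
  have hN₀form : ∀ z : Euc (n + 1), lightForm (lightLift (z : OnePoint (Euc (n + 1)))) N₀ =
      (1 - ‖z‖ ^ 2) / 2 := by
    intro z
    simp only [lightForm, lightLift_coe, hN₀, inner_zero_right]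
    ring
  set f : Euc (n + 1) → ℝ :=
    fun y => lightForm (lightLift (y : OnePoint (Euc (n + 1)))) N₁ with hf
  have hfeq : ∀ y, f y = inner ℝ y N₁.1 - (N₁.2.2 + ‖y‖ ^ 2 * N₁.2.1) / 2 := by
    intro y
    simp only [hf, lightForm, lightLift_coe]
    ring
  have hfcont : Continuous f := by
    rw [funext hfeq]
    fun_prop
  have hfin : ∀ y ∈ ball (0 : Euc (n + 1)) 1, 0 < f y := by
    intro y hy
    obtain ⟨τ, h1, h2⟩ := hform y
    have hm : Φ y ∈ ball (0 : Euc (n + 1)) 1 := by rw [← hΦimg]; exact ⟨y, hy, rfl⟩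
    rw [mem_ball_zero_iff] at hm
    have : f y = τ * ((1 - ‖Φ y‖ ^ 2) / 2) := by
      rw [← hN₀form, ← hφΦ y hy]
      exact h2
    rw [this]
    have : ‖Φ y‖ ^ 2 < 1 := pow_lt_one₀ (norm_nonneg _) hm two_ne_zero
    apply mul_pos h1
    linarith
  have hfout : ∀ y : Euc (n + 1), ‖y‖ = 1 → f y ≤ 0 := by
    intro y hy
    obtain ⟨τ, h1, h2⟩ := hform y
    change f y = _ at h2
    rw [h2]
    apply mul_nonpos_of_nonneg_of_nonpos h1.le
    rcases h3 : φ y with _ | z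
    · change lightForm (lightLift OnePoint.infty) N₀ ≤ 0
      simp [lightForm, hN₀]
    · change lightForm (lightLift (z : OnePoint (Euc (n + 1)))) N₀ ≤ 0
      rw [hN₀form]
      by_contra hlt
      have hz : z ∈ ball (0 : Euc (n + 1)) 1 := by
        rw [mem_ball_zero_iff]
        nlinarith [norm_nonneg z]
      have : φ y ∈ φ '' ((↑) '' ball (0 : Euc (n + 1)) 1) := by
        rw [himg, h3]
        exact ⟨z, hz, rfl⟩
      obtain ⟨w, ⟨v, hv, rfl⟩, hw⟩ := this
      have hvy := hinj (hbij.1 hw)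
      rw [hvy, mem_ball_zero_iff] at hv
      linarith
  have hfbd : ∀ y : Euc (n + 1), ‖y‖ = 1 → f y = 0 := by
    intro y hy
    apply le_antisymm (hfout y hy)
    have hyc : y ∈ closure (ball (0 : Euc (n + 1)) 1) := by
      rw [closure_ball _ one_ne_zero]
      simp [hy]
    exact closure_minimal (fun z hz => (hfin z hz).le) (isClosed_le continuous_const hfcont) hyc
  have hst : N₁.2.2 = - N₁.2.1 := by
    have h1 := hfbd (EuclideanSpace.single 0 1) (by simp)
    have h2 := hfbd (-EuclideanSpace.single 0 1) (by simp)
    rw [hfeq] at h1 h2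
    rw [inner_neg_left] at h2
    simp at h1 h2
    linarith
  have hp : N₁.1 = 0 := by
    by_contra hne
    have hne' : ‖N₁.1‖ ≠ 0 := norm_ne_zero_iff.mpr hne
    have h1 := hfbd (‖N₁.1‖⁻¹ • N₁.1) (by simp [norm_smul, hne'])
    rw [hfeq, real_inner_smul_left, real_inner_self_eq_norm_sq, norm_smul, norm_inv, norm_norm,
      inv_mul_cancel₀ hne', hst] at h1
    field_simp at h1
    have : 0 < ‖N₁.1‖ := by positivity
    linarith
  have hN₁N₁ : lightForm N₁ N₁ = 1 := by
    rw [← hL, hN₁]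
    simp [lightForm, hN₀]
  have hs1 : N₁.2.1 = 1 := by
    rw [lightForm, hp, hst, inner_zero_left] at hN₁N₁
    have h1 := hfin 0 (by simp)
    rw [hfeq, hst] at h1
    simp at h1
    nlinarith
  have hN : L N₀ = N₀ := by
    have : N₁ = N₀ := by
      ext i
      · simp [hp, hN₀]
      · simp [hs1, hN₀]
      · simp [hst, hs1, hN₀]
    rw [← this, hN₁, this]
  -- the image of `e = (0, 0, 1)` determines the conformal factor in the image variable
  set Q := L (0, 0, 1) with hQ
  have hQQ : lightForm Q Q = 0 := by
    rw [hQ, hL]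
    simp [lightForm]
  have hQN : lightForm Q N₀ = -1 / 2 := by
    rw [hQ, ← hN, hL]
    simp [lightForm, hN₀]
    norm_num
  have ht : Q.2.2 = Q.2.1 + 1 := by
    simp only [lightForm, hN₀, inner_zero_right] at hQN
    linarith
  have hnull : ‖Q.1‖ ^ 2 = Q.2.1 * (Q.2.1 + 1) := by
    rw [lightForm, real_inner_self_eq_norm_sq, ht] at hQQ
    linarith
  have hσinv : ∀ y ∈ ball (0 : Euc (n + 1)) 1,
      σ y * (Q.2.2 - 2 * inner ℝ (Φ y) Q.1 + Q.2.1 * ‖Φ y‖ ^ 2) = 1 := by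
    intro y hy
    have h1 := hL (y, 1, ‖y‖ ^ 2) (0, 0, 1)
    rw [← hQ, hLσ y hy, lightForm_smul_left] at h1
    simp only [lightForm, inner_zero_right] at h1
    linarith
  have hQ2 : 0 < Q.2.2 := by
    have h0 : (0 : Euc (n + 1)) ∈ Φ '' ball 0 1 := by rw [hΦimg]; simp
    obtain ⟨y, hy, hy0⟩ := h0
    have h1 := hσinv y hy
    rw [hy0] at h1
    simp at h1
    exact pos_of_mul_pos_right (by rw [h1]; exact one_pos) (hσpos y hy).le
  have hQ1 : 0 ≤ Q.2.1 := by
    by_contra hlt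
    nlinarith [sq_nonneg ‖Q.1‖]
  have hb : ∀ y, confFactor ((-2 : ℝ) • Q.1) y =
      Q.2.2 - 2 * inner ℝ y Q.1 + Q.2.1 * ‖y‖ ^ 2 := by
    intro y
    have h1 : 1 + ‖(-2 : ℝ) • Q.1‖ ^ 2 = (2 * Q.2.1 + 1) ^ 2 := by
      rw [norm_smul, mul_pow, hnull]
      norm_num
      ring
    rw [confFactor, h1, Real.sqrt_sq (by positivity), real_inner_smul_left, real_inner_comm, ht]
    ring
  refine ⟨hΦimg, hΦinj, fun y hy => ?_, (-2 : ℝ) • Q.1, fun y hy z hz => ?_⟩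
  · let L' : (Euc (n + 1) × ℝ × ℝ) →L[ℝ] (Euc (n + 1) × ℝ × ℝ) :=
      L.toLinearMap.toContinuousLinearMap
    have hev : Φ =ᶠ[𝓝 y] fun z => ((L' (z, 1, ‖z‖ ^ 2)).2.1)⁻¹ • (L' (z, 1, ‖z‖ ^ 2)).1 := by
      filter_upwards [isOpen_ball.mem_nhds hy] with z hz
      change _ = (L (z, 1, ‖z‖ ^ 2)).2.1⁻¹ • (L (z, 1, ‖z‖ ^ 2)).1
      rw [hLσ z hz]
      simp [smul_smul, (hσpos z hz).ne']
    refine DifferentiableAt.congr_of_eventuallyEq ?_ hev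
    have hpair : DifferentiableAt ℝ (fun z : Euc (n + 1) => L' (z, 1, ‖z‖ ^ 2)) y :=
      L'.differentiableAt.comp y (differentiableAt_id.prodMk ((differentiableAt_const _).prodMk
        (differentiableAt_id.norm_sq ℝ)))
    have hne : (L' (y, 1, ‖y‖ ^ 2)).2.1 ≠ 0 := by
      change (L (y, 1, ‖y‖ ^ 2)).2.1 ≠ 0
      rw [hLσ y hy]
      simp [(hσpos y hy).ne']
    exact (hpair.snd.fst.inv hne).smul hpair.fst
  · rw [hb, hb, ← hdist y hy z hz]
    have h1 := hσinv y hy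
    have h2 := hσinv z hz
    calc ‖Φ y - Φ z‖ ^ 2
        = (σ y * (Q.2.2 - 2 * inner ℝ (Φ y) Q.1 + Q.2.1 * ‖Φ y‖ ^ 2)) *
          (σ z * (Q.2.2 - 2 * inner ℝ (Φ z) Q.1 + Q.2.1 * ‖Φ z‖ ^ 2)) *
            ‖Φ y - Φ z‖ ^ 2 := by rw [h1, h2]; ring
      _ = _ := by ring

end Ball

/-! ### Jacobians of conformal maps -/

section Det

variable {E : Type*} [NormedAddCommGroup E] [InnerProductSpace ℝ E] [FiniteDimensional ℝ E]

lemma abs_det_eq_of_norm_eq {S T : E →ₗ[ℝ] E} (h : ∀ v, ‖S v‖ = ‖T v‖) :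
    |LinearMap.det S| = |LinearMap.det T| := by
  let b := stdOrthonormalBasis ℝ E
  have hin : ∀ v w, inner ℝ (S v) (S w) = inner ℝ (T v) (T w) := by
    intro v w
    rw [real_inner_eq_norm_add_mul_self_sub_norm_mul_self_sub_norm_mul_self_div_two,
      real_inner_eq_norm_add_mul_self_sub_norm_mul_self_sub_norm_mul_self_div_two,
      ← map_add, ← map_add, h, h, h]
  have h1 : S.normDet ^ 2 = T.normDet ^ 2 := by
    have hS := S.normDet_sq_eq_det_gram b
    have hT := T.normDet_sq_eq_det_gram b
    have : Matrix.gram ℝ (S <| b ·) = Matrix.gram ℝ (T <| b ·) := by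
      ext i j
      simp [Matrix.gram_apply, hin]
    rw [this, ← hT] at hS
    exact_mod_cast hS
  have h2 := (sq_eq_sq₀ S.normDet_nonneg T.normDet_nonneg).mp h1
  rwa [S.normDet_eq_norm_det, T.normDet_eq_norm_det, Real.norm_eq_abs, Real.norm_eq_abs] at h2

omit [FiniteDimensional ℝ E] in
lemma tendsto_slope_of_hasFDerivAt {F : Type*} [NormedAddCommGroup F] [NormedSpace ℝ F]
    {f : E → F} {f' : E →L[ℝ] F} {x : E} (hf : HasFDerivAt f f' x) (v : E) :
    Tendsto (fun t : ℝ => t⁻¹ • (f (x + t • v) - f x)) (𝓝[≠] 0) (𝓝 (f' v)) := by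
  have h := hasDerivAt_iff_tendsto_slope_zero.mp (hf.hasLineDerivAt v)
  simpa using h

lemma abs_det_fderiv_of_dist {F : E → E} {k : E → ℝ} {x : E} (hF : DifferentiableAt ℝ F x)
    (hk : ContinuousAt k x) (hk0 : 0 ≤ k x)
    (h : ∀ᶠ y in 𝓝 x, ‖F y - F x‖ ^ 2 = k y * k x * ‖y - x‖ ^ 2) :
    |(fderiv ℝ F x).det| = k x ^ Module.finrank ℝ E := by
  have hnorm : ∀ v, ‖fderiv ℝ F x v‖ = ‖k x • v‖ := by
    intro v
    have h1 := ((tendsto_slope_of_hasFDerivAt hF.hasFDerivAt v).norm).pow 2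
    have hline : Tendsto (fun t : ℝ => x + t • v) (𝓝[≠] 0) (𝓝 x) := by
      have : Continuous fun t : ℝ => x + t • v := by fun_prop
      simpa using (this.tendsto 0).mono_left nhdsWithin_le_nhds
    have h2 : Tendsto (fun t : ℝ => k (x + t • v) * k x * ‖v‖ ^ 2) (𝓝[≠] 0)
        (𝓝 (k x * k x * ‖v‖ ^ 2)) :=
      ((hk.tendsto.comp hline).mul_const _).mul_const _
    have h3 : (fun t : ℝ => ‖t⁻¹ • (F (x + t • v) - F x)‖ ^ 2) =ᶠ[𝓝[≠] 0]
        fun t : ℝ => k (x + t • v) * k x * ‖v‖ ^ 2 := by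
      filter_upwards [hline.eventually h, self_mem_nhdsWithin] with t ht ht0
      have ht0' : t ≠ 0 := ht0
      rw [norm_smul, mul_pow, ht, add_sub_cancel_left, norm_smul, mul_pow, norm_inv,
        Real.norm_eq_abs, inv_pow, sq_abs]
      field_simp
    have h4 := tendsto_nhds_unique (h1.congr' h3) h2
    have h5 : ‖fderiv ℝ F x v‖ ^ 2 = ‖k x • v‖ ^ 2 := by
      rw [h4, norm_smul, mul_pow, Real.norm_eq_abs, sq_abs]
      ring
    exact (sq_eq_sq₀ (norm_nonneg _) (norm_nonneg _)).mp h5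
  have h6 := abs_det_eq_of_norm_eq (S := (fderiv ℝ F x).toLinearMap)
    (T := k x • (LinearMap.id : E →ₗ[ℝ] E)) hnorm
  rw [LinearMap.det_smul, LinearMap.det_id, mul_one, abs_pow, abs_of_nonneg hk0] at h6
  exact h6

/-- The determinant of a linear map which is an isometry from the line spanned by `u` onto a line
and a similarity of ratio `k` on the orthogonal complement of `u`, in the sense of the induced
quadratic form. -/
lemma abs_det_of_norm_sq {T : E →ₗ[ℝ] E} {u : E} (hu : ‖u‖ = 1) {k : ℝ} (hk : 0 < k) {n : ℕ}
    (hn : Module.finrank ℝ E = n + 1)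
    (h : ∀ v, ‖T v‖ ^ 2 = (1 - k ^ 2) * inner ℝ u v ^ 2 + k ^ 2 * ‖v‖ ^ 2) :
    |LinearMap.det T| = k ^ n := by
  let f : Module.Dual ℝ E := ((1 - k) / k) • (innerSL ℝ u).toLinearMap
  have hf : ∀ v, f v = (1 - k) / k * inner ℝ u v := fun v => by simp [f]
  have hnorm : ∀ v, ‖T v‖ = ‖(k • LinearMap.transvection f u) v‖ := by
    intro v
    have : ‖T v‖ ^ 2 = ‖(k • LinearMap.transvection f u) v‖ ^ 2 := by
      rw [h, LinearMap.smul_apply, LinearMap.transvection.apply, norm_smul, mul_pow,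
        norm_add_sq_real, norm_smul, hu, real_inner_smul_right, hf, Real.norm_eq_abs,
        Real.norm_eq_abs, mul_one, sq_abs, sq_abs, real_inner_comm]
      field_simp
      ring
    exact (sq_eq_sq₀ (norm_nonneg _) (norm_nonneg _)).mp this
  rw [abs_det_eq_of_norm_eq hnorm, LinearMap.det_smul, LinearMap.transvection.det, hf,
    real_inner_self_eq_norm_sq, hu, hn]
  have : k ^ (n + 1) * (1 + (1 - k) / k * 1 ^ 2) = k ^ n := by
    field_simp
    ring
  rw [this, abs_of_pos (by positivity)]

end Det

/-! ### The uniform measures on the sphere and on the ball -/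

instance (n : ℕ) : Nonempty (Sph n) := ⟨stereo n OnePoint.infty⟩

instance (n : ℕ) : IsProbabilityMeasure (ballMeasure n) where
  measure_univ := by
    rw [ballMeasure, Measure.smul_apply, Measure.restrict_apply_univ, smul_eq_mul]
    exact ENNReal.inv_mul_cancel (measure_ball_pos _ _ one_pos).ne' measure_ball_lt_top.ne

/-- The direction `x / |x|` of a vector, with a fixed value at `0`. -/
noncomputable def sphereDir (n : ℕ) (x : Euc (n + 1)) : Sph n :=
  if hx : x = 0 then stereo n OnePoint.infty
  else ⟨‖x‖⁻¹ • x, by simp [norm_smul, norm_ne_zero_iff.mpr hx]⟩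

lemma coe_sphereDir {n : ℕ} {x : Euc (n + 1)} (hx : x ≠ 0) :
    (sphereDir n x : Euc (n + 1)) = ‖x‖⁻¹ • x := by
  simp [sphereDir, hx]

lemma norm_smul_sphereDir {n : ℕ} {x : Euc (n + 1)} (hx : x ≠ 0) :
    ‖x‖ • (sphereDir n x : Euc (n + 1)) = x := by
  rw [coe_sphereDir hx, smul_smul, mul_inv_cancel₀ (norm_ne_zero_iff.mpr hx), one_smul]

lemma sphereDir_smul {n : ℕ} {r : ℝ} (hr : 0 < r) (ω : Sph n) :
    sphereDir n (r • (ω : Euc (n + 1))) = ω := by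
  have h0 : r • (ω : Euc (n + 1)) ≠ 0 := smul_ne_zero hr.ne' (ne_zero_of_mem_unit_sphere ω)
  apply Subtype.ext
  rw [coe_sphereDir h0, norm_smul, norm_eq_of_mem_sphere, mul_one, Real.norm_of_nonneg hr.le,
    smul_smul, inv_mul_cancel₀ hr.ne', one_smul]

lemma continuousOn_sphereDir (n : ℕ) : ContinuousOn (sphereDir n) {0}ᶜ := by
  rw [Topology.IsEmbedding.subtypeVal.continuousOn_iff]
  have : ContinuousOn (fun x : Euc (n + 1) => ‖x‖⁻¹ • x) {0}ᶜ :=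
    (continuous_norm.continuousOn.inv₀ fun x hx => norm_ne_zero_iff.mpr hx).smul continuousOn_id
  exact this.congr fun x hx => coe_sphereDir hx

lemma measurable_sphereDir (n : ℕ) : Measurable (sphereDir n) :=
  measurable_of_continuousOn_compl_singleton 0 (continuousOn_sphereDir n)

open scoped Pointwise in
/-- The uniform measure on the sphere is the image of the uniform measure on the ball under the
radial projection. -/
theorem sphereMeasure_eq_map (n : ℕ) :
    sphereMeasure n = (ballMeasure n).map (sphereDir n) := by
  ext s hs
  rw [Measure.map_apply (measurable_sphereDir n) hs, sphereMeasure, ballMeasure,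
    Measure.smul_apply, Measure.smul_apply, Measure.toSphere_apply_univ,
    Measure.toSphere_apply' _ hs, Measure.restrict_apply (measurable_sphereDir n hs), smul_eq_mul,
    smul_eq_mul]
  have hset : (Set.Ioo (0 : ℝ) 1 • ((↑) '' s : Set (Euc (n + 1)))) =
      (sphereDir n ⁻¹' s ∩ ball 0 1) \ {0} := by
    ext x
    constructor
    · rintro ⟨r, hr, -, ⟨ω, hω, rfl⟩, rfl⟩
      refine ⟨⟨?_, ?_⟩, smul_ne_zero hr.1.ne' (ne_zero_of_mem_unit_sphere ω)⟩
      · rw [Set.mem_preimage]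
        beta_reduce
        rw [sphereDir_smul hr.1]
        exact hω
      · simp [norm_smul, abs_of_pos hr.1, hr.2]
    · rintro ⟨⟨h1, h2⟩, h3⟩
      have h3' : x ≠ 0 := h3
      exact ⟨‖x‖, ⟨norm_pos_iff.mpr h3', mem_ball_zero_iff.mp h2⟩, _, ⟨_, h1, rfl⟩,
        norm_smul_sphereDir h3'⟩
  rw [hset, measure_sdiff_null (measure_singleton _)]
  have h0 : (Module.finrank ℝ (Euc (n + 1)) : ℝ≥0∞) ≠ 0 := by simp
  have ht : (Module.finrank ℝ (Euc (n + 1)) : ℝ≥0∞) ≠ ⊤ := ENNReal.natCast_ne_top _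
  rw [ENNReal.mul_inv (Or.inl h0) (Or.inl ht), mul_mul_mul_comm,
    ENNReal.inv_mul_cancel h0 ht, one_mul]

instance (n : ℕ) : IsProbabilityMeasure (sphereMeasure n) := by
  rw [sphereMeasure_eq_map]
  exact Measure.isProbabilityMeasure_map (measurable_sphereDir n).aemeasurable

instance (n : ℕ) : (sphereMeasure n).IsOpenPosMeasure where
  open_pos U hU hne := by
    rw [sphereMeasure, Measure.smul_apply, smul_eq_mul]
    exact mul_ne_zero (ENNReal.inv_ne_zero.mpr (measure_ne_top _ _)) (hU.measure_ne_zero _ hne)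

lemma integral_sphereMeasure {n : ℕ} {f : Sph n → ℝ} (hf : Continuous f) :
    ∫ ω, f ω ∂(sphereMeasure n) = ∫ x, f (sphereDir n x) ∂(ballMeasure n) := by
  rw [sphereMeasure_eq_map, integral_map (measurable_sphereDir n).aemeasurable
    hf.aestronglyMeasurable]

lemma integral_ballMeasure {n : ℕ} (f : Euc (n + 1) → ℝ) :
    ∫ y, f y ∂(ballMeasure n) =
      (volume (ball (0 : Euc (n + 1)) 1)).toReal⁻¹ * ∫ y in ball 0 1, f y := by
  rw [ballMeasure, integral_smul_measure, ENNReal.toReal_inv, smul_eq_mul]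

lemma ae_mem_ball (n : ℕ) : ∀ᵐ y ∂(ballMeasure n), y ∈ ball (0 : Euc (n + 1)) 1 :=
  Measure.ae_smul_measure (ae_restrict_mem measurableSet_ball) _

lemma aestronglyMeasurable_of_continuousOn_ball {n : ℕ} {f : Euc (n + 1) → ℝ}
    (hf : ContinuousOn f (ball 0 1)) : AEStronglyMeasurable f (ballMeasure n) :=
  (hf.aestronglyMeasurable measurableSet_ball).smul_measure _

lemma integrable_of_continuous_sphere {n : ℕ} {f : Sph n → ℝ} (hf : Continuous f) :
    Integrable f (sphereMeasure n) :=
  hf.integrable_of_hasCompactSupport (HasCompactSupport.of_compactSpace f)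

/-! ### Conformal maps of the sphere and their change of variables -/

/-- `Ψ` is a bijection of the sphere with differentiable radial extension which is conformal
with factor `κ`, in the integrated form `|Ψ x - Ψ z|² = κ(x) κ(z) |x - z|²`. -/
structure IsConformal (n : ℕ) (Ψ : Sph n → Sph n) (κ : Sph n → ℝ) : Prop where
  bijective : Function.Bijective Ψ
  differentiableAt : ∀ x ≠ 0, DifferentiableAt ℝ (radialExt n Ψ) x
  continuous_factor : Continuous κ
  pos : ∀ x, 0 < κ x
  dist_sq : ∀ x z, ‖(Ψ x : Euc (n + 1)) - Ψ z‖ ^ 2 = κ x * κ z * ‖(x : Euc (n + 1)) - z‖ ^ 2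

lemma radialExt_of_ne_zero {n : ℕ} (Ψ : Sph n → Sph n) {x : Euc (n + 1)} (hx : x ≠ 0) :
    radialExt n Ψ x = ‖x‖ • (Ψ (sphereDir n x) : Euc (n + 1)) := by
  simp [radialExt, sphereDir, hx]

lemma radialExt_coe {n : ℕ} (Ψ : Sph n → Sph n) (ω : Sph n) :
    radialExt n Ψ (ω : Euc (n + 1)) = Ψ ω := by
  have h := sphereDir_smul one_pos ω
  rw [one_smul] at h
  rw [radialExt_of_ne_zero Ψ (ne_zero_of_mem_unit_sphere ω), h, norm_eq_of_mem_sphere, one_smul]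

lemma continuous_of_differentiableAt_radialExt {n : ℕ} {Ψ : Sph n → Sph n}
    (h : ∀ x ≠ 0, DifferentiableAt ℝ (radialExt n Ψ) x) : Continuous Ψ := by
  rw [continuous_induced_rng]
  have : ((↑) : Sph n → Euc (n + 1)) ∘ Ψ = fun ω : Sph n => radialExt n Ψ (ω : Euc (n + 1)) :=
    funext fun ω => (radialExt_coe Ψ ω).symm
  rw [this, continuous_iff_continuousAt]
  intro ω
  exact (h _ (ne_zero_of_mem_unit_sphere ω)).continuousAt.comp continuous_subtype_val.continuousAt

lemma norm_smul_sub_smul_sq {E : Type*} [NormedAddCommGroup E] [InnerProductSpace ℝ E] {u v : E}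
    (hu : ‖u‖ = 1) (hv : ‖v‖ = 1) (r s : ℝ) :
    ‖r • u - s • v‖ ^ 2 = (r - s) ^ 2 + r * s * ‖u - v‖ ^ 2 := by
  rw [norm_sub_sq_real, norm_sub_sq_real, norm_smul, norm_smul, hu, hv, real_inner_smul_left,
    real_inner_smul_right, Real.norm_eq_abs, Real.norm_eq_abs, mul_one, mul_one, sq_abs, sq_abs]
  ring

section Conformal

variable {n : ℕ} {Ψ : Sph n → Sph n} {κ : Sph n → ℝ}

lemma IsConformal.continuous (h : IsConformal n Ψ κ) : Continuous Ψ :=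
  continuous_of_differentiableAt_radialExt h.differentiableAt

lemma IsConformal.radialExt_dist_sq (h : IsConformal n Ψ κ) {x y : Euc (n + 1)} (hx : x ≠ 0)
    (hy : y ≠ 0) : ‖radialExt n Ψ y - radialExt n Ψ x‖ ^ 2 =
      (1 - κ (sphereDir n y) * κ (sphereDir n x)) * (‖y‖ - ‖x‖) ^ 2 +
      κ (sphereDir n y) * κ (sphereDir n x) * ‖y - x‖ ^ 2 := by
  rw [radialExt_of_ne_zero Ψ hx, radialExt_of_ne_zero Ψ hy,
    norm_smul_sub_smul_sq (by simp) (by simp), h.dist_sq]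
  have h1 : ‖y - x‖ ^ 2 = (‖y‖ - ‖x‖) ^ 2 +
      ‖y‖ * ‖x‖ * ‖(sphereDir n y : Euc (n + 1)) - sphereDir n x‖ ^ 2 := by
    rw [← norm_smul_sub_smul_sq (by simp) (by simp), norm_smul_sphereDir hx,
      norm_smul_sphereDir hy]
  rw [h1]
  ring

lemma IsConformal.abs_det_fderiv (h : IsConformal n Ψ κ) {x : Euc (n + 1)} (hx : x ≠ 0) :
    |(fderiv ℝ (radialExt n Ψ) x).det| = κ (sphereDir n x) ^ n := by
  have hx0 : ‖x‖ ≠ 0 := norm_ne_zero_iff.mpr hx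
  set k : Euc (n + 1) → ℝ := fun y => κ (sphereDir n y) with hk
  have hkc : ContinuousAt k x :=
    (h.continuous_factor.comp_continuousOn (continuousOn_sphereDir n)).continuousAt
      (isOpen_compl_singleton.mem_nhds hx)
  have hnd : DifferentiableAt ℝ (fun y : Euc (n + 1) => ‖y‖) x := differentiableAt_id.norm ℝ hx
  have hnv : ∀ v, fderiv ℝ (fun y : Euc (n + 1) => ‖y‖) x v =
      inner ℝ (sphereDir n x : Euc (n + 1)) v := by
    intro v
    have h1 := (hasFDerivAt_id (𝕜 := ℝ) x).norm_sq
    have h2 := hnd.hasFDerivAt.pow 2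
    have h3 := congrArg (fun L => L v) (h1.unique h2)
    simp at h3
    rw [coe_sphereDir hx, real_inner_smul_left]
    field_simp
    linarith
  refine abs_det_of_norm_sq (u := (sphereDir n x : Euc (n + 1))) (by simp) (h.pos _)
    (by simp) fun v => ?_
  change ‖fderiv ℝ (radialExt n Ψ) x v‖ ^ 2 = _
  have hline : Tendsto (fun t : ℝ => x + t • v) (𝓝[≠] 0) (𝓝 x) := by
    have : Continuous fun t : ℝ => x + t • v := by fun_prop
    simpa using (this.tendsto 0).mono_left nhdsWithin_le_nhds
  have h1 := ((tendsto_slope_of_hasFDerivAt (h.differentiableAt x hx).hasFDerivAt v).norm).pow 2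
  have h2 := (tendsto_slope_of_hasFDerivAt hnd.hasFDerivAt v).pow 2
  have hkt := hkc.tendsto.comp hline
  have h3 : Tendsto (fun t : ℝ => (1 - k (x + t • v) * k x) *
      (t⁻¹ • (‖x + t • v‖ - ‖x‖)) ^ 2 + k (x + t • v) * k x * ‖v‖ ^ 2) (𝓝[≠] 0)
      (𝓝 ((1 - k x * k x) * (fderiv ℝ (fun y : Euc (n + 1) => ‖y‖) x v) ^ 2 +
        k x * k x * ‖v‖ ^ 2)) :=
    ((tendsto_const_nhds.sub (hkt.mul_const _)).mul h2).add ((hkt.mul_const _).mul_const _)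
  have h4 : (fun t : ℝ => ‖t⁻¹ • (radialExt n Ψ (x + t • v) - radialExt n Ψ x)‖ ^ 2)
      =ᶠ[𝓝[≠] 0] fun t : ℝ => (1 - k (x + t • v) * k x) *
      (t⁻¹ • (‖x + t • v‖ - ‖x‖)) ^ 2 + k (x + t • v) * k x * ‖v‖ ^ 2 := by
    filter_upwards [hline.eventually (isOpen_ne.mem_nhds hx), self_mem_nhdsWithin] with t ht ht0
    have ht0' : t ≠ 0 := ht0
    rw [norm_smul, mul_pow, h.radialExt_dist_sq hx ht, add_sub_cancel_left, norm_smul,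
      mul_pow ‖t‖, norm_inv, Real.norm_eq_abs, inv_pow, sq_abs, smul_eq_mul]
    field_simp
    simp only [hk]
    ring
  rw [tendsto_nhds_unique (h1.congr' h4) h3, hnv]
  ring

lemma IsConformal.sphereJac_eq (h : IsConformal n Ψ κ) (ω : Sph n) :
    sphereJac n Ψ ω = κ ω ^ n := by
  have h1 := sphereDir_smul one_pos ω
  rw [one_smul] at h1
  rw [sphereJac, h.abs_det_fderiv (ne_zero_of_mem_unit_sphere ω), h1]

/-- Change of variables on the sphere, from the change of variables for the radial extension. -/
theorem IsConformal.integral_comp (h : IsConformal n Ψ κ) {G : Sph n → ℝ} (hG : Continuous G) :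
    ∫ ω, κ ω ^ n * G (Ψ ω) ∂(sphereMeasure n) = ∫ ω, G ω ∂(sphereMeasure n) := by
  have hc : Continuous fun ω => κ ω ^ n * G (Ψ ω) :=
    (h.continuous_factor.pow n).mul (hG.comp h.continuous)
  rw [integral_sphereMeasure hc, integral_sphereMeasure hG, integral_ballMeasure,
    integral_ballMeasure]
  congr 1
  set B : Set (Euc (n + 1)) := ball 0 1 \ {0} with hB
  have hBae : (ball (0 : Euc (n + 1)) 1 : Set _) =ᵐ[volume] B :=
    (sdiff_null_ae_eq_self (measure_singleton _)).symm
  rw [setIntegral_congr_set hBae, setIntegral_congr_set hBae]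
  have hBm : MeasurableSet B := measurableSet_ball.diff (measurableSet_singleton 0)
  have hne : ∀ x ∈ B, x ≠ 0 := fun x hx => hx.2
  have hnorm : ∀ x ≠ 0, ‖radialExt n Ψ x‖ = ‖x‖ := by
    intro x hx
    rw [radialExt_of_ne_zero Ψ hx, norm_smul, norm_norm, norm_eq_of_mem_sphere, mul_one]
  have hdir : ∀ x ≠ 0, sphereDir n (radialExt n Ψ x) = Ψ (sphereDir n x) := by
    intro x hx
    rw [radialExt_of_ne_zero Ψ hx, sphereDir_smul (norm_pos_iff.mpr hx)]
  have himg : radialExt n Ψ '' B = B := by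
    ext x
    constructor
    · rintro ⟨y, hy, rfl⟩
      have h1 := hnorm y (hne y hy)
      refine ⟨?_, ?_⟩
      · rw [mem_ball_zero_iff, h1]
        exact mem_ball_zero_iff.mp hy.1
      · intro h0
        rw [Set.mem_singleton_iff] at h0
        rw [h0, norm_zero] at h1
        exact hne y hy (norm_eq_zero.mp h1.symm)
    · intro hx
      have hx0 := norm_pos_iff.mpr (hne x hx)
      obtain ⟨ω, hω⟩ := h.bijective.2 (sphereDir n x)
      have hne' : ‖x‖ • (ω : Euc (n + 1)) ≠ 0 :=
        smul_ne_zero hx0.ne' (ne_zero_of_mem_unit_sphere ω)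
      refine ⟨‖x‖ • (ω : Euc (n + 1)), ⟨?_, hne'⟩, ?_⟩
      · rw [mem_ball_zero_iff, norm_smul, norm_norm, norm_eq_of_mem_sphere, mul_one]
        exact mem_ball_zero_iff.mp hx.1
      · rw [radialExt_of_ne_zero Ψ hne', sphereDir_smul hx0, hω, norm_smul, norm_norm,
          norm_eq_of_mem_sphere, mul_one, norm_smul_sphereDir (hne x hx)]
  have hinj : Set.InjOn (radialExt n Ψ) B := by
    intro x hx y hy hxy
    have h1 : ‖x‖ = ‖y‖ := by rw [← hnorm x (hne x hx), hxy, hnorm y (hne y hy)]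
    have h2 : sphereDir n x = sphereDir n y := by
      apply h.bijective.1
      rw [← hdir x (hne x hx), hxy, hdir y (hne y hy)]
    rw [← norm_smul_sphereDir (hne x hx), ← norm_smul_sphereDir (hne y hy), h1, h2]
  have hcv := integral_image_eq_integral_abs_det_fderiv_smul volume hBm
    (fun x hx => (h.differentiableAt x (hne x hx)).hasFDerivAt.hasFDerivWithinAt) hinj
    (fun x => G (sphereDir n x))
  rw [himg] at hcv
  rw [hcv]
  refine setIntegral_congr_fun hBm fun x hx => ?_
  beta_reduce
  rw [h.abs_det_fderiv (hne x hx), hdir x (hne x hx), smul_eq_mul]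

end Conformal

/-! ### The Möbius transformations `Ψ_η` and the Poisson kernel -/

section PsiEta

variable {n : ℕ}

/-- The conformal factor `(1 - |η|²) / |ω - η|²` of `Ψ_η`. -/
noncomputable def etaFactor (n : ℕ) (η : Euc (n + 1)) (ω : Sph n) : ℝ :=
  (1 - ‖η‖ ^ 2) / ‖(ω : Euc (n + 1)) - η‖ ^ 2

lemma sub_ne_zero_of_mem_ball {η : Euc (n + 1)} (hη : ‖η‖ < 1) (ω : Sph n) :
    (ω : Euc (n + 1)) - η ≠ 0 := by
  intro h
  have h1 : ‖(ω : Euc (n + 1))‖ = ‖η‖ := by rw [sub_eq_zero.mp h]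
  rw [norm_eq_of_mem_sphere] at h1
  linarith

lemma one_sub_norm_sq_pos {E : Type*} [NormedAddCommGroup E] {η : E} (hη : ‖η‖ < 1) :
    0 < 1 - ‖η‖ ^ 2 := by
  nlinarith [norm_nonneg η]

lemma etaFactor_pos {η : Euc (n + 1)} (hη : ‖η‖ < 1) (ω : Sph n) : 0 < etaFactor n η ω := by
  have h1 := norm_pos_iff.mpr (sub_ne_zero_of_mem_ball hη ω)
  have h2 := one_sub_norm_sq_pos hη
  rw [etaFactor]
  positivity

lemma continuous_etaFactor {η : Euc (n + 1)} (hη : ‖η‖ < 1) : Continuous (etaFactor n η) := by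
  unfold etaFactor
  refine Continuous.div (by fun_prop) (by fun_prop) fun ω => ?_
  exact pow_ne_zero 2 (norm_ne_zero_iff.mpr (sub_ne_zero_of_mem_ball hη ω))

lemma norm_sub_sq_sphere (η : Euc (n + 1)) (ω : Sph n) :
    ‖(ω : Euc (n + 1)) - η‖ ^ 2 = 1 - 2 * inner ℝ η (ω : Euc (n + 1)) + ‖η‖ ^ 2 := by
  rw [norm_sub_sq_real, norm_eq_of_mem_sphere, real_inner_comm]
  ring

lemma coe_psiEta (η : ball (0 : Euc (n + 1)) 1) (ω : Sph n) :
    (psiEta n η ω : Euc (n + 1)) =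
      etaFactor n η ω • ((ω : Euc (n + 1)) - η) - (η : Euc (n + 1)) := by
  have hη : ‖(η : Euc (n + 1))‖ < 1 := mem_ball_zero_iff.mp η.2
  have h1 := norm_ne_zero_iff.mpr (sub_ne_zero_of_mem_ball hη ω)
  change psiVec n η ω = _
  rw [psiVec, ← norm_sub_sq_sphere, etaFactor, smul_sub, smul_smul, smul_smul,
    inv_mul_cancel₀ (pow_ne_zero 2 h1), one_smul, div_eq_inv_mul]

/-- The chord through `ω` and `η` meets the sphere again at `-Ψ_η(ω)`. -/
lemma neg_psiEta_sub (η : ball (0 : Euc (n + 1)) 1) (ω : Sph n) :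
    ((-psiEta n η ω : Sph n) : Euc (n + 1)) - η = -(etaFactor n η ω • ((ω : Euc (n + 1)) - η)) := by
  rw [coe_neg_sphere, coe_psiEta]
  module

lemma etaFactor_neg_psiEta (η : ball (0 : Euc (n + 1)) 1) (ω : Sph n) :
    etaFactor n η (-psiEta n η ω) = (etaFactor n η ω)⁻¹ := by
  have hη : ‖(η : Euc (n + 1))‖ < 1 := mem_ball_zero_iff.mp η.2
  have h1 := norm_ne_zero_iff.mpr (sub_ne_zero_of_mem_ball hη ω)
  have h2 := one_sub_norm_sq_pos hη
  rw [etaFactor, neg_psiEta_sub, norm_neg, norm_smul, Real.norm_of_nonneg (etaFactor_pos hη ω).le,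
    etaFactor]
  field_simp

lemma neg_psiEta_involutive (η : ball (0 : Euc (n + 1)) 1) :
    Function.Involutive fun ω => -psiEta n η ω := by
  intro ω
  have hη : ‖(η : Euc (n + 1))‖ < 1 := mem_ball_zero_iff.mp η.2
  apply Subtype.ext
  apply sub_left_injective (b := (η : Euc (n + 1)))
  beta_reduce
  rw [neg_psiEta_sub, neg_psiEta_sub, etaFactor_neg_psiEta, smul_neg, neg_neg, smul_smul,
    inv_mul_cancel₀ (etaFactor_pos hη ω).ne', one_smul]

lemma IsConformal.neg {Ψ : Sph n → Sph n} {κ : Sph n → ℝ} (h : IsConformal n Ψ κ) :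
    IsConformal n (fun ω => -Ψ ω) κ where
  bijective := (neg_involutive.bijective).comp h.bijective
  differentiableAt x hx := by
    have : radialExt n (fun ω => -Ψ ω) = -radialExt n Ψ := by
      ext1 y
      by_cases hy : y = 0
      · simp [radialExt, hy]
      · rw [Pi.neg_apply, radialExt_of_ne_zero _ hy, radialExt_of_ne_zero _ hy, coe_neg_sphere,
          smul_neg]
    rw [this]
    exact (h.differentiableAt x hx).neg
  continuous_factor := h.continuous_factor
  pos := h.pos
  dist_sq x z := by
    rw [coe_neg_sphere, coe_neg_sphere, neg_sub_neg, norm_sub_rev, h.dist_sq]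

theorem isConformal_psiEta (η : ball (0 : Euc (n + 1)) 1) :
    IsConformal n (psiEta n η) (etaFactor n η) := by
  have hη : ‖(η : Euc (n + 1))‖ < 1 := mem_ball_zero_iff.mp η.2
  refine ⟨?_, fun x hx => ?_, continuous_etaFactor hη, etaFactor_pos hη, fun x z => ?_⟩
  · have h1 := neg_involutive.bijective.comp (neg_psiEta_involutive η).bijective
    have h2 : psiEta n η = Neg.neg ∘ fun ω => -psiEta n η ω := by
      ext1 ω
      simp
    rw [h2]
    exact h1
  · have hev : radialExt n (psiEta n η) =ᶠ[𝓝 x] fun y => ‖y‖ • (((1 - ‖(η : Euc (n + 1))‖ ^ 2) *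
        (‖‖y‖⁻¹ • y - η‖ ^ 2)⁻¹) • (‖y‖⁻¹ • y - (η : Euc (n + 1))) - (η : Euc (n + 1))) := by
      filter_upwards [isOpen_ne.mem_nhds hx] with y hy
      rw [radialExt_of_ne_zero _ hy, coe_psiEta, etaFactor, coe_sphereDir hy, div_eq_mul_inv]
    refine DifferentiableAt.congr_of_eventuallyEq ?_ hev
    have hn : DifferentiableAt ℝ (fun y : Euc (n + 1) => ‖y‖) x := differentiableAt_id.norm ℝ hx
    have hu : DifferentiableAt ℝ (fun y : Euc (n + 1) => ‖y‖⁻¹ • y - (η : Euc (n + 1))) x :=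
      ((hn.inv (norm_ne_zero_iff.mpr hx)).smul differentiableAt_id).sub_const _
    have hne : ‖‖x‖⁻¹ • x - (η : Euc (n + 1))‖ ^ 2 ≠ 0 := by
      rw [← coe_sphereDir hx]
      exact pow_ne_zero 2 (norm_ne_zero_iff.mpr (sub_ne_zero_of_mem_ball hη _))
    exact hn.smul (((((hu.norm_sq ℝ).inv hne).const_mul _).smul hu).sub_const _)
  · have hx := norm_ne_zero_iff.mpr (sub_ne_zero_of_mem_ball hη x)
    have hz := norm_ne_zero_iff.mpr (sub_ne_zero_of_mem_ball hη z)
    have e1 : (x : Euc (n + 1)) - z = (x - η) - (z - (η : Euc (n + 1))) := by abel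
    rw [coe_psiEta, coe_psiEta, sub_sub_sub_cancel_right, e1]
    rw [etaFactor, etaFactor]
    generalize (x : Euc (n + 1)) - η = u at *
    generalize (z : Euc (n + 1)) - η = v at *
    rw [norm_sub_sq_real, norm_sub_sq_real, norm_smul, norm_smul,
      real_inner_smul_left, real_inner_smul_right, Real.norm_eq_abs, Real.norm_eq_abs, mul_pow,
      mul_pow, sq_abs, sq_abs]
    field_simp
    ring

lemma isConformal_isometry (U : Euc (n + 1) ≃ₗᵢ[ℝ] Euc (n + 1)) :
    IsConformal n (fun ω => ⟨U ω, by simp⟩) (fun _ => 1) where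
  bijective := by
    constructor
    · intro x z h
      exact Subtype.ext (U.injective (congrArg Subtype.val h))
    · intro x
      exact ⟨⟨U.symm x, by simp⟩, Subtype.ext (by simp)⟩
  differentiableAt x hx := by
    refine U.toContinuousLinearEquiv.differentiableAt.congr_of_eventuallyEq ?_
    filter_upwards [isOpen_ne.mem_nhds hx] with y hy
    rw [radialExt_of_ne_zero _ hy]
    change ‖y‖ • U _ = U y
    rw [← map_smul, norm_smul_sphereDir hy]
  continuous_factor := continuous_const
  pos _ := one_pos
  dist_sq x z := by
    rw [← map_sub, U.norm_map]
    ring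

lemma integral_comp_isometry (U : Euc (n + 1) ≃ₗᵢ[ℝ] Euc (n + 1)) {G : Euc (n + 1) → ℝ}
    (hG : Continuous G) :
    ∫ ω : Sph n, G (U ω) ∂(sphereMeasure n) = ∫ ω : Sph n, G ω ∂(sphereMeasure n) := by
  simpa using (isConformal_isometry U).integral_comp (G := fun ω => G ω) (by fun_prop)

lemma integral_etaFactor_pow {η : Euc (n + 1)} (hη : ‖η‖ < 1) :
    ∫ ω, etaFactor n η ω ^ n ∂(sphereMeasure n) = 1 := by
  have h := (isConformal_psiEta (n := n) ⟨η, mem_ball_zero_iff.mpr hη⟩).integral_comp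
    (G := fun _ => 1) continuous_const
  simpa using h

/-- Change of variables under the involution `-Ψ_η` exchanges the two powers of the conformal
factor whose exponents add up to `n`. -/
lemma integral_etaFactor_rpow_symm {η : Euc (n + 1)} (hη : ‖η‖ < 1) (s : ℝ) :
    ∫ ω, etaFactor n η ω ^ (n - s) ∂(sphereMeasure n) =
      ∫ ω, etaFactor n η ω ^ s ∂(sphereMeasure n) := by
  have hc : Continuous fun ω => etaFactor n η ω ^ s :=
    (continuous_etaFactor hη).rpow_const fun ω => Or.inl (etaFactor_pos hη ω).ne'
  obtain ⟨η', rfl⟩ : ∃ η' : ball (0 : Euc (n + 1)) 1, (η' : Euc (n + 1)) = η :=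
    ⟨⟨η, mem_ball_zero_iff.mpr hη⟩, rfl⟩
  have h := (isConformal_psiEta η').neg.integral_comp hc
  rw [← h]
  congr 1
  ext ω
  rw [etaFactor_neg_psiEta, Real.inv_rpow (etaFactor_pos hη ω).le,
    Real.rpow_sub (etaFactor_pos hη ω), Real.rpow_natCast, div_eq_mul_inv]

lemma etaFactor_rpow {η : Euc (n + 1)} (hη : ‖η‖ < 1) (s : ℝ) (ω : Sph n) :
    etaFactor n η ω ^ s = (1 - ‖η‖ ^ 2) ^ s * (‖(ω : Euc (n + 1)) - η‖ ^ 2) ^ (-s) := by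
  rw [etaFactor, Real.div_rpow (one_sub_norm_sq_pos hη).le (by positivity),
    Real.rpow_neg (by positivity), div_eq_mul_inv]

/-- The point `ω - r e` with `|r| ≤ R` stays at distance at least `1 - R` from the origin. -/
lemma sq_le_norm_sub_smul_sq {r R : ℝ} (hr : |r| ≤ R) (hR : R ≤ 1) (e ω : Sph n) :
    (1 - R) ^ 2 ≤ ‖(ω : Euc (n + 1)) - r • (e : Euc (n + 1))‖ ^ 2 := by
  have h1 := norm_sub_norm_le (ω : Euc (n + 1)) (r • (e : Euc (n + 1)))
  rw [norm_smul, norm_eq_of_mem_sphere, norm_eq_of_mem_sphere, mul_one, Real.norm_eq_abs] at h1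
  apply pow_le_pow_left₀ (by linarith)
  linarith

lemma hasDerivAt_integral_rpow (e : Sph n) (k : ℝ) (hk : 0 ≤ k) {r₀ : ℝ} (hr₀ : |r₀| < 1) :
    HasDerivAt (fun r : ℝ => ∫ ω : Sph n,
        (‖(ω : Euc (n + 1)) - r • (e : Euc (n + 1))‖ ^ 2) ^ (-k) ∂(sphereMeasure n))
      (∫ ω : Sph n, (2 * r₀ - 2 * inner ℝ (e : Euc (n + 1)) (ω : Euc (n + 1))) * -k *
        (‖(ω : Euc (n + 1)) - r₀ • (e : Euc (n + 1))‖ ^ 2) ^ (-k - 1) ∂(sphereMeasure n)) r₀ := by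
  set R : ℝ := (1 + |r₀|) / 2 with hR
  have hR1 : R < 1 := by rw [hR]; linarith
  have hrR : |r₀| < R := by rw [hR]; linarith
  have hpos : ∀ r : ℝ, |r| ≤ R → ∀ ω : Sph n,
      0 < ‖(ω : Euc (n + 1)) - r • (e : Euc (n + 1))‖ ^ 2 := fun r hr ω =>
    lt_of_lt_of_le (by nlinarith) (sq_le_norm_sub_smul_sq hr hR1.le e ω)
  have hcont : ∀ r : ℝ, |r| ≤ R → ∀ s : ℝ, Continuous fun ω : Sph n =>
      (‖(ω : Euc (n + 1)) - r • (e : Euc (n + 1))‖ ^ 2) ^ s := by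
    intro r hr s
    exact Continuous.rpow_const (by fun_prop) fun ω => Or.inl (hpos r hr ω).ne'
  have hs : {r : ℝ | |r| < R} ∈ 𝓝 r₀ := (isOpen_lt continuous_abs continuous_const).mem_nhds hrR
  refine (hasDerivAt_integral_of_dominated_loc_of_deriv_le
    (F := fun (r : ℝ) (ω : Sph n) => (‖(ω : Euc (n + 1)) - r • (e : Euc (n + 1))‖ ^ 2) ^ (-k))
    (F' := fun (r : ℝ) (ω : Sph n) =>
      (2 * r - 2 * inner ℝ (e : Euc (n + 1)) (ω : Euc (n + 1))) * -k *
        (‖(ω : Euc (n + 1)) - r • (e : Euc (n + 1))‖ ^ 2) ^ (-k - 1))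
    (bound := fun _ => 4 * k * ((1 - R) ^ 2) ^ (-k - 1)) hs ?_ ?_ ?_ ?_ ?_ ?_).2
  · filter_upwards [hs] with r hr
    exact (hcont r (le_of_lt hr) _).aestronglyMeasurable
  · exact integrable_of_continuous_sphere (hcont r₀ hrR.le _)
  · exact (Continuous.mul (by fun_prop) (hcont r₀ hrR.le _)).aestronglyMeasurable
  · refine Eventually.of_forall fun ω r hr => ?_
    have hr' : |r| < R := hr
    have hin : |inner ℝ (e : Euc (n + 1)) (ω : Euc (n + 1))| ≤ 1 := by
      simpa using abs_real_inner_le_norm (e : Euc (n + 1)) (ω : Euc (n + 1))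
    rw [norm_mul, norm_mul, norm_neg, Real.norm_of_nonneg hk,
      Real.norm_of_nonneg (Real.rpow_nonneg (hpos r hr'.le ω).le _), Real.norm_eq_abs]
    have h1 : |2 * r - 2 * inner ℝ (e : Euc (n + 1)) (ω : Euc (n + 1))| ≤ 4 := by
      rw [abs_le] at hin ⊢
      have := abs_lt.mp hr'
      constructor <;> linarith [hin.1, hin.2, this.1, this.2]
    have h2 : (‖(ω : Euc (n + 1)) - r • (e : Euc (n + 1))‖ ^ 2) ^ (-k - 1) ≤
        ((1 - R) ^ 2) ^ (-k - 1) :=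
      Real.rpow_le_rpow_of_nonpos (by nlinarith) (sq_le_norm_sub_smul_sq hr'.le hR1.le e ω)
        (by linarith)
    gcongr
  · exact integrable_const _
  · refine Eventually.of_forall fun ω r hr => ?_
    have hr' : |r| < R := hr
    have h1 : HasDerivAt (fun r : ℝ => ‖(ω : Euc (n + 1)) - r • (e : Euc (n + 1))‖ ^ 2)
        (2 * r - 2 * inner ℝ (e : Euc (n + 1)) (ω : Euc (n + 1))) r := by
      have h2 : (fun r : ℝ => ‖(ω : Euc (n + 1)) - r • (e : Euc (n + 1))‖ ^ 2) =
          fun r : ℝ => 1 - 2 * (r * inner ℝ (e : Euc (n + 1)) (ω : Euc (n + 1))) + r ^ 2 := by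
        ext r
        rw [norm_sub_sq_sphere, real_inner_smul_left, norm_smul, norm_eq_of_mem_sphere, mul_one,
          Real.norm_eq_abs, sq_abs]
      rw [h2]
      have h3 := (((((hasDerivAt_id r).mul_const
        (inner ℝ (e : Euc (n + 1)) (ω : Euc (n + 1)))).const_mul 2).const_sub 1).add
          ((hasDerivAt_id r).pow 2))
      refine h3.congr_deriv ?_
      simp
      ring
    exact h1.rpow_const (Or.inl (hpos r hr'.le ω).ne')

/-- Newton's theorem for the potential of the sphere: the function `|ω - η|^{1-n}` has mean one.
Along a ray the derivative of the mean is a combination of the two integrals that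
`integral_etaFactor_rpow_symm` identifies with each other. -/
theorem integral_rpow_norm_sub {η : Euc (n + 1)} (hn : 1 ≤ n) (hη : ‖η‖ < 1) :
    ∫ ω : Sph n, (‖(ω : Euc (n + 1)) - η‖ ^ 2) ^ (-(((n : ℝ) - 1) / 2)) ∂(sphereMeasure n) = 1 := by
  set k : ℝ := ((n : ℝ) - 1) / 2 with hk
  have hk0 : 0 ≤ k := by
    have : (1 : ℝ) ≤ n := by exact_mod_cast hn
    rw [hk]
    linarith
  set e : Sph n := sphereDir n η with he
  have hηe : η = ‖η‖ • (e : Euc (n + 1)) := by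
    by_cases h0 : η = 0
    · simp [h0]
    · exact (norm_smul_sphereDir h0).symm
  set f : ℝ → ℝ := fun r : ℝ => ∫ ω : Sph n,
        (‖(ω : Euc (n + 1)) - r • (e : Euc (n + 1))‖ ^ 2) ^ (-k) ∂(sphereMeasure n) with hf
  have hf0 : f 0 = 1 := by simp [hf]
  suffices hfη : f ‖η‖ = f 0 by
    refine Eq.trans ?_ (hfη.trans hf0)
    simp only [hf]
    rw [← hηe]
  rcases (norm_nonneg η).eq_or_lt with h0 | hpos
  · rw [← h0]
  have hder : ∀ r : ℝ, 0 < r → r < 1 → HasDerivAt f 0 r := by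
    intro r hr0 hr1
    have habs : |r| < 1 := by rwa [abs_of_pos hr0]
    have h1 := hasDerivAt_integral_rpow e k hk0 habs
    convert h1 using 1
    have hnr : ‖r • (e : Euc (n + 1))‖ < 1 := by
      rwa [norm_smul, norm_eq_of_mem_sphere, mul_one, Real.norm_eq_abs]
    have hnr' : ‖r • (e : Euc (n + 1))‖ ^ 2 = r ^ 2 := by
      rw [norm_smul, norm_eq_of_mem_sphere, mul_one, Real.norm_eq_abs, sq_abs]
    have hDpos : ∀ ω : Sph n, 0 < ‖(ω : Euc (n + 1)) - r • (e : Euc (n + 1))‖ ^ 2 := fun ω =>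
      pow_pos (norm_pos_iff.mpr (sub_ne_zero_of_mem_ball hnr ω)) 2
    have hcont : ∀ s : ℝ, Continuous fun ω : Sph n =>
        (‖(ω : Euc (n + 1)) - r • (e : Euc (n + 1))‖ ^ 2) ^ s := fun s =>
      Continuous.rpow_const (by fun_prop) fun ω => Or.inl (hDpos ω).ne'
    have hsym := integral_etaFactor_rpow_symm hnr k
    have hexp : (n : ℝ) - k = k + 1 := by rw [hk]; ring
    rw [hexp] at hsym
    simp only [etaFactor_rpow hnr, integral_const_mul, hnr'] at hsym
    have h1r : 0 < 1 - r ^ 2 := by nlinarith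
    rw [Real.rpow_add h1r, Real.rpow_one, mul_assoc] at hsym
    have hsym' := mul_left_cancel₀ (Real.rpow_pos_of_pos h1r k).ne' hsym
    have hint : ∀ ω : Sph n, (2 * r - 2 * inner ℝ (e : Euc (n + 1)) (ω : Euc (n + 1))) * -k *
        (‖(ω : Euc (n + 1)) - r • (e : Euc (n + 1))‖ ^ 2) ^ (-k - 1) =
        -k / r * ((‖(ω : Euc (n + 1)) - r • (e : Euc (n + 1))‖ ^ 2) ^ (-k) -
          (1 - r ^ 2) * (‖(ω : Euc (n + 1)) - r • (e : Euc (n + 1))‖ ^ 2) ^ (-(k + 1))) := by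
      intro ω
      have e1 : (‖(ω : Euc (n + 1)) - r • (e : Euc (n + 1))‖ ^ 2) ^ (-k) =
          (‖(ω : Euc (n + 1)) - r • (e : Euc (n + 1))‖ ^ 2) ^ (-(k + 1)) *
            ‖(ω : Euc (n + 1)) - r • (e : Euc (n + 1))‖ ^ 2 := by
        rw [← Real.rpow_add_one (hDpos ω).ne']
        congr 1
        ring
      rw [e1, show -k - 1 = -(k + 1) by ring]
      set X := (‖(ω : Euc (n + 1)) - r • (e : Euc (n + 1))‖ ^ 2) ^ (-(k + 1))
      rw [norm_sub_sq_sphere, real_inner_smul_left, hnr']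
      field_simp
      ring
    simp only [hint]
    rw [integral_const_mul, integral_sub (integrable_of_continuous_sphere (hcont _))
      ((integrable_of_continuous_sphere (hcont _)).const_mul _), integral_const_mul, hsym',
      sub_self, mul_zero]
  have hcontf : ContinuousOn f (Set.Icc 0 ‖η‖) := by
    intro r hr
    have : |r| < 1 := by rw [abs_of_nonneg hr.1]; exact lt_of_le_of_lt hr.2 hη
    exact (hasDerivAt_integral_rpow e k hk0 this).continuousAt.continuousWithinAt
  obtain ⟨c, -, hc2⟩ := exists_hasDerivAt_eq_slope f (fun _ => 0) hpos hcontf fun x hx =>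
    hder x hx.1 (hx.2.trans hη)
  have h3 := (div_eq_zero_iff.mp hc2.symm).resolve_right (by linarith)
  linarith

lemma integral_etaFactor_rpow_half_sub {η : Euc (n + 1)} (hn : 1 ≤ n) (hη : ‖η‖ < 1) :
    ∫ ω, etaFactor n η ω ^ (((n : ℝ) - 1) / 2) ∂(sphereMeasure n) =
      (1 - ‖η‖ ^ 2) ^ (((n : ℝ) - 1) / 2) := by
  simp only [etaFactor_rpow hη, integral_const_mul, integral_rpow_norm_sub hn hη, mul_one]

lemma integral_etaFactor_rpow_half_add {η : Euc (n + 1)} (hn : 1 ≤ n) (hη : ‖η‖ < 1) :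
    ∫ ω, etaFactor n η ω ^ (((n : ℝ) + 1) / 2) ∂(sphereMeasure n) =
      (1 - ‖η‖ ^ 2) ^ (((n : ℝ) - 1) / 2) := by
  rw [← integral_etaFactor_rpow_half_sub hn hη, ← integral_etaFactor_rpow_symm hη]
  congr! 3
  ring

/-- The Poisson kernel has mean one on the sphere. -/
theorem integral_poissonKernel (hn : 1 ≤ n) {y : Euc (n + 1)} (hy : ‖y‖ < 1) :
    ∫ ω, poissonKernel n y ω ∂(sphereMeasure n) = 1 := by
  have h0 := one_sub_norm_sq_pos hy
  have h : ∀ ω, poissonKernel n y ω =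
      ((1 - ‖y‖ ^ 2) ^ (((n : ℝ) - 1) / 2))⁻¹ * etaFactor n y ω ^ (((n : ℝ) + 1) / 2) := by
    intro ω
    have h2 : ‖(ω : Euc (n + 1)) - y‖ ^ (n + 1) =
        (‖(ω : Euc (n + 1)) - y‖ ^ 2) ^ (((n : ℝ) + 1) / 2) := by
      rw [← Real.rpow_natCast_mul (norm_nonneg _), ← Real.rpow_natCast]
      congr 1
      push_cast
      ring
    rw [poissonKernel, norm_sub_rev, h2, etaFactor_rpow hy, ← mul_assoc,
      Real.rpow_neg (by positivity), div_eq_mul_inv]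
    congr 1
    rw [← Real.rpow_neg h0.le, ← Real.rpow_add h0]
    conv_lhs => rw [← Real.rpow_one (1 - ‖y‖ ^ 2)]
    congr 1
    ring
  simp only [h]
  rw [integral_const_mul, integral_etaFactor_rpow_half_add hn hy]
  exact inv_mul_cancel₀ (Real.rpow_pos_of_pos h0 _).ne'

end PsiEta

/-! ### Mass of the Poisson kernel and bounds for the deficits -/

section RealLp

variable {α : Type*} [MeasurableSpace α] {m : Measure α} {f : α → ℝ} {r : ℝ}

lemma lpNorm_ofReal_eq (hr : 0 < r) (hf : AEStronglyMeasurable f m) :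
    lpNorm f (ENNReal.ofReal r) m = (∫ x, |f x| ^ r ∂m) ^ r⁻¹ := by
  rw [lpNorm_eq_integral_norm_rpow_toReal (by simpa using hr) ENNReal.ofReal_ne_top hf,
    ENNReal.toReal_ofReal hr.le]
  simp only [Real.norm_eq_abs]

lemma lpNorm_ofReal_rpow (hr : 0 < r) (hf : AEStronglyMeasurable f m) :
    lpNorm f (ENNReal.ofReal r) m ^ r = ∫ x, |f x| ^ r ∂m := by
  rw [lpNorm_ofReal_eq hr hf, Real.rpow_inv_rpow (by positivity) hr.ne']

lemma lpNorm_fun_const_mul (c : ℝ) (f : α → ℝ) (p : ℝ≥0∞) :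
    lpNorm (fun x => c * f x) p m = |c| * lpNorm f p m := by
  have h := lpNorm_const_smul c f m (p := p)
  rw [coe_nnnorm, Real.norm_eq_abs] at h
  exact h

variable [IsProbabilityMeasure m]

lemma integral_abs_le_lpNorm (hr : 1 ≤ r) (hf : MemLp f (ENNReal.ofReal r) m) :
    ∫ x, |f x| ∂m ≤ lpNorm f (ENNReal.ofReal r) m := by
  have h1 : ∫ x, |f x| ∂m = lpNorm f 1 m :=
    (lpNorm_one_eq_integral_norm hf.aestronglyMeasurable).symm
  rw [h1, ← toReal_eLpNorm hf.aestronglyMeasurable, ← toReal_eLpNorm hf.aestronglyMeasurable]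
  refine ENNReal.toReal_mono hf.eLpNorm_ne_top ?_
  exact eLpNorm_le_eLpNorm_of_exponent_le (by simpa using ENNReal.ofReal_le_ofReal hr)
    hf.aestronglyMeasurable

lemma integral_le_lpNorm (hr : 1 ≤ r) (hf : MemLp f (ENNReal.ofReal r) m) :
    ∫ x, f x ∂m ≤ lpNorm f (ENNReal.ofReal r) m :=
  (le_abs_self _).trans ((abs_integral_le_integral_abs).trans (integral_abs_le_lpNorm hr hf))

end RealLp

section Poisson

variable {n : ℕ}

lemma poissonKernel_nonneg {y : Euc (n + 1)} (hy : ‖y‖ < 1) (ω : Sph n) :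
    0 ≤ poissonKernel n y ω :=
  div_nonneg (one_sub_norm_sq_pos hy).le (by positivity)

lemma measurable_poissonKernel :
    Measurable fun p : Euc (n + 1) × Sph n => poissonKernel n p.1 p.2 := by
  unfold poissonKernel
  fun_prop

lemma measurable_poissonKernel_left (ω : Sph n) :
    Measurable fun y : Euc (n + 1) => poissonKernel n y ω := by
  unfold poissonKernel
  fun_prop

lemma lintegral_sphere_poissonKernel (hn : 1 ≤ n) {y : Euc (n + 1)} (hy : ‖y‖ < 1) :
    ∫⁻ ω, ENNReal.ofReal (poissonKernel n y ω) ∂(sphereMeasure n) = 1 := by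
  have h := integral_poissonKernel hn hy
  have hint : Integrable (poissonKernel n y) (sphereMeasure n) := by
    by_contra hni
    rw [integral_undef hni] at h
    exact zero_ne_one h
  rw [← ofReal_integral_eq_lintegral_ofReal hint
    (Eventually.of_forall fun ω => poissonKernel_nonneg hy ω), h, ENNReal.ofReal_one]

lemma measurePreserving_ball (U : Euc (n + 1) ≃ₗᵢ[ℝ] Euc (n + 1)) :
    MeasurePreserving U (ballMeasure n) (ballMeasure n) := by
  have h := U.measurePreserving.restrict_preimage (s := ball (0 : Euc (n + 1)) 1)
    measurableSet_ball
  have h2 : U ⁻¹' ball (0 : Euc (n + 1)) 1 = ball 0 1 := by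
    ext x
    simp
  rw [h2] at h
  exact h.smul_measure _

/-- The Poisson kernel has mean one on the ball: by rotation invariance the mean does not depend on
the boundary point, and its average over the sphere is given by `integral_poissonKernel`. -/
lemma lintegral_ball_poissonKernel (hn : 1 ≤ n) (ω : Sph n) :
    ∫⁻ y, ENNReal.ofReal (poissonKernel n y ω) ∂(ballMeasure n) = 1 := by
  have hconst : ∀ ω' : Sph n, ∫⁻ y, ENNReal.ofReal (poissonKernel n y ω') ∂(ballMeasure n) =
      ∫⁻ y, ENNReal.ofReal (poissonKernel n y ω) ∂(ballMeasure n) := by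
    intro ω'
    obtain ⟨U, hU⟩ : ∃ U : Euc (n + 1) ≃ₗᵢ[ℝ] Euc (n + 1), U (ω' : Euc (n + 1)) = ω :=
      ⟨_, Submodule.reflection_sub (by simp)⟩
    have hm : Measurable fun y => ENNReal.ofReal (poissonKernel n y ω) :=
      (measurable_poissonKernel_left ω).ennreal_ofReal
    rw [← (measurePreserving_ball U).lintegral_comp hm]
    congr 1
    ext y
    rw [poissonKernel, poissonKernel, ← hU, ← map_sub, U.norm_map, U.norm_map]
  have hswap : ∫⁻ y, ∫⁻ ω', ENNReal.ofReal (poissonKernel n y ω') ∂(sphereMeasure n)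
      ∂(ballMeasure n) = ∫⁻ ω', ∫⁻ y, ENNReal.ofReal (poissonKernel n y ω') ∂(ballMeasure n)
      ∂(sphereMeasure n) :=
    lintegral_lintegral_swap measurable_poissonKernel.ennreal_ofReal.aemeasurable
  have hone : ∫⁻ y, ∫⁻ ω', ENNReal.ofReal (poissonKernel n y ω') ∂(sphereMeasure n)
      ∂(ballMeasure n) = 1 := by
    rw [lintegral_congr_ae (g := fun _ => 1), lintegral_one, measure_univ]
    filter_upwards [ae_mem_ball n] with y hy
    exact lintegral_sphere_poissonKernel hn (mem_ball_zero_iff.mp hy)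
  rw [hone] at hswap
  simp only [hconst] at hswap
  rw [lintegral_const, measure_univ, mul_one] at hswap
  exact hswap.symm

lemma ae_prod_mem_ball :
    ∀ᵐ p ∂((ballMeasure n).prod (sphereMeasure n)), p.1 ∈ ball (0 : Euc (n + 1)) 1 :=
  Measure.quasiMeasurePreserving_fst.ae (ae_mem_ball n)

lemma integrable_prod_poissonKernel (hn : 1 ≤ n) :
    Integrable (fun p : Euc (n + 1) × Sph n => poissonKernel n p.1 p.2)
      ((ballMeasure n).prod (sphereMeasure n)) := by
  refine ⟨measurable_poissonKernel.aestronglyMeasurable, ?_⟩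
  rw [hasFiniteIntegral_iff_ofReal, lintegral_prod _
    measurable_poissonKernel.ennreal_ofReal.aemeasurable,
    lintegral_congr_ae (g := fun _ => 1), lintegral_one, measure_univ]
  · exact ENNReal.one_lt_top
  · filter_upwards [ae_mem_ball n] with y hy
    exact lintegral_sphere_poissonKernel hn (mem_ball_zero_iff.mp hy)
  · filter_upwards [ae_prod_mem_ball] with p hp
    exact poissonKernel_nonneg (mem_ball_zero_iff.mp hp) p.2

lemma integrable_poissonKernel_mul (hn : 1 ≤ n) {g : Euc (n + 1) × Sph n → ℝ} {M : ℝ}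
    (hg : AEStronglyMeasurable g ((ballMeasure n).prod (sphereMeasure n)))
    (hM : ∀ᵐ p ∂((ballMeasure n).prod (sphereMeasure n)), |g p| ≤ M) :
    Integrable (fun p => poissonKernel n p.1 p.2 * g p)
      ((ballMeasure n).prod (sphereMeasure n)) :=
  (integrable_prod_poissonKernel hn).mul_bdd hg hM

lemma integral_ball_poissonKernel (hn : 1 ≤ n) (ω : Sph n) :
    Integrable (fun y => poissonKernel n y ω) (ballMeasure n) ∧
      ∫ y, poissonKernel n y ω ∂(ballMeasure n) = 1 := by
  have hm := measurable_poissonKernel_left ω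
  have h0 : 0 ≤ᵐ[ballMeasure n] fun y => poissonKernel n y ω := by
    filter_upwards [ae_mem_ball n] with y hy
    exact poissonKernel_nonneg (mem_ball_zero_iff.mp hy) ω
  constructor
  · refine ⟨hm.aestronglyMeasurable, ?_⟩
    rw [hasFiniteIntegral_iff_ofReal h0, lintegral_ball_poissonKernel hn]
    exact ENNReal.one_lt_top
  · rw [integral_eq_lintegral_of_nonneg_ae h0 hm.aestronglyMeasurable,
      lintegral_ball_poissonKernel hn, ENNReal.toReal_one]

lemma integrable_poissonKernel (hn : 1 ≤ n) {y : Euc (n + 1)} (hy : ‖y‖ < 1) :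
    Integrable (poissonKernel n y) (sphereMeasure n) := by
  by_contra hni
  have h := integral_poissonKernel hn hy
  rw [integral_undef hni] at h
  exact zero_ne_one h

lemma exists_bound_of_continuous_sphere {u : Sph n → ℝ} (hu : Continuous u) :
    ∃ M : ℝ, 0 < M ∧ ∀ ω, |u ω| ≤ M := by
  obtain ⟨M, hM⟩ := isCompact_univ.exists_bound_of_continuousOn hu.continuousOn
  exact ⟨|M| + 1, by positivity, fun ω => (hM ω trivial).trans ((le_abs_self M).trans (by linarith))⟩

lemma memLp_of_continuous_sphere {u : Sph n → ℝ} (hu : Continuous u) (p : ℝ≥0∞) :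
    MemLp u p (sphereMeasure n) := by
  obtain ⟨M, -, hM⟩ := exists_bound_of_continuous_sphere hu
  exact MemLp.of_bound hu.aestronglyMeasurable M (Eventually.of_forall hM)

lemma memLp_poissonExt (hn : 1 ≤ n) {u : Sph n → ℝ} (hu : Continuous u) (p : ℝ≥0∞) :
    MemLp (poissonExt n u) p (ballMeasure n) := by
  obtain ⟨M, hM0, hM⟩ := exists_bound_of_continuous_sphere hu
  have hmeas : AEStronglyMeasurable (poissonExt n u) (ballMeasure n) := by
    have h : StronglyMeasurable fun p : Euc (n + 1) × Sph n => poissonKernel n p.1 p.2 * u p.2 :=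
      (measurable_poissonKernel.mul (hu.measurable.comp measurable_snd)).stronglyMeasurable
    exact h.integral_prod_right'.aestronglyMeasurable
  refine MemLp.of_bound hmeas M ?_
  filter_upwards [ae_mem_ball n] with y hy
  have hy' := mem_ball_zero_iff.mp hy
  have h1 : ‖poissonExt n u y‖ ≤ ∫ ω, poissonKernel n y ω * M ∂(sphereMeasure n) := by
    refine norm_integral_le_of_norm_le ((integrable_poissonKernel hn hy').mul_const M)
      (Eventually.of_forall fun ω => ?_)
    rw [norm_mul, Real.norm_of_nonneg (poissonKernel_nonneg hy' ω)]
    exact mul_le_mul_of_nonneg_left (hM ω) (poissonKernel_nonneg hy' ω)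
  rwa [integral_mul_const, integral_poissonKernel hn hy', one_mul] at h1

lemma integral_poissonExt (hn : 1 ≤ n) {u : Sph n → ℝ} (hu : Continuous u) :
    ∫ y, poissonExt n u y ∂(ballMeasure n) = ∫ ω, u ω ∂(sphereMeasure n) := by
  obtain ⟨M, -, hM⟩ := exists_bound_of_continuous_sphere hu
  have hint := integrable_poissonKernel_mul (g := fun p => u p.2) hn
    (hu.measurable.comp measurable_snd).aestronglyMeasurable (Eventually.of_forall fun p => hM p.2)
  unfold poissonExt
  rw [integral_integral_swap hint]
  congr 1
  ext ω
  rw [integral_mul_const, (integral_ball_poissonKernel hn ω).2, one_mul]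

lemma memLp_dualPoisson (hn : 1 ≤ n) {v : Euc (n + 1) → ℝ} {M : ℝ}
    (hv : AEStronglyMeasurable v (ballMeasure n)) (hM : ∀ y ∈ ball (0 : Euc (n + 1)) 1, |v y| ≤ M)
    (p : ℝ≥0∞) : MemLp (dualPoisson n v) p (sphereMeasure n) := by
  have hmeas : AEStronglyMeasurable (dualPoisson n v) (sphereMeasure n) := by
    have h : AEStronglyMeasurable (fun p : Euc (n + 1) × Sph n => poissonKernel n p.1 p.2 * v p.1)
        ((ballMeasure n).prod (sphereMeasure n)) :=
      measurable_poissonKernel.aestronglyMeasurable.mul hv.comp_fst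
    exact h.prod_swap.integral_prod_right'
  refine MemLp.of_bound hmeas M (Eventually.of_forall fun ω => ?_)
  obtain ⟨hi, h1⟩ := integral_ball_poissonKernel hn ω
  have h2 : ‖dualPoisson n v ω‖ ≤ ∫ y, poissonKernel n y ω * M ∂(ballMeasure n) := by
    refine norm_integral_le_of_norm_le (hi.mul_const M) ?_
    filter_upwards [ae_mem_ball n] with y hy
    have hy' := mem_ball_zero_iff.mp hy
    rw [norm_mul, Real.norm_of_nonneg (poissonKernel_nonneg hy' ω)]
    exact mul_le_mul_of_nonneg_left (hM y hy) (poissonKernel_nonneg hy' ω)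
  rwa [integral_mul_const, h1, one_mul] at h2

lemma integral_dualPoisson (hn : 1 ≤ n) {v : Euc (n + 1) → ℝ} {M : ℝ}
    (hv : AEStronglyMeasurable v (ballMeasure n))
    (hM : ∀ y ∈ ball (0 : Euc (n + 1)) 1, |v y| ≤ M) :
    ∫ ω, dualPoisson n v ω ∂(sphereMeasure n) = ∫ y, v y ∂(ballMeasure n) := by
  have hint := integrable_poissonKernel_mul (g := fun p => v p.1) hn hv.comp_fst
    (ae_prod_mem_ball.mono fun p hp => hM p.1 hp)
  unfold dualPoisson
  rw [← integral_integral_swap hint]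
  refine integral_congr_ae ?_
  filter_upwards [ae_mem_ball n] with y hy
  rw [integral_mul_const, integral_poissonKernel hn (mem_ball_zero_iff.mp hy), one_mul]

end Poisson

section Exponents

variable {n : ℕ}

lemma dim_eq (n : ℕ) : dim n = n + 1 := by simp [dim]

lemma expP_eq (n : ℕ) : expP n = 2 * n / (n - 1) := by
  rw [expP, dim_eq]
  congr 1 <;> ring

lemma two_lt_expP (hn : 2 ≤ n) : 2 < expP n := by
  have h : (2 : ℝ) ≤ n := by exact_mod_cast hn
  rw [expP_eq, lt_div_iff₀ (by linarith)]
  linarith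

lemma two_lt_expQ (hn : 2 ≤ n) : 2 < expQ n := by
  have h : (2 : ℝ) ≤ n := by exact_mod_cast hn
  rw [expQ, dim_eq, lt_div_iff₀ (by linarith)]
  linarith

lemma one_lt_expP' (hn : 2 ≤ n) : 1 < expP' n := by
  have h : (2 : ℝ) ≤ n := by exact_mod_cast hn
  rw [expP', dim_eq, lt_div_iff₀ (by linarith)]
  linarith

lemma one_lt_expQ' (hn : 2 ≤ n) : 1 < expQ' n := by
  have h : (2 : ℝ) ≤ n := by exact_mod_cast hn
  rw [expQ', dim_eq, lt_div_iff₀ (by linarith)]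
  linarith

end Exponents

section Normalize

variable {n : ℕ}

/-- The scalar inequality behind the deficit bounds: for norms `N`, `S` of a function and of its
image, and a lower bound `m` of `S`. -/
lemma one_sub_div_rpow_le {N S m K r : ℝ} (hr : 0 < r) (hN : 1 ≤ N) (hm : 0 ≤ m) (hmS : m ≤ S)
    (hK : 0 ≤ K) (h : N ^ r ≤ m ^ r + K) : 1 - (N⁻¹ * S) ^ r ≤ K := by
  have hN0 : 0 < N := by linarith
  have h1 : 1 ≤ N ^ r := Real.one_le_rpow hN hr.le
  have h2 : m ^ r ≤ S ^ r := Real.rpow_le_rpow hm hmS hr.le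
  rw [Real.mul_rpow (by positivity) (hm.trans hmS), Real.inv_rpow hN0.le, inv_mul_eq_div,
    one_sub_div (by positivity), div_le_iff₀ (by positivity)]
  nlinarith

lemma sphereNorm_const_mul (r c : ℝ) (u : Sph n → ℝ) :
    sphereNorm n r (fun ω => c * u ω) = |c| * sphereNorm n r u :=
  lpNorm_fun_const_mul c u _

lemma ballNorm_const_mul (r c : ℝ) (v : Euc (n + 1) → ℝ) :
    ballNorm n r (fun y => c * v y) = |c| * ballNorm n r v :=
  lpNorm_fun_const_mul c v _

lemma sphereNorm_normalize {u : Sph n → ℝ} (hN : 0 < sphereNorm n (expP n) u) :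
    sphereNorm n (expP n) (sphereNormalize n u) = 1 := by
  unfold sphereNormalize
  rw [sphereNorm_const_mul, abs_of_pos (by positivity), inv_mul_cancel₀ hN.ne']

lemma ballNorm_normalize {v : Euc (n + 1) → ℝ} (hN : 0 < ballNorm n (expQ' n) v) :
    ballNorm n (expQ' n) (ballNormalize n v) = 1 := by
  unfold ballNormalize
  rw [ballNorm_const_mul, abs_of_pos (by positivity), inv_mul_cancel₀ hN.ne']

lemma integral_le_sphereNorm {r : ℝ} (hr : 1 ≤ r) {u : Sph n → ℝ} (hu : Continuous u) :
    ∫ ω, u ω ∂(sphereMeasure n) ≤ sphereNorm n r u :=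
  integral_le_lpNorm hr (memLp_of_continuous_sphere hu _)

/-- The deficit of a normalized function is controlled by the defect in Jensen's inequality,
since the harmonic extension preserves the mean. -/
theorem sphereDeficit_normalize_le (hn : 2 ≤ n) {u : Sph n → ℝ} (hu : Continuous u) {K : ℝ}
    (hK : 0 ≤ K) (hmean : 1 ≤ ∫ ω, u ω ∂(sphereMeasure n))
    (h : ∫ ω, |u ω| ^ expP n ∂(sphereMeasure n) ≤ (∫ ω, u ω ∂(sphereMeasure n)) ^ expP n + K) :
    sphereDeficit n (sphereNormalize n u) ≤ K := by
  have hp := two_lt_expP hn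
  have hN : 1 ≤ sphereNorm n (expP n) u :=
    hmean.trans (integral_le_sphereNorm (by linarith) hu)
  rw [sphereDeficit, sphereNorm_normalize (by linarith), Real.one_rpow]
  have hext : poissonExt n (sphereNormalize n u) =
      fun y => (sphereNorm n (expP n) u)⁻¹ * poissonExt n u y := by
    ext y
    unfold poissonExt sphereNormalize
    rw [← integral_const_mul]
    congr 1
    ext ω
    ring
  rw [hext, ballNorm_const_mul, abs_of_pos (by positivity)]
  refine one_sub_div_rpow_le (m := ∫ ω, u ω ∂(sphereMeasure n)) (by linarith) hN (by linarith)
    ?_ hK ?_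
  · rw [← integral_poissonExt (by omega) hu]
    exact integral_le_lpNorm (by linarith [two_lt_expQ hn]) (memLp_poissonExt (by omega) hu _)
  · rwa [sphereNorm, lpNorm_ofReal_rpow (by linarith) hu.aestronglyMeasurable]

theorem ballDeficit_normalize_le (hn : 2 ≤ n) {v : Euc (n + 1) → ℝ} {M K : ℝ}
    (hv : AEStronglyMeasurable v (ballMeasure n)) (hM : ∀ y ∈ ball (0 : Euc (n + 1)) 1, |v y| ≤ M)
    (hK : 0 ≤ K) (hmean : 1 ≤ ∫ y, v y ∂(ballMeasure n))
    (h : ∫ y, |v y| ^ expQ' n ∂(ballMeasure n) ≤ (∫ y, v y ∂(ballMeasure n)) ^ expQ' n + K) :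
    ballDeficit n (ballNormalize n v) ≤ K := by
  have hp := one_lt_expQ' hn
  have hvL : MemLp v (ENNReal.ofReal (expQ' n)) (ballMeasure n) :=
    MemLp.of_bound hv M ((ae_mem_ball n).mono hM)
  have hN : 1 ≤ ballNorm n (expQ' n) v := hmean.trans (integral_le_lpNorm hp.le hvL)
  rw [ballDeficit, ballNorm_normalize (by linarith), Real.one_rpow]
  have hext : dualPoisson n (ballNormalize n v) =
      fun ω => (ballNorm n (expQ' n) v)⁻¹ * dualPoisson n v ω := by
    ext ω
    unfold dualPoisson ballNormalize
    rw [← integral_const_mul]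
    congr 1
    ext y
    ring
  rw [hext, sphereNorm_const_mul, abs_of_pos (by positivity)]
  refine one_sub_div_rpow_le (m := ∫ y, v y ∂(ballMeasure n)) (by linarith) hN (by linarith)
    ?_ hK ?_
  · rw [← integral_dualPoisson (by omega) hv hM]
    exact integral_le_lpNorm (one_lt_expP' hn).le (memLp_dualPoisson (by omega) hv hM _)
  · rwa [ballNorm, lpNorm_ofReal_rpow (by linarith) hv]

end Normalize

/-! ### Powers of the conformal factor near and far from the identity -/

section Scalar

lemma abs_one_add_rpow_neg_sub_le {k t : ℝ} (hk : 0 ≤ k) (ht : |t| ≤ 1 / (2 * k + 2)) :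
    |(1 + t) ^ (-k) - 1 + k * t| ≤ (2 * k + 4 * k ^ 2) * t ^ 2 := by
  have hk2 : 0 < 2 * k + 2 := by linarith
  have ht1 : |t| * (2 * k + 2) ≤ 1 := (le_div_iff₀ hk2).mp ht
  have ht0 := abs_nonneg t
  have hthalf : |t| ≤ 1 / 2 := by nlinarith
  obtain ⟨hl, hu⟩ := abs_le.mp hthalf
  have hpos : 0 < 1 + t := by linarith
  have hexp : (1 + t) ^ (-k) = Real.exp (-k * Real.log (1 + t)) := by
    rw [Real.rpow_def_of_pos hpos]
    ring_nf
  have hlower : 1 - k * t ≤ (1 + t) ^ (-k) := by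
    have h1 := Real.add_one_le_exp (-k * Real.log (1 + t))
    have h2 := Real.log_le_sub_one_of_pos hpos
    rw [hexp]
    nlinarith
  have hupper : (1 + t) ^ (-k) ≤ 1 - k * t + (2 * k + 4 * k ^ 2) * t ^ 2 := by
    set z := -k * t + 2 * k * t ^ 2 with hz
    have h1 : -k * Real.log (1 + t) ≤ z := by
      have h2 := Real.one_sub_inv_le_log_of_pos hpos
      have h3 : 1 - (1 + t)⁻¹ = t - t ^ 2 / (1 + t) := by
        field_simp
        ring
      have h4 : t ^ 2 / (1 + t) ≤ 2 * t ^ 2 := by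
        rw [div_le_iff₀ hpos]
        nlinarith [sq_nonneg t]
      have h5 : t - 2 * t ^ 2 ≤ Real.log (1 + t) := by linarith
      rw [hz]
      nlinarith
    have h2 : |z| ≤ 2 * k * |t| := by
      have h3 : |z| ≤ |-k * t| + |2 * k * t ^ 2| := abs_add_le _ _
      have h6 : |-k * t| = k * |t| := by rw [abs_mul, abs_neg, abs_of_nonneg hk]
      have h7 : |2 * k * t ^ 2| = 2 * (k * |t|) * |t| := by
        rw [abs_of_nonneg (by positivity), ← sq_abs t]
        ring
      rw [h6, h7] at h3
      nlinarith [mul_le_mul_of_nonneg_left hthalf (mul_nonneg hk ht0)]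
    have h3 : |z| ≤ 1 := by nlinarith
    have h4 := (abs_le.mp (Real.abs_exp_sub_one_sub_id_le h3)).2
    have h5 : z ^ 2 ≤ 4 * k ^ 2 * t ^ 2 := by
      rw [← sq_abs z, ← sq_abs t]
      calc |z| ^ 2 ≤ (2 * k * |t|) ^ 2 := pow_le_pow_left₀ (abs_nonneg z) h2 2
        _ = _ := by ring
    rw [hexp]
    calc Real.exp (-k * Real.log (1 + t)) ≤ Real.exp z := Real.exp_le_exp.mpr h1
      _ ≤ 1 + z + z ^ 2 := by linarith
      _ ≤ _ := by rw [hz] at *; linarith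
  rw [abs_le]
  constructor
  · have : 0 ≤ (2 * k + 4 * k ^ 2) * t ^ 2 := by positivity
    linarith
  · linarith

lemma one_add_half_rpow_neg_le {k m s : ℝ} (hk : 1 / 2 ≤ k) (hm0 : 0 ≤ m) (hm1 : m ≤ 1)
    (hs : 1 + m / 2 ≤ s) : s ^ (-k) ≤ 1 - m / 8 := by
  have h1 : s ^ (-k) ≤ (1 + m / 2) ^ (-k) :=
    Real.rpow_le_rpow_of_nonpos (by positivity) hs (by linarith)
  have h2 : (1 + m / 2) ^ (-k) ≤ (1 + m / 2) ^ (-(1 / 2 : ℝ)) :=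
    Real.rpow_le_rpow_of_exponent_le (by linarith) (by linarith)
  have h3 : (1 + m / 2) ^ (-(1 / 2 : ℝ)) ≤ 1 - m / 8 := by
    rw [Real.rpow_neg (by positivity), ← Real.sqrt_eq_rpow]
    rw [inv_le_iff_one_le_mul₀ (Real.sqrt_pos.mpr (by positivity))]
    have h4 : (1 - m / 8)⁻¹ ≤ √(1 + m / 2) := by
      apply Real.le_sqrt_of_sq_le
      rw [inv_pow, inv_le_iff_one_le_mul₀ (by nlinarith)]
      nlinarith [mul_nonneg hm0 hm0, mul_nonneg (mul_nonneg hm0 hm0) hm0,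
        mul_nonneg hm0 (sub_nonneg.mpr hm1)]
    rw [inv_le_iff_one_le_mul₀ (by linarith)] at h4
    linarith
  exact h1.trans (h2.trans h3)

lemma sqrt_one_add_sub_one_le {E : Type*} [NormedAddCommGroup E] (b : E) :
    √(1 + ‖b‖ ^ 2) - 1 ≤ ‖b‖ ^ 2 := by
  have h : √(1 + ‖b‖ ^ 2) ≤ 1 + ‖b‖ ^ 2 :=
    Real.sqrt_le_left (by positivity) |>.mpr (by nlinarith [sq_nonneg ‖b‖])
  linarith

end Scalar

section ConfPow

variable {E : Type*} [NormedAddCommGroup E] [InnerProductSpace ℝ E]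

/-- The power `confFactor b y ^ (-k)`; for suitable `k` it is the image of the constant function
`1` under a Möbius transformation of the sphere or of the ball. -/
noncomputable def confPow (k : ℝ) (b y : E) : ℝ := confFactor b y ^ (-k)

lemma confPow_pos (k : ℝ) (b : E) {y : E} (hy : ‖y‖ ≤ 1) : 0 < confPow k b y :=
  Real.rpow_pos_of_pos (confFactor_pos b hy) _

lemma measurable_confPow [MeasurableSpace E] [OpensMeasurableSpace E] (k : ℝ) (b : E) :
    Measurable (confPow k b) :=
  (continuous_confFactor b).measurable.pow_const _

lemma continuousOn_confPow (k : ℝ) (b : E) : ContinuousOn (confPow k b) (closedBall 0 1) :=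
  (continuous_confFactor b).continuousOn.rpow_const fun _ hy =>
    Or.inl (confFactor_pos b (mem_closedBall_zero_iff.mp hy)).ne'

lemma exists_confFactor_eq (b : E) {y : E} (hy : ‖y‖ ≤ 1) :
    ∃ θ : ℝ, 0 ≤ θ ∧ θ ≤ ‖b‖ ^ 2 ∧ confFactor b y = 1 + (inner ℝ b y + θ) := by
  have h1 := one_le_sqrt_one_add b
  have h2 := sqrt_one_add_sub_one_le b
  have h3 : ‖y‖ ^ 2 ≤ 1 := pow_le_one₀ (norm_nonneg y) hy
  refine ⟨(√(1 + ‖b‖ ^ 2) - 1) / 2 * (1 + ‖y‖ ^ 2), ?_, ?_, ?_⟩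
  · apply mul_nonneg
    · linarith
    · positivity
  · nlinarith
  · rw [confFactor]
    ring

/-- First order expansion of `confPow k b` at `b = 0`. -/
lemma abs_confPow_sub_le {k : ℝ} (hk : 0 ≤ k) {b y : E} (hb : ‖b‖ ≤ 1 / (4 * k + 4))
    (hy : ‖y‖ ≤ 1) :
    |confPow k b y - 1 + k * inner ℝ b y| ≤ (9 * k + 16 * k ^ 2) * ‖b‖ ^ 2 := by
  obtain ⟨θ, hθ0, hθ1, hθ⟩ := exists_confFactor_eq b hy
  have hin : |inner ℝ b y| ≤ ‖b‖ :=
    (abs_real_inner_le_norm b y).trans (mul_le_of_le_one_right (norm_nonneg b) hy)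
  have hb1 : ‖b‖ * (4 * k + 4) ≤ 1 := (le_div_iff₀ (by linarith)).mp hb
  have hb0 := norm_nonneg b
  have ht : |inner ℝ b y + θ| ≤ 2 * ‖b‖ := by
    have := abs_add_le (inner ℝ b y) θ
    rw [abs_of_nonneg hθ0] at this
    nlinarith
  have ht2 : |inner ℝ b y + θ| ≤ 1 / (2 * k + 2) := by
    refine ht.trans ?_
    rw [le_div_iff₀ (by linarith)]
    linarith
  have h1 := abs_one_add_rpow_neg_sub_le hk ht2
  rw [confPow, hθ]
  have h2 : (1 + (inner ℝ b y + θ)) ^ (-k) - 1 + k * inner ℝ b y =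
      ((1 + (inner ℝ b y + θ)) ^ (-k) - 1 + k * (inner ℝ b y + θ)) + (-(k * θ)) := by ring
  rw [h2]
  have h3 : (inner ℝ b y + θ) ^ 2 ≤ 4 * ‖b‖ ^ 2 := by
    rw [← sq_abs]
    calc |inner ℝ b y + θ| ^ 2 ≤ (2 * ‖b‖) ^ 2 := pow_le_pow_left₀ (abs_nonneg _) ht 2
      _ = _ := by ring
  have h4 := abs_add_le ((1 + (inner ℝ b y + θ)) ^ (-k) - 1 + k * (inner ℝ b y + θ)) (-(k * θ))
  rw [abs_neg, abs_of_nonneg (mul_nonneg hk hθ0)] at h4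
  have h5 : k * θ ≤ k * ‖b‖ ^ 2 := mul_le_mul_of_nonneg_left hθ1 hk
  have h6 : (2 * k + 4 * k ^ 2) * (inner ℝ b y + θ) ^ 2 ≤ (2 * k + 4 * k ^ 2) * (4 * ‖b‖ ^ 2) :=
    mul_le_mul_of_nonneg_left h3 (by positivity)
  linarith

lemma abs_confPow_sub_one_le {k : ℝ} (hk : 0 ≤ k) {b y : E} (hb : ‖b‖ ≤ 1 / (4 * k + 4))
    (hy : ‖y‖ ≤ 1) : |confPow k b y - 1| ≤ (10 * k + 16 * k ^ 2) * ‖b‖ := by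
  have h1 := abs_confPow_sub_le hk hb hy
  have hin : |inner ℝ b y| ≤ ‖b‖ :=
    (abs_real_inner_le_norm b y).trans (mul_le_of_le_one_right (norm_nonneg b) hy)
  have hb1 : ‖b‖ * (4 * k + 4) ≤ 1 := (le_div_iff₀ (by linarith)).mp hb
  have hb0 := norm_nonneg b
  have hb2 : ‖b‖ ^ 2 ≤ ‖b‖ := by nlinarith
  have h2 : |confPow k b y - 1| ≤ |confPow k b y - 1 + k * inner ℝ b y| + |k * inner ℝ b y| := by
    have := abs_sub (confPow k b y - 1 + k * inner ℝ b y) (k * inner ℝ b y)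
    rwa [add_sub_cancel_right] at this
  rw [abs_mul, abs_of_nonneg hk] at h2
  have h3 := mul_le_mul_of_nonneg_left hin hk
  have h4 : (9 * k + 16 * k ^ 2) * ‖b‖ ^ 2 ≤ (9 * k + 16 * k ^ 2) * ‖b‖ :=
    mul_le_mul_of_nonneg_left hb2 (by positivity)
  linarith

/-- In the cap around the direction of `b` the function `confPow k b` is definitely below `1`. -/
lemma confPow_le_of_inner_ge {k : ℝ} (hk : 1 / 2 ≤ k) {b y : E} (h : ‖b‖ / 2 ≤ inner ℝ b y) :
    confPow k b y ≤ 1 - min 1 ‖b‖ / 8 := by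
  refine one_add_half_rpow_neg_le hk (le_min zero_le_one (norm_nonneg b)) (min_le_left _ _) ?_
  have h1 := one_le_sqrt_one_add b
  have h2 : min 1 ‖b‖ ≤ ‖b‖ := min_le_right _ _
  rw [confFactor]
  nlinarith [sq_nonneg ‖y‖]

end ConfPow

/-! ### Lower bounds for the `L¹`-distance to powers of conformal factors -/

section Distance

variable {α : Type*} [MeasurableSpace α] {m : Measure α} [IsProbabilityMeasure m] {n : ℕ}

lemma integrable_confPow {ι : α → Euc n} (hι : AEMeasurable ι m) (hι1 : ∀ᵐ a ∂m, ‖ι a‖ ≤ 1)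
    (k : ℝ) (b : Euc n) : Integrable (fun a => confPow k b (ι a)) m := by
  obtain ⟨M, hM⟩ := (isCompact_closedBall (0 : Euc n) 1).exists_bound_of_continuousOn
    (continuousOn_confPow k b)
  refine Integrable.of_bound ((measurable_confPow k b).comp_aemeasurable hι).aestronglyMeasurable
    M ?_
  filter_upwards [hι1] with a ha
  exact hM _ (mem_closedBall_zero_iff.mpr ha)

lemma le_integral_abs_one_sub_confPow {ι : α → Euc n} (hι : AEMeasurable ι m)
    (hι1 : ∀ᵐ a ∂m, ‖ι a‖ ≤ 1) {c₀ : ℝ}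
    (hcap : ∀ e : Euc n, ‖e‖ = 1 → c₀ ≤ m.real {a | 1 / 2 ≤ inner ℝ e (ι a)}) {k : ℝ}
    (hk : 1 / 2 ≤ k) (b : Euc n) :
    c₀ / 8 * min 1 ‖b‖ ≤ ∫ a, |1 - confPow k b (ι a)| ∂m := by
  by_cases hb : b = 0
  · rw [hb, norm_zero, min_eq_right zero_le_one, mul_zero]
    positivity
  have hb' : ‖b‖ ≠ 0 := norm_ne_zero_iff.mpr hb
  have hmin : 0 ≤ min 1 ‖b‖ := le_min zero_le_one (norm_nonneg b)
  set S := {a | 1 / 2 ≤ inner ℝ (‖b‖⁻¹ • b) (ι a)} with hS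
  have hc := hcap (‖b‖⁻¹ • b) (by simp [norm_smul, hb'])
  have hint : Integrable (fun a => |1 - confPow k b (ι a)|) m :=
    ((integrable_const 1).sub (integrable_confPow hι hι1 k b)).abs
  have h1 := mul_meas_ge_le_integral_of_nonneg (Eventually.of_forall fun a => abs_nonneg _) hint
    (min 1 ‖b‖ / 8)
  have h2 : S ⊆ {a | min 1 ‖b‖ / 8 ≤ |1 - confPow k b (ι a)|} := by
    intro a ha
    have ha' : 1 / 2 ≤ inner ℝ (‖b‖⁻¹ • b) (ι a) := ha
    rw [real_inner_smul_left, inv_mul_eq_div, le_div_iff₀ (by positivity)] at ha'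
    have h3 := confPow_le_of_inner_ge hk (b := b) (y := ι a) (by linarith)
    exact le_trans (show min 1 ‖b‖ / 8 ≤ 1 - confPow k b (ι a) by linarith) (le_abs_self _)
  have h4 : m.real S ≤ m.real {a | min 1 ‖b‖ / 8 ≤ |1 - confPow k b (ι a)|} := measureReal_mono h2
  nlinarith [hc.trans h4]

/-- The functions `confPow k b` stay away from `λ (1 + ε f)` by a multiple of `ε`, if `f` is not
orthogonal to some `h` that is orthogonal to the affine functions. For `b` large compared to `ε`
this holds since `confPow k b` is far from `1`; for `b` of order `ε` it follows from the first order
expansion in `b` and integration against `h`. -/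
theorem exists_le_integral_abs_sub_confPow {ι : α → Euc n} (hι : AEMeasurable ι m)
    (hι1 : ∀ᵐ a ∂m, ‖ι a‖ ≤ 1) {c₀ : ℝ} (hc₀ : 0 < c₀)
    (hcap : ∀ e : Euc n, ‖e‖ = 1 → c₀ ≤ m.real {a | 1 / 2 ≤ inner ℝ e (ι a)}) {k : ℝ}
    (hk : 1 / 2 ≤ k) {f h : α → ℝ} {M : ℝ} (hM : 0 < M) (hf : AEStronglyMeasurable f m)
    (hh : AEStronglyMeasurable h m) (hfM : ∀ᵐ a ∂m, |f a| ≤ M) (hhM : ∀ᵐ a ∂m, |h a| ≤ M)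
    (hh0 : ∫ a, h a ∂m = 0) (hhι : ∀ b, ∫ a, h a * inner ℝ b (ι a) ∂m = 0)
    (hhf : ∫ a, h a * f a ∂m ≠ 0) :
    ∃ c > 0, ∃ ε₀ > 0, ∀ ε l : ℝ, |ε| ≤ ε₀ → |l - 1| ≤ M * |ε| → ∀ b,
      c * |ε| ≤ ∫ a, |l * (1 + ε * f a) - confPow k b (ι a)| ∂m := by
  set A := |∫ a, h a * f a ∂m| with hA
  have hA0 : 0 < A := abs_pos.mpr hhf
  set c₁ := c₀ / 8 with hc₁
  have hc₁0 : 0 < c₁ := by positivity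
  set K := (3 * M + 1) / c₁ with hK
  have hK0 : 0 < K := by positivity
  set C := 9 * k + 16 * k ^ 2 with hC
  have hk0 : 0 < k := by linarith
  have hC0 : 0 < C := by positivity
  set b₀ := 1 / (4 * k + 4) with hb₀
  have hb₀0 : 0 < b₀ := by positivity
  refine ⟨min 1 (A / (4 * M)), by positivity, min (min (1 / (2 * M)) (min 1 b₀ / K))
    (A / (4 * (C * K ^ 2 * M))), by positivity, fun ε l hε hl b => ?_⟩
  have hε1 : |ε| ≤ 1 / (2 * M) := hε.trans ((min_le_left _ _).trans (min_le_left _ _))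
  have hε2 : |ε| ≤ min 1 b₀ / K := hε.trans ((min_le_left _ _).trans (min_le_right _ _))
  have hε3 : |ε| ≤ A / (4 * (C * K ^ 2 * M)) := hε.trans (min_le_right _ _)
  rw [le_div_iff₀ (by positivity)] at hε1 hε2 hε3
  have hε0 := abs_nonneg ε
  have hl1 : |l - 1| ≤ 1 / 2 := by linarith
  obtain ⟨hl2, hl3⟩ := abs_le.mp hl1
  have hwint := integrable_confPow hι hι1 k b
  have hfint : Integrable f m := Integrable.of_bound hf M hfM
  have hhint : Integrable h m := Integrable.of_bound hh M hhM
  have huint : Integrable (fun a => l * (1 + ε * f a)) m :=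
    ((integrable_const 1).add (hfint.const_mul ε)).const_mul l
  have hdint : Integrable (fun a => |l * (1 + ε * f a) - confPow k b (ι a)|) m :=
    (huint.sub hwint).abs
  -- comparison with the constant function
  have hfar : c₁ * min 1 ‖b‖ - 3 * M * |ε| ≤
      ∫ a, |l * (1 + ε * f a) - confPow k b (ι a)| ∂m := by
    have h1 := le_integral_abs_one_sub_confPow hι hι1 hcap hk b
    rw [← hc₁] at h1
    have h2 : ∫ a, |1 - confPow k b (ι a)| ∂m ≤
        ∫ a, (|l * (1 + ε * f a) - confPow k b (ι a)| + 3 * M * |ε|) ∂m := by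
      refine integral_mono_ae ((integrable_const 1).sub hwint).abs
        (hdint.add (integrable_const _)) ?_
      filter_upwards [hfM] with a ha
      have h3 : |l * (1 + ε * f a) - 1| ≤ 3 * M * |ε| := by
        have h4 : l * (1 + ε * f a) - 1 = (l - 1) + l * (ε * f a) := by ring
        rw [h4]
        refine (abs_add_le _ _).trans ?_
        rw [abs_mul, abs_mul]
        have h5 : |l| ≤ 2 := by rw [abs_le]; constructor <;> linarith
        have h6 : |ε| * |f a| ≤ |ε| * M := mul_le_mul_of_nonneg_left ha hε0
        have h7 : |l| * (|ε| * |f a|) ≤ 2 * (|ε| * M) :=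
          mul_le_mul h5 h6 (by positivity) (by norm_num)
        linarith
      have h8 := abs_sub_le 1 (l * (1 + ε * f a)) (confPow k b (ι a))
      rw [abs_sub_comm 1 (l * (1 + ε * f a))] at h8
      linarith
    rw [integral_add hdint (integrable_const _), integral_const, probReal_univ, one_smul] at h2
    linarith
  rcases le_or_gt (K * |ε|) (min 1 ‖b‖) with hcase | hcase
  · have h1 : (3 * M + 1) * |ε| ≤ c₁ * min 1 ‖b‖ := by
      have h2 := mul_le_mul_of_nonneg_left hcase hc₁0.le
      rwa [← mul_assoc, hK, mul_div_cancel₀ _ hc₁0.ne'] at h2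
    have h3 : min 1 (A / (4 * M)) * |ε| ≤ 1 * |ε| :=
      mul_le_mul_of_nonneg_right (min_le_left _ _) hε0
    linarith
  · -- `b` is of order `ε`: test against `h`
    have hbε : ‖b‖ ≤ K * |ε| := by
      have h1 : min 1 b₀ ≤ 1 := min_le_left _ _
      rcases min_lt_iff.mp hcase with h | h
      · linarith
      · exact h.le
    have hbb₀ : ‖b‖ ≤ b₀ := by
      have h1 : min 1 b₀ ≤ b₀ := min_le_right _ _
      linarith
    set R : α → ℝ := fun a => confPow k b (ι a) - 1 + k * inner ℝ b (ι a) with hR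
    have hinn : AEStronglyMeasurable (fun a => inner ℝ b (ι a)) m :=
      (by fun_prop : Measurable fun y : Euc n => inner ℝ b y).comp_aemeasurable hι
        |>.aestronglyMeasurable
    have hinnint : Integrable (fun a => inner ℝ b (ι a)) m := by
      refine Integrable.of_bound hinn ‖b‖ ?_
      filter_upwards [hι1] with a ha
      exact (norm_inner_le_norm b (ι a)).trans (mul_le_of_le_one_right (norm_nonneg b) ha)
    have hRint : Integrable R m := (hwint.sub (integrable_const 1)).add (hinnint.const_mul k)
    have hRb : ∀ᵐ a ∂m, |R a| ≤ C * (K * |ε|) ^ 2 := by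
      filter_upwards [hι1] with a ha
      refine (abs_confPow_sub_le hk0.le hbb₀ ha).trans ?_
      have := pow_le_pow_left₀ (norm_nonneg b) hbε 2
      exact mul_le_mul_of_nonneg_left this hC0.le
    have hexpand : ∫ a, h a * (l * (1 + ε * f a) - confPow k b (ι a)) ∂m =
        l * ε * ∫ a, h a * f a ∂m - ∫ a, h a * R a ∂m := by
      have h1 : ∀ a, h a * (l * (1 + ε * f a) - confPow k b (ι a)) =
          ((l - 1) * h a + l * ε * (h a * f a) + k * (h a * inner ℝ b (ι a))) - h a * R a := by
        intro a
        simp only [hR]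
        ring
      have i1 : Integrable (fun a => (l - 1) * h a) m := hhint.const_mul _
      have i2 : Integrable (fun a => l * ε * (h a * f a)) m :=
        (hfint.bdd_mul hh hhM).const_mul _
      have i3 : Integrable (fun a => k * (h a * inner ℝ b (ι a))) m :=
        (hinnint.bdd_mul hh hhM).const_mul _
      have i4 : Integrable (fun a => h a * R a) m := hRint.bdd_mul hh hhM
      simp only [h1]
      have i12 : Integrable (fun a => (l - 1) * h a + l * ε * (h a * f a)) m := i1.add i2
      have i123 : Integrable (fun a => (l - 1) * h a + l * ε * (h a * f a) +
          k * (h a * inner ℝ b (ι a))) m := i12.add i3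
      rw [integral_sub i123 i4, integral_add i12 i3, integral_add i1 i2,
        integral_const_mul, integral_const_mul, integral_const_mul, hh0, hhι]
      ring
    have hup : |∫ a, h a * (l * (1 + ε * f a) - confPow k b (ι a)) ∂m| ≤
        M * ∫ a, |l * (1 + ε * f a) - confPow k b (ι a)| ∂m := by
      have h1 : ‖∫ a, h a * (l * (1 + ε * f a) - confPow k b (ι a)) ∂m‖ ≤
          ∫ a, M * |l * (1 + ε * f a) - confPow k b (ι a)| ∂m := by
        refine norm_integral_le_of_norm_le (hdint.const_mul M) ?_
        filter_upwards [hhM] with a ha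
        rw [norm_mul]
        exact mul_le_mul_of_nonneg_right ha (norm_nonneg _)
      rwa [integral_const_mul] at h1
    have hRh : |∫ a, h a * R a ∂m| ≤ M * (C * (K * |ε|) ^ 2) := by
      have h1 : ‖∫ a, h a * R a ∂m‖ ≤ ∫ _, M * (C * (K * |ε|) ^ 2) ∂m := by
        refine norm_integral_le_of_norm_le (integrable_const _) ?_
        filter_upwards [hhM, hRb] with a ha ha'
        rw [norm_mul]
        exact mul_le_mul ha ha' (norm_nonneg _) hM.le
      rwa [integral_const, probReal_univ, one_smul] at h1
    have hmain : |l * ε * ∫ a, h a * f a ∂m| = |l| * |ε| * A := by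
      rw [abs_mul, abs_mul]
    have hlow : |l| * |ε| * A - M * (C * (K * |ε|) ^ 2) ≤
        M * ∫ a, |l * (1 + ε * f a) - confPow k b (ι a)| ∂m := by
      rw [hexpand] at hup
      have := abs_sub_abs_le_abs_sub (l * ε * ∫ a, h a * f a ∂m) (∫ a, h a * R a ∂m)
      linarith
    have hl4 : 1 / 2 ≤ |l| := le_trans (by linarith) (le_abs_self l)
    have h1 : 1 / 2 * |ε| * A ≤ |l| * |ε| * A := by gcongr
    have h2 : M * (C * (K * |ε|) ^ 2) ≤ |ε| * A / 4 := by
      have h3 : M * (C * (K * |ε|) ^ 2) = |ε| * (|ε| * (4 * (C * K ^ 2 * M))) / 4 := by ring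
      rw [h3]
      have := mul_le_mul_of_nonneg_left hε3 hε0
      linarith
    have h4 : |ε| * A / 4 ≤ M * ∫ a, |l * (1 + ε * f a) - confPow k b (ι a)| ∂m := by linarith
    have h5 : min 1 (A / (4 * M)) * |ε| ≤ A / (4 * M) * |ε| :=
      mul_le_mul_of_nonneg_right (min_le_right _ _) hε0
    refine h5.trans ?_
    rw [div_mul_eq_mul_div, div_le_iff₀ (by positivity)]
    linarith

end Distance

/-! ### Measure of caps -/

section Cap

variable {n : ℕ}

lemma cap_ballMeasure_le (e : Euc (n + 1)) (he : ‖e‖ = 1) :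
    (1 / 4) ^ (n + 1) ≤ (ballMeasure n).real {y | 1 / 2 ≤ inner ℝ e y} := by
  have hsub : ball ((3 / 4 : ℝ) • e) (1 / 4) ⊆ {y | 1 / 2 ≤ inner ℝ e y} ∩ ball 0 1 := by
    intro y hy
    rw [mem_ball, dist_eq_norm] at hy
    have h1 : y = (3 / 4 : ℝ) • e + (y - (3 / 4 : ℝ) • e) := by abel
    have h2 : inner ℝ e y = 3 / 4 + inner ℝ e (y - (3 / 4 : ℝ) • e) := by
      conv_lhs => rw [h1]
      rw [inner_add_right, real_inner_smul_right, real_inner_self_eq_norm_sq, he]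
      norm_num
    have h3 := (abs_le.mp (abs_real_inner_le_norm e (y - (3 / 4 : ℝ) • e))).1
    rw [he, one_mul] at h3
    refine ⟨?_, ?_⟩
    · rw [Set.mem_ofPred_eq, h2]
      linarith
    · rw [mem_ball_zero_iff]
      have h4 := norm_add_le ((3 / 4 : ℝ) • e) (y - (3 / 4 : ℝ) • e)
      rw [← h1, norm_smul, he] at h4
      norm_num at h4
      linarith
  have hv : (volume (ball (0 : Euc (n + 1)) 1)).toReal ≠ 0 :=
    (ENNReal.toReal_pos (measure_ball_pos _ _ one_pos).ne' measure_ball_lt_top.ne).ne'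
  have hm : MeasurableSet {y : Euc (n + 1) | 1 / 2 ≤ inner ℝ e y} :=
    measurableSet_le measurable_const (by fun_prop)
  have h5 : (ballMeasure n).real {y | 1 / 2 ≤ inner ℝ e y} =
      (volume (ball (0 : Euc (n + 1)) 1)).toReal⁻¹ *
        (volume ({y | 1 / 2 ≤ inner ℝ e y} ∩ ball (0 : Euc (n + 1)) 1)).toReal := by
    rw [Measure.real, ballMeasure, Measure.smul_apply, smul_eq_mul, ENNReal.toReal_mul,
      ENNReal.toReal_inv, Measure.restrict_apply hm]
  have h6 : (volume (ball ((3 / 4 : ℝ) • e) (1 / 4))).toReal =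
      (1 / 4) ^ (n + 1) * (volume (ball (0 : Euc (n + 1)) 1)).toReal := by
    rw [Measure.addHaar_ball_of_pos volume _ (by norm_num : (0 : ℝ) < 1 / 4), ENNReal.toReal_mul,
      ENNReal.toReal_ofReal (by positivity), finrank_euclideanSpace_fin]
  have h7 : (volume (ball ((3 / 4 : ℝ) • e) (1 / 4))).toReal ≤
      (volume ({y | 1 / 2 ≤ inner ℝ e y} ∩ ball (0 : Euc (n + 1)) 1)).toReal :=
    ENNReal.toReal_mono (measure_ne_top_of_subset Set.inter_subset_right measure_ball_lt_top.ne)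
      (measure_mono hsub)
  rw [h6] at h7
  rw [h5]
  calc (1 / 4 : ℝ) ^ (n + 1) = (volume (ball (0 : Euc (n + 1)) 1)).toReal⁻¹ *
        ((1 / 4) ^ (n + 1) * (volume (ball (0 : Euc (n + 1)) 1)).toReal) := by field_simp
    _ ≤ _ := mul_le_mul_of_nonneg_left h7 (by positivity)

lemma cap_sphereMeasure_le (e : Euc (n + 1)) (he : ‖e‖ = 1) :
    (1 / 4) ^ (n + 1) ≤
      (sphereMeasure n).real {ω : Sph n | 1 / 2 ≤ inner ℝ e (ω : Euc (n + 1))} := by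
  have hm : MeasurableSet {ω : Sph n | 1 / 2 ≤ inner ℝ e (ω : Euc (n + 1))} :=
    measurableSet_le measurable_const (by fun_prop)
  have h1 : (sphereMeasure n).real {ω : Sph n | 1 / 2 ≤ inner ℝ e (ω : Euc (n + 1))} =
      (ballMeasure n).real
        (sphereDir n ⁻¹' {ω : Sph n | 1 / 2 ≤ inner ℝ e (ω : Euc (n + 1))}) := by
    rw [Measure.real, sphereMeasure_eq_map, Measure.map_apply (measurable_sphereDir n) hm,
      Measure.real]
  rw [h1]
  refine (cap_ballMeasure_le e he).trans ?_
  have hae : ∀ᵐ y ∂(ballMeasure n), y ∈ {y : Euc (n + 1) | 1 / 2 ≤ inner ℝ e y} →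
      y ∈ sphereDir n ⁻¹' {ω : Sph n | 1 / 2 ≤ inner ℝ e (ω : Euc (n + 1))} := by
    filter_upwards [ae_mem_ball n] with y hy hy2
    have hy2' : 1 / 2 ≤ inner ℝ e y := hy2
    have hy0 : y ≠ 0 := by
      rintro rfl
      rw [inner_zero_right] at hy2'
      norm_num at hy2'
    have hpos := norm_pos_iff.mpr hy0
    have hlt := mem_ball_zero_iff.mp hy
    rw [Set.mem_preimage, Set.mem_ofPred_eq, coe_sphereDir hy0, real_inner_smul_right,
      inv_mul_eq_div, le_div_iff₀ hpos]
    nlinarith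
  exact ENNReal.toReal_mono (measure_ne_top _ _) (measure_mono_ae hae)

end Cap

/-! ### The action of Möbius transformations on functions -/

section Act

variable {n : ℕ}

lemma IsMoebiusSphere.exists_isConformal {Ψ : Sph n → Sph n} (h : IsMoebiusSphere n Ψ) :
    ∃ b : Euc (n + 1), IsConformal n Ψ (fun ω => confFactor b (Ψ ω : Euc (n + 1))) := by
  obtain ⟨h1, h2, b, h3⟩ := h.exists_confFactor
  exact ⟨b, h1, h2, by
    have := continuous_of_differentiableAt_radialExt h2
    exact (continuous_confFactor b).comp (continuous_subtype_val.comp this),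
    fun x => confFactor_pos b (by simp), h3⟩

lemma IsConformal.sphereAct_eq {Ψ : Sph n → Sph n} {κ : Sph n → ℝ} (h : IsConformal n Ψ κ)
    (hn : 2 ≤ n) (u : Sph n → ℝ) (ω : Sph n) :
    sphereAct n Ψ u ω = κ ω ^ (((n : ℝ) - 1) / 2) * u (Ψ ω) := by
  have hn0 : (n : ℝ) ≠ 0 := by positivity
  rw [sphereAct, h.sphereJac_eq, ← Real.rpow_natCast, ← Real.rpow_mul (h.pos ω).le, dim_eq]
  congr 2
  rw [show (n : ℝ) + 1 - 1 = n by ring]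
  field_simp
  ring

lemma isMoebiusSphere_id : IsMoebiusSphere n id := ⟨id, IsMoebius.id, fun _ => rfl⟩

lemma isMoebiusBall_id : IsMoebiusBall n id := ⟨id, IsMoebius.id, by simp, fun _ _ => rfl⟩

lemma isConformal_id : IsConformal n id (fun _ => 1) :=
  isConformal_isometry (LinearIsometryEquiv.refl ℝ (Euc (n + 1)))

lemma sphereAct_id (hn : 2 ≤ n) (u : Sph n → ℝ) : sphereAct n id u = u := by
  funext ω
  rw [isConformal_id.sphereAct_eq hn, Real.one_rpow, one_mul, id]

lemma ballAct_id (v : Euc (n + 1) → ℝ) : ballAct n id v = v := by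
  funext y
  simp [ballAct, ballJac, ContinuousLinearMap.det]

lemma continuous_confPow_sphere (k : ℝ) (b : Euc (n + 1)) :
    Continuous fun ω : Sph n => confPow k b (ω : Euc (n + 1)) :=
  (continuousOn_confPow k b).comp_continuous continuous_subtype_val fun ω => by simp

/-- The `L^p`-distance of `(u)_Ψ` to `1` is that of `u` to the image of `1` under `Ψ⁻¹`, a power
of a conformal factor; for other exponents a weight appears. -/
theorem IsMoebiusSphere.exists_sphereNorm_eq (hn : 2 ≤ n) {Ψ : Sph n → Sph n}
    (h : IsMoebiusSphere n Ψ) : ∃ b : Euc (n + 1), ∀ u : Sph n → ℝ, Continuous u →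
      sphereNorm n (expP n) (fun ω => sphereAct n Ψ u ω - 1) =
        sphereNorm n (expP n) (fun ω => u ω - confPow (((n : ℝ) - 1) / 2) b ω) ∧
      ∀ r, 1 ≤ r → ∫ ω : Sph n, |u ω - confPow (((n : ℝ) - 1) / 2) b ω| *
          confPow (((n : ℝ) + 1) / 2) b ω ∂(sphereMeasure n) ≤
        sphereNorm n r (fun ω => sphereAct n Ψ u ω - 1) := by
  obtain ⟨b, hc⟩ := h.exists_isConformal
  refine ⟨b, fun u hu => ?_⟩
  have hn' : (2 : ℝ) ≤ n := by exact_mod_cast hn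
  set k := ((n : ℝ) - 1) / 2 with hk
  have hw := continuous_confPow_sphere (n := n) k b
  have hw' := continuous_confPow_sphere (n := n) (((n : ℝ) + 1) / 2) b
  have hG : Continuous fun ω : Sph n => u ω - confPow k b ω := hu.sub hw
  have hact : ∀ ω, sphereAct n Ψ u ω - 1 =
      confFactor b (Ψ ω : Euc (n + 1)) ^ k * (u (Ψ ω) - confPow k b (Ψ ω : Euc (n + 1))) := by
    intro ω
    have hp := confFactor_pos b (y := (Ψ ω : Euc (n + 1))) (by simp)
    rw [hc.sphereAct_eq hn, mul_sub, confPow, Real.rpow_neg hp.le,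
      mul_inv_cancel₀ (Real.rpow_pos_of_pos hp _).ne']
  have habs : ∀ ω, |sphereAct n Ψ u ω - 1| =
      confFactor b (Ψ ω : Euc (n + 1)) ^ k * |u (Ψ ω) - confPow k b (Ψ ω : Euc (n + 1))| := by
    intro ω
    have hp := confFactor_pos b (y := (Ψ ω : Euc (n + 1))) (by simp)
    rw [hact, abs_mul, abs_of_pos (Real.rpow_pos_of_pos hp _)]
  have hactc : Continuous fun ω => sphereAct n Ψ u ω - 1 := by
    simp only [hact]
    exact (hc.continuous_factor.rpow_const fun ω => Or.inl (hc.pos ω).ne').mul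
      (hG.comp hc.continuous)
  have hp0 : 0 < expP n := by linarith [two_lt_expP hn]
  constructor
  · unfold sphereNorm
    rw [lpNorm_ofReal_eq hp0 hactc.aestronglyMeasurable, lpNorm_ofReal_eq hp0 hG.aestronglyMeasurable,
      ← hc.integral_comp (hG.abs.rpow_const fun _ => Or.inr hp0.le)]
    congr 2
    funext ω
    have hp := confFactor_pos b (y := (Ψ ω : Euc (n + 1))) (by simp)
    have hkp : k * expP n = n := by
      rw [hk, expP_eq]
      field_simp [show (n : ℝ) - 1 ≠ 0 by linarith]
    rw [habs, Real.mul_rpow (Real.rpow_nonneg hp.le _) (abs_nonneg _), ← Real.rpow_mul hp.le, hkp,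
      Real.rpow_natCast]
  · intro r hr
    have h1 : ∫ ω : Sph n, |u ω - confPow k b ω| * confPow (((n : ℝ) + 1) / 2) b ω
        ∂(sphereMeasure n) = ∫ ω, |sphereAct n Ψ u ω - 1| ∂(sphereMeasure n) := by
      have hGw : Continuous fun ω : Sph n =>
          |u ω - confPow k b ω| * confPow (((n : ℝ) + 1) / 2) b ω := hG.abs.mul hw'
      rw [← hc.integral_comp hGw]
      congr 1
      funext ω
      have hp := confFactor_pos b (y := (Ψ ω : Euc (n + 1))) (by simp)
      rw [habs, mul_left_comm, mul_comm, confPow, ← Real.rpow_natCast, ← Real.rpow_add hp, hk]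
      ring_nf
    rw [h1]
    exact integral_abs_le_lpNorm hr (memLp_of_continuous_sphere hactc _)

/-- The `L^{q'}`-distance of `[v]_Φ` to `1` controls the `L¹`-distance of `v` to the image of `1`
under `Φ⁻¹`, a power of a conformal factor. -/
theorem IsMoebiusBall.exists_le_ballNorm (hn : 2 ≤ n) {Φ : Euc (n + 1) → Euc (n + 1)}
    (h : IsMoebiusBall n Φ) : ∃ b : Euc (n + 1), ∀ v : Euc (n + 1) → ℝ, ContinuousOn v (ball 0 1) →
      ∀ M, (∀ y ∈ ball (0 : Euc (n + 1)) 1, |v y| ≤ M) →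
      ∫ y, |v y - confPow (((n : ℝ) + 3) / 2) b y| ∂(ballMeasure n) ≤
        ballNorm n (expQ' n) (fun y => ballAct n Φ v y - 1) := by
  obtain ⟨himg, hinj, hdiff, b, hb⟩ := h.exists_confFactor
  refine ⟨b, fun v hv M hM => ?_⟩
  have hn' : (2 : ℝ) ≤ n := by exact_mod_cast hn
  set k := ((n : ℝ) + 3) / 2 with hk
  have hk0 : 0 < k := by positivity
  have hmaps : ∀ y ∈ ball (0 : Euc (n + 1)) 1, Φ y ∈ ball (0 : Euc (n + 1)) 1 := fun y hy => by
    rw [← himg]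
    exact Set.mem_image_of_mem Φ hy
  have hΦc : ContinuousOn Φ (ball 0 1) := fun y hy => (hdiff y hy).continuousAt.continuousWithinAt
  have hpos : ∀ y ∈ ball (0 : Euc (n + 1)) 1, 0 < confFactor b y := fun y hy =>
    confFactor_pos b (mem_ball_zero_iff.mp hy).le
  have hjac : ∀ y ∈ ball (0 : Euc (n + 1)) 1, |(fderiv ℝ Φ y).det| = confFactor b (Φ y) ^ (n + 1) := by
    intro y hy
    have h1 := abs_det_fderiv_of_dist (k := fun y => confFactor b (Φ y)) (hdiff y hy)
      ((continuous_confFactor b).continuousAt.comp (hdiff y hy).continuousAt)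
      (hpos _ (hmaps y hy)).le (by
        filter_upwards [isOpen_ball.mem_nhds hy] with z hz
        exact hb z hz y hy)
    rwa [finrank_euclideanSpace_fin] at h1
  have hcb : ContinuousOn (confPow k b) (ball 0 1) :=
    (continuousOn_confPow k b).mono ball_subset_closedBall
  have hG : ContinuousOn (fun y => v y - confPow k b y) (ball 0 1) := hv.sub hcb
  have hexp : ∀ y ∈ ball (0 : Euc (n + 1)) 1, ballAct n Φ v y = confFactor b (Φ y) ^ k * v (Φ y) := by
    intro y hy
    rw [ballAct, ballJac, hjac y hy, ← Real.rpow_natCast,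
      ← Real.rpow_mul (hpos _ (hmaps y hy)).le, dim_eq, hk]
    congr 2
    push_cast
    field_simp
    ring
  have hact : ∀ y ∈ ball (0 : Euc (n + 1)) 1, ballAct n Φ v y - 1 =
      confFactor b (Φ y) ^ k * (v (Φ y) - confPow k b (Φ y)) := by
    intro y hy
    have hp := hpos _ (hmaps y hy)
    rw [hexp y hy, mul_sub, confPow, Real.rpow_neg hp.le,
      mul_inv_cancel₀ (Real.rpow_pos_of_pos hp _).ne']
  have hactc : ContinuousOn (fun y => ballAct n Φ v y - 1) (ball 0 1) := by
    refine ContinuousOn.congr (f := fun y => confFactor b (Φ y) ^ k * (v (Φ y) - confPow k b (Φ y)))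
      ?_ hact
    refine ContinuousOn.mul ?_ (hG.comp hΦc hmaps)
    exact ((continuous_confFactor b).comp_continuousOn hΦc).rpow_const fun y hy =>
      Or.inl (hpos _ (hmaps y hy)).ne'
  have hq : 1 < expQ' n := one_lt_expQ' hn
  have hq0 : 0 < expQ' n := by linarith
  have hkq : k * expQ' n = (n + 1 : ℕ) := by
    rw [hk, expQ', dim_eq]
    push_cast
    field_simp
    ring
  -- the norms agree, by the change of variables
  have heq : ballNorm n (expQ' n) (fun y => ballAct n Φ v y - 1) =
      ballNorm n (expQ' n) (fun y => v y - confPow k b y) := by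
    unfold ballNorm
    rw [lpNorm_ofReal_eq hq0 (aestronglyMeasurable_of_continuousOn_ball hactc),
      lpNorm_ofReal_eq hq0 (aestronglyMeasurable_of_continuousOn_ball hG), integral_ballMeasure,
      integral_ballMeasure]
    congr 2
    conv_rhs => rw [← himg]
    rw [integral_image_eq_integral_abs_det_fderiv_smul volume measurableSet_ball
      (fun y hy => (hdiff y hy).hasFDerivAt.hasFDerivWithinAt) hinj]
    refine setIntegral_congr_fun measurableSet_ball fun y hy => ?_
    have hp := hpos _ (hmaps y hy)
    beta_reduce
    rw [hact y hy, abs_mul, abs_of_pos (Real.rpow_pos_of_pos hp _),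
      Real.mul_rpow (Real.rpow_nonneg hp.le _) (abs_nonneg _), ← Real.rpow_mul hp.le, hkq,
      Real.rpow_natCast, hjac y hy, smul_eq_mul]
  rw [heq]
  obtain ⟨K, hK⟩ := (isCompact_closedBall (0 : Euc (n + 1)) 1).exists_bound_of_continuousOn
    (continuousOn_confPow k b)
  refine integral_abs_le_lpNorm hq.le (MemLp.of_bound
    (aestronglyMeasurable_of_continuousOn_ball hG) (M + K) ?_)
  filter_upwards [ae_mem_ball n] with y hy
  exact (norm_sub_le _ _).trans (add_le_add (hM y hy) (hK y (ball_subset_closedBall hy)))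

end Act

/-! ### Distances and sharpness -/

section Sharp

variable {n : ℕ}

lemma rpow_le_sphereDist {r s c : ℝ} (hs : 0 ≤ s) (hc : 0 ≤ c) {u : Sph n → ℝ}
    (h : ∀ Ψ, IsMoebiusSphere n Ψ → c ≤ sphereNorm n r (fun ω => sphereAct n Ψ u ω - 1)) :
    c ^ s ≤ sphereDist n r s u :=
  haveI : Nonempty {Ψ : Sph n → Sph n // IsMoebiusSphere n Ψ} := ⟨⟨id, isMoebiusSphere_id⟩⟩
  le_ciInf fun Ψ => Real.rpow_le_rpow hc (h Ψ.1 Ψ.2) hs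

lemma rpow_le_ballDist {r s c : ℝ} (hs : 0 ≤ s) (hc : 0 ≤ c) {v : Euc (n + 1) → ℝ}
    (h : ∀ Φ, IsMoebiusBall n Φ → c ≤ ballNorm n r (fun y => ballAct n Φ v y - 1)) :
    c ^ s ≤ ballDist n r s v :=
  haveI : Nonempty {Φ : Euc (n + 1) → Euc (n + 1) // IsMoebiusBall n Φ} :=
    ⟨⟨id, isMoebiusBall_id⟩⟩
  le_ciInf fun Φ => Real.rpow_le_rpow hc (h Φ.1 Φ.2) hs

lemma sphereDist_nonneg (r s : ℝ) (u : Sph n → ℝ) : 0 ≤ sphereDist n r s u :=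
  Real.iInf_nonneg fun _ => Real.rpow_nonneg lpNorm_nonneg _

lemma ballDist_nonneg (r s : ℝ) (v : Euc (n + 1) → ℝ) : 0 ≤ ballDist n r s v :=
  Real.iInf_nonneg fun _ => Real.rpow_nonneg lpNorm_nonneg _

lemma sphereDist_one_le (hn : 2 ≤ n) (r : ℝ) (u : Sph n → ℝ) :
    sphereDist n r 1 u ≤ sphereNorm n r (fun ω => u ω - 1) := by
  refine (ciInf_le ⟨0, ?_⟩ ⟨id, isMoebiusSphere_id⟩).trans ?_
  · rintro _ ⟨Ψ, rfl⟩
    exact Real.rpow_nonneg lpNorm_nonneg _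
  · rw [Real.rpow_one, sphereAct_id hn]

lemma ballDist_one_le (r : ℝ) (v : Euc (n + 1) → ℝ) :
    ballDist n r 1 v ≤ ballNorm n r (fun y => v y - 1) := by
  refine (ciInf_le ⟨0, ?_⟩ ⟨id, isMoebiusBall_id⟩).trans ?_
  · rintro _ ⟨Φ, rfl⟩
    exact Real.rpow_nonneg lpNorm_nonneg _
  · rw [Real.rpow_one, ballAct_id]

/-- An exponent is sharp if the distances are at least of order `δ j` and the deficits at most of
order `δ j ^ r`, where `δ j → 0`. -/
theorem exponentSharp_of_le {D : ℕ → ℝ} {dist : ℝ → ℕ → ℝ} {r c₀ C : ℝ} {δ : ℕ → ℝ} (hr : 0 < r)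
    (hc₀ : 0 < c₀) (hC : 0 ≤ C) (hδ : ∀ j, 0 < δ j) (hδ0 : Tendsto δ atTop (𝓝 0))
    (hdist : ∀ᶠ j in atTop, ∀ s, 0 < s → (c₀ * δ j) ^ s ≤ dist s j)
    (hD : ∀ᶠ j in atTop, D j ≤ C * δ j ^ r) : ExponentSharp D dist r := by
  refine ⟨?_, ?_, fun s hs hsr c hc => ?_⟩
  · filter_upwards [hdist] with j hj
    exact (Real.rpow_pos_of_pos (mul_pos hc₀ (hδ j)) r).trans_le (hj r hr)
  · refine lt_of_le_of_lt (limsup_le_of_le (a := ((C / c₀ ^ r : ℝ) : EReal)) ?_ ?_)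
      (EReal.coe_lt_top _)
    · isBoundedDefault
    · filter_upwards [hdist, hD] with j hj hDj
      rw [EReal.coe_le_coe_iff]
      have h1 := hj r hr
      have h2 : 0 < c₀ ^ r := Real.rpow_pos_of_pos hc₀ r
      have h3 : 0 < δ j ^ r := Real.rpow_pos_of_pos (hδ j) r
      rw [Real.mul_rpow hc₀.le (hδ j).le] at h1
      have h4 : 0 < dist r j := (mul_pos h2 h3).trans_le h1
      rw [div_le_div_iff₀ h4 h2]
      calc D j * c₀ ^ r ≤ C * δ j ^ r * c₀ ^ r := mul_le_mul_of_nonneg_right hDj h2.le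
        _ = C * (c₀ ^ r * δ j ^ r) := by ring
        _ ≤ C * dist r j := mul_le_mul_of_nonneg_left h1 hC
  · have hlim : Tendsto (fun j => C * δ j ^ (r - s)) atTop (𝓝 0) := by
      have h1 := (hδ0.rpow_const (p := r - s) (Or.inr (by linarith))).const_mul C
      rwa [Real.zero_rpow (by linarith), mul_zero] at h1
    have hcs : 0 < c * c₀ ^ s := mul_pos hc (Real.rpow_pos_of_pos hc₀ s)
    filter_upwards [hdist, hD, hlim.eventually_lt_const hcs] with j hj hDj hl
    have h1 := hj s hs
    rw [Real.mul_rpow hc₀.le (hδ j).le] at h1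
    have h2 : 0 < δ j ^ s := Real.rpow_pos_of_pos (hδ j) s
    calc D j ≤ C * δ j ^ r := hDj
      _ = C * δ j ^ (r - s) * δ j ^ s := by
        rw [mul_assoc, ← Real.rpow_add (hδ j), sub_add_cancel]
      _ < c * c₀ ^ s * δ j ^ s := mul_lt_mul_of_pos_right hl h2
      _ = c * (c₀ ^ s * δ j ^ s) := by ring
      _ ≤ c * dist s j := mul_le_mul_of_nonneg_left h1 hc.le

end Sharp

/-! ### Small perturbations of the constant function -/

section Perturbation

variable {α : Type*} [MeasurableSpace α] {m : Measure α} [IsProbabilityMeasure m]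

lemma one_add_rpow_le {p x : ℝ} (hp : 1 ≤ p) (hx : |p * x| ≤ 1) :
    |1 + x| ^ p ≤ 1 + p * x + (p * x) ^ 2 := by
  have h1 : |x| ≤ 1 := by
    rw [abs_mul, abs_of_nonneg (by linarith)] at hx
    nlinarith [abs_nonneg x]
  have h2 : 0 ≤ 1 + x := by linarith [(abs_le.mp h1).1]
  have h3 : |1 + x| ^ p ≤ Real.exp (p * x) := by
    rw [abs_of_nonneg h2, mul_comm, Real.exp_mul]
    exact Real.rpow_le_rpow h2 (by linarith [Real.add_one_le_exp x]) (by linarith)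
  have h4 := (abs_le.mp (Real.abs_exp_sub_one_sub_id_le hx)).2
  linarith

lemma lpNorm_le_of_ae_abs_le {r C : ℝ} (hr : 0 < r) {f : α → ℝ} (hf : AEStronglyMeasurable f m)
    (hC : 0 ≤ C) (h : ∀ᵐ a ∂m, |f a| ≤ C) : lpNorm f (ENNReal.ofReal r) m ≤ C := by
  have h1 : ∫ a, |f a| ^ r ∂m ≤ ∫ _, C ^ r ∂m := by
    refine integral_mono_of_nonneg (Eventually.of_forall fun a => ?_) (integrable_const _) ?_
    · exact Real.rpow_nonneg (abs_nonneg _) _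
    · filter_upwards [h] with a ha
      exact Real.rpow_le_rpow (abs_nonneg _) ha hr.le
  rw [integral_const, probReal_univ, one_smul, ← lpNorm_ofReal_rpow hr hf] at h1
  exact (Real.rpow_le_rpow_iff lpNorm_nonneg hC hr).mp h1

variable {f : α → ℝ} {M ε p : ℝ}

lemma memLp_one_add_mul (hf : AEStronglyMeasurable f m) (hM : ∀ᵐ a ∂m, |f a| ≤ M) (p : ℝ≥0∞) :
    MemLp (fun a => 1 + ε * f a) p m := by
  have h1 : MemLp f p m := MemLp.of_bound hf M hM
  have h2 : MemLp (fun a => ε * f a) p m := h1.const_mul ε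
  have h3 : MemLp (fun _ : α => (1 : ℝ)) p m := memLp_const 1
  exact h3.add h2

lemma integral_one_add_mul (hf : AEStronglyMeasurable f m) (hM : ∀ᵐ a ∂m, |f a| ≤ M) :
    ∫ a, (1 + ε * f a) ∂m = 1 + ε * ∫ a, f a ∂m := by
  rw [integral_add (integrable_const 1) ((Integrable.of_bound hf M hM).const_mul ε),
    integral_const_mul, integral_const, probReal_univ, one_smul]

lemma one_le_lpNorm_one_add_mul (hp : 1 ≤ p) (hf : AEStronglyMeasurable f m)
    (hM : ∀ᵐ a ∂m, |f a| ≤ M) (hε : 0 ≤ ε * ∫ a, f a ∂m) :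
    1 ≤ lpNorm (fun a => 1 + ε * f a) (ENNReal.ofReal p) m := by
  have h := integral_le_lpNorm hp (memLp_one_add_mul (ε := ε) hf hM (ENNReal.ofReal p))
  rw [integral_one_add_mul hf hM] at h
  linarith

lemma lpNorm_one_add_mul_le (hp : 1 ≤ p) (hf : AEStronglyMeasurable f m) (hM0 : 0 ≤ M)
    (hM : ∀ᵐ a ∂m, |f a| ≤ M) :
    lpNorm (fun a => 1 + ε * f a) (ENNReal.ofReal p) m ≤ 1 + M * |ε| := by
  refine lpNorm_le_of_ae_abs_le (by linarith) (memLp_one_add_mul hf hM 1).aestronglyMeasurable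
    (by positivity) ?_
  filter_upwards [hM] with a ha
  refine (abs_add_le _ _).trans ?_
  rw [abs_one, abs_mul, mul_comm M]
  gcongr

lemma abs_inv_lpNorm_sub_one_le (hp : 1 ≤ p) (hf : AEStronglyMeasurable f m) (hM0 : 0 ≤ M)
    (hM : ∀ᵐ a ∂m, |f a| ≤ M) (hε : 0 ≤ ε * ∫ a, f a ∂m) :
    |(lpNorm (fun a => 1 + ε * f a) (ENNReal.ofReal p) m)⁻¹ - 1| ≤ M * |ε| := by
  have h1 := one_le_lpNorm_one_add_mul hp hf hM hε
  have h2 := lpNorm_one_add_mul_le (ε := ε) hp hf hM0 hM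
  set N := lpNorm (fun a => 1 + ε * f a) (ENNReal.ofReal p) m
  have hN : 0 < N := by linarith
  have h3 : N⁻¹ ≤ 1 := inv_le_one_of_one_le₀ h1
  rw [abs_of_nonpos (by linarith), neg_sub]
  have h4 : 1 - N⁻¹ = (N - 1) * N⁻¹ := by field_simp
  rw [h4]
  nlinarith

lemma lpNorm_normalized_sub_one_le (hp : 1 ≤ p) (hf : AEStronglyMeasurable f m) (hM0 : 0 ≤ M)
    (hM : ∀ᵐ a ∂m, |f a| ≤ M) (hε : 0 ≤ ε * ∫ a, f a ∂m) :
    lpNorm (fun a => (lpNorm (fun a => 1 + ε * f a) (ENNReal.ofReal p) m)⁻¹ * (1 + ε * f a) - 1)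
      (ENNReal.ofReal p) m ≤ 2 * M * |ε| := by
  have h1 := one_le_lpNorm_one_add_mul hp hf hM hε
  have h2 := abs_inv_lpNorm_sub_one_le hp hf hM0 hM hε
  set N := lpNorm (fun a => 1 + ε * f a) (ENNReal.ofReal p) m
  have hN : 0 < N := by linarith
  have h3 : N⁻¹ ≤ 1 := inv_le_one_of_one_le₀ h1
  have hN' : 0 ≤ N⁻¹ := by positivity
  refine lpNorm_le_of_ae_abs_le (by linarith) ?_ (by positivity) ?_
  · exact (((memLp_one_add_mul hf hM 1).const_mul _).sub (memLp_const 1)).aestronglyMeasurable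
  · filter_upwards [hM] with a ha
    have h4 : N⁻¹ * (1 + ε * f a) - 1 = (N⁻¹ - 1) + N⁻¹ * (ε * f a) := by ring
    rw [h4]
    refine (abs_add_le _ _).trans ?_
    rw [abs_mul, abs_mul, abs_of_nonneg hN']
    have h5 : |ε| * |f a| ≤ |ε| * M := mul_le_mul_of_nonneg_left ha (abs_nonneg ε)
    have h6 : N⁻¹ * (|ε| * |f a|) ≤ 1 * (|ε| * M) :=
      mul_le_mul h3 h5 (by positivity) zero_le_one
    linarith

/-- The defect in Jensen's inequality for a small perturbation of `1` is of second order. -/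
lemma integral_one_add_mul_rpow_le (hp : 1 ≤ p) (hf : AEStronglyMeasurable f m)
    (hM : ∀ᵐ a ∂m, |f a| ≤ M) (hε : 0 ≤ ε * ∫ a, f a ∂m) (hsmall : p * M * |ε| ≤ 1) :
    ∫ a, |1 + ε * f a| ^ p ∂m ≤ (∫ a, (1 + ε * f a) ∂m) ^ p + (p * M) ^ 2 * ε ^ 2 := by
  have hfi : Integrable f m := Integrable.of_bound hf M hM
  have hi : Integrable (fun a => p * ε * f a) m := hfi.const_mul _
  have h1 : ∫ a, |1 + ε * f a| ^ p ∂m ≤ ∫ a, (1 + (p * M) ^ 2 * ε ^ 2 + p * ε * f a) ∂m := by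
    refine integral_mono_of_nonneg (Eventually.of_forall fun a => ?_)
      ((integrable_const _).add hi) ?_
    · exact Real.rpow_nonneg (abs_nonneg _) _
    · filter_upwards [hM] with a ha
      have h2 : |p * (ε * f a)| ≤ p * M * |ε| := by
        rw [abs_mul, abs_mul, abs_of_nonneg (by linarith)]
        calc p * (|ε| * |f a|) ≤ p * (|ε| * M) := by gcongr
          _ = _ := by ring
      have h3 := one_add_rpow_le hp (h2.trans hsmall)
      have h4 : (p * (ε * f a)) ^ 2 ≤ (p * M) ^ 2 * ε ^ 2 := by
        rw [← sq_abs, ← sq_abs ε, ← mul_pow]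
        exact pow_le_pow_left₀ (abs_nonneg _) h2 2
      linarith
  rw [integral_add (integrable_const _) hi, integral_const, probReal_univ, one_smul,
    integral_const_mul] at h1
  have h5 := one_add_mul_self_le_rpow_one_add (s := ε * ∫ a, f a ∂m) (by linarith) hp
  rw [integral_one_add_mul hf hM]
  linarith

end Perturbation

/-! ### Two bubbles in the ball -/

section BallBubble

variable {n : ℕ}

/-- The denominator `1 - 2 η·y + |η|² |y|²` in the Möbius transformation `phiEta`. -/
noncomputable def phiDenom (η y : Euc (n + 1)) : ℝ := 1 - 2 * inner ℝ η y + ‖η‖ ^ 2 * ‖y‖ ^ 2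

lemma sq_one_sub_le_phiDenom {η y : Euc (n + 1)} (hη : ‖η‖ < 1) (hy : ‖y‖ < 1) :
    (1 - ‖η‖) ^ 2 ≤ phiDenom η y := by
  have h1 := (abs_le.mp (abs_real_inner_le_norm η y)).2
  have h2 : (1 - ‖η‖ * ‖y‖) ^ 2 ≤ phiDenom η y := by
    rw [phiDenom]
    nlinarith
  have h3 : ‖η‖ * ‖y‖ ≤ ‖η‖ := mul_le_of_le_one_right (norm_nonneg η) hy.le
  refine le_trans (pow_le_pow_left₀ (by linarith) (by linarith) 2) h2

lemma phiDenom_pos {η y : Euc (n + 1)} (hη : ‖η‖ < 1) (hy : ‖y‖ < 1) : 0 < phiDenom η y :=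
  (pow_pos (by linarith) 2).trans_le (sq_one_sub_le_phiDenom hη hy)

lemma continuous_phiDenom (η : Euc (n + 1)) : Continuous (phiDenom η) := by
  unfold phiDenom
  fun_prop

lemma norm_phiEta_sub_sq {η y z : Euc (n + 1)} (hy : phiDenom η y ≠ 0) (hz : phiDenom η z ≠ 0) :
    ‖phiEta n η y - phiEta n η z‖ ^ 2 =
      (1 - ‖η‖ ^ 2) / phiDenom η y * ((1 - ‖η‖ ^ 2) / phiDenom η z) * ‖y - z‖ ^ 2 := by
  have hphi : ∀ x, phiDenom η x ≠ 0 → phiEta n η x = (phiDenom η x)⁻¹ •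
      ((1 - ‖η‖ ^ 2) • x - (1 - 2 * inner ℝ η x + ‖x‖ ^ 2) • η) := by
    intro x hx
    have h1 : ‖x - η‖ ^ 2 = ‖x‖ ^ 2 - 2 * inner ℝ η x + ‖η‖ ^ 2 := by
      rw [norm_sub_sq_real, real_inner_comm]
    rw [phiEta, ← phiDenom, h1]
    congr 1
    module
  rw [hphi y hy, hphi z hz]
  have e1 : ∀ x : Euc (n + 1), ‖x‖ ^ 2 = inner ℝ x x := fun x =>
    (real_inner_self_eq_norm_sq x).symm
  have hy' : 1 - 2 * inner ℝ η y + inner ℝ η η * inner ℝ y y ≠ 0 := by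
    rw [← e1, ← e1]
    exact hy
  have hz' : 1 - 2 * inner ℝ η z + inner ℝ η η * inner ℝ z z ≠ 0 := by
    rw [← e1, ← e1]
    exact hz
  simp only [phiDenom, e1, inner_sub_left, inner_sub_right, real_inner_smul_left,
    real_inner_smul_right, real_inner_comm η y, real_inner_comm η z, real_inner_comm y z]
  generalize (inner ℝ η η : ℝ) = a at *
  generalize (inner ℝ η y : ℝ) = a₁ at *
  generalize (inner ℝ η z : ℝ) = a₂ at *
  generalize (inner ℝ y y : ℝ) = a₃ at *
  generalize (inner ℝ z z : ℝ) = a₄ at *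
  field_simp
  ring

lemma differentiableAt_phiEta {η y : Euc (n + 1)} (hy : phiDenom η y ≠ 0) :
    DifferentiableAt ℝ (phiEta n η) y := by
  have h1 : DifferentiableAt ℝ (fun y : Euc (n + 1) => ‖y‖ ^ 2) y :=
    (differentiable_id.norm_sq ℝ).differentiableAt
  have h2 : DifferentiableAt ℝ (fun y : Euc (n + 1) => ‖y - η‖ ^ 2) y :=
    ((differentiable_id.sub_const η).norm_sq ℝ).differentiableAt
  have h3 : DifferentiableAt ℝ (fun y : Euc (n + 1) => inner ℝ η y) y :=
    (innerSL ℝ η).differentiableAt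
  have h4 : DifferentiableAt ℝ (phiDenom η) y := by
    unfold phiDenom
    fun_prop
  have h5 : DifferentiableAt ℝ (fun y => (phiDenom η y)⁻¹) y := h4.inv hy
  have h6 : phiEta n η = fun y => (phiDenom η y)⁻¹ •
      ((1 - ‖η‖ ^ 2) • (y - η) - ‖y - η‖ ^ 2 • η) := rfl
  rw [h6]
  fun_prop

/-- The explicit form of the bubble `[1]_{Φ_η}` in the ball. -/
lemma ballAct_phiEta_one {η y : Euc (n + 1)} (hη : ‖η‖ < 1) (hy : ‖y‖ < 1) :
    ballAct n (phiEta n η) (fun _ => 1) y =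
      ((1 - ‖η‖ ^ 2) / phiDenom η y) ^ (((n : ℝ) + 3) / 2) := by
  have hp := phiDenom_pos hη hy
  have hη' := one_sub_norm_sq_pos hη
  have hq : 0 < (1 - ‖η‖ ^ 2) / phiDenom η y := by positivity
  have h := abs_det_fderiv_of_dist (k := fun y => (1 - ‖η‖ ^ 2) / phiDenom η y)
    (differentiableAt_phiEta hp.ne')
    (continuousAt_const.div (continuous_phiDenom η).continuousAt hp.ne') hq.le (by
      filter_upwards [(continuous_phiDenom η).continuousAt.eventually_ne hp.ne'] with z hz
      exact norm_phiEta_sub_sq hz hp.ne')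
  rw [finrank_euclideanSpace_fin] at h
  rw [ballAct, ballJac, h, mul_one, ← Real.rpow_natCast, ← Real.rpow_mul hq.le, dim_eq]
  congr 1
  push_cast
  field_simp
  ring

lemma continuousOn_ballAct_phiEta_one {η : Euc (n + 1)} (hη : ‖η‖ < 1) :
    ContinuousOn (ballAct n (phiEta n η) fun _ => 1) (ball 0 1) := by
  have hη' := one_sub_norm_sq_pos hη
  refine ContinuousOn.congr
    (f := fun y => ((1 - ‖η‖ ^ 2) / phiDenom η y) ^ (((n : ℝ) + 3) / 2)) ?_
    fun y hy => ballAct_phiEta_one hη (mem_ball_zero_iff.mp hy)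
  refine (continuousOn_const.div (continuous_phiDenom η).continuousOn fun y hy =>
    (phiDenom_pos hη (mem_ball_zero_iff.mp hy)).ne').rpow_const fun y hy => Or.inl ?_
  exact (div_pos hη' (phiDenom_pos hη (mem_ball_zero_iff.mp hy))).ne'

lemma ballAct_phiEta_one_nonneg {η y : Euc (n + 1)} (hη : ‖η‖ < 1) (hy : ‖y‖ < 1) :
    0 ≤ ballAct n (phiEta n η) (fun _ => 1) y := by
  rw [ballAct_phiEta_one hη hy]
  exact Real.rpow_nonneg (div_nonneg (one_sub_norm_sq_pos hη).le (phiDenom_pos hη hy).le) _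

lemma exists_ballAct_phiEta_one_le {η : Euc (n + 1)} (hη : ‖η‖ < 1) :
    ∃ M : ℝ, 0 < M ∧ ∀ y ∈ ball (0 : Euc (n + 1)) 1,
      |ballAct n (phiEta n η) (fun _ => 1) y| ≤ M := by
  have hη' := one_sub_norm_sq_pos hη
  have h1 : 0 < (1 - ‖η‖) ^ 2 := pow_pos (by linarith) 2
  refine ⟨((1 - ‖η‖ ^ 2) / (1 - ‖η‖) ^ 2) ^ (((n : ℝ) + 3) / 2), by positivity, fun y hy => ?_⟩
  have hy' := mem_ball_zero_iff.mp hy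
  rw [abs_of_nonneg (ballAct_phiEta_one_nonneg hη hy'), ballAct_phiEta_one hη hy']
  have h2 := phiDenom_pos hη hy'
  exact Real.rpow_le_rpow (by positivity)
    (div_le_div_of_nonneg_left hη'.le h1 (sq_one_sub_le_phiDenom hη hy')) (by positivity)

/-- The bubble is strictly convex at the origin in the direction of `η`, so it is not affine. -/
lemma ballAct_phiEta_one_midpoint {η : Euc (n + 1)} (hη : ‖η‖ < 1) (hη0 : η ≠ 0) :
    2 * ballAct n (phiEta n η) (fun _ => 1) 0 <
      ballAct n (phiEta n η) (fun _ => 1) ((1 / 2 : ℝ) • η) +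
      ballAct n (phiEta n η) (fun _ => 1) (-((1 / 2 : ℝ) • η)) := by
  have hη' := one_sub_norm_sq_pos hη
  have hpos := norm_pos_iff.mpr hη0
  set k := ((n : ℝ) + 3) / 2 with hk
  have hk0 : 0 < k := by positivity
  have hnt : ‖(1 / 2 : ℝ) • η‖ < 1 := by
    rw [norm_smul]
    norm_num
    linarith
  set x := ‖η‖ ^ 2 / 2 with hx
  have hx0 : 0 < x := by positivity
  have hx1 : x < 1 := by
    have : ‖η‖ ^ 2 < 1 := by linarith
    linarith
  have d1 : phiDenom η ((1 / 2 : ℝ) • η) = (1 - x) ^ 2 := by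
    rw [phiDenom, real_inner_smul_right, real_inner_self_eq_norm_sq, norm_smul, hx]
    norm_num
    ring
  have d2 : phiDenom η (-((1 / 2 : ℝ) • η)) = (1 + x) ^ 2 := by
    rw [phiDenom, inner_neg_right, norm_neg, real_inner_smul_right, real_inner_self_eq_norm_sq,
      norm_smul, hx]
    norm_num
    ring
  have d0 : phiDenom η (0 : Euc (n + 1)) = 1 := by simp [phiDenom]
  rw [ballAct_phiEta_one hη (by simp), ballAct_phiEta_one hη hnt,
    ballAct_phiEta_one hη (by rwa [norm_neg]), d0, d1, d2, div_one]
  set a := 1 - ‖η‖ ^ 2 with ha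
  set A := (a / (1 - x) ^ 2) ^ k with hA
  set B := (a / (1 + x) ^ 2) ^ k with hB
  have hx2 : 0 < 1 - x := by linarith
  have hA0 : 0 < A := by positivity
  have hB0 : 0 < B := by positivity
  have hak : 0 < a ^ k := by positivity
  -- the product of the two values exceeds the square of the value at the origin
  have hAB : (a ^ k) ^ 2 < A * B := by
    rw [hA, hB, ← Real.mul_rpow (by positivity) (by positivity), sq,
      ← Real.mul_rpow hη'.le hη'.le]
    refine Real.rpow_lt_rpow (by positivity) ?_ hk0
    rw [div_mul_div_comm, lt_div_iff₀ (by positivity)]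
    have h1 : (1 - x) ^ 2 * (1 + x) ^ 2 < 1 := by
      have h2 : (1 - x) ^ 2 * (1 + x) ^ 2 = (1 - x ^ 2) ^ 2 := by ring
      rw [h2]
      have : 0 < x ^ 2 := by positivity
      have : x ^ 2 < 1 := by nlinarith
      nlinarith
    exact mul_lt_of_lt_one_right (by positivity) h1
  nlinarith [sq_nonneg (A - B)]

lemma integral_indicator_ball_mul {t : Euc (n + 1)} {r : ℝ} (h : ‖t‖ + r ≤ 1)
    (g : Euc (n + 1) → ℝ) :
    ∫ y, (ball t r).indicator 1 y * g y ∂(ballMeasure n) =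
      (volume (ball (0 : Euc (n + 1)) 1)).toReal⁻¹ * ∫ y in ball 0 r, g (y + t) := by
  have h1 : ∀ y, (ball t r).indicator 1 y * g y = (ball t r).indicator g y := by
    intro y
    by_cases hy : y ∈ ball t r <;> simp [hy]
  have h2 : ball t r ⊆ ball (0 : Euc (n + 1)) 1 := ball_subset_ball' (by
    rw [dist_zero_right]
    linarith)
  have h3 : (fun y => y + t) ⁻¹' ball t r = ball (0 : Euc (n + 1)) r := by
    ext y
    simp [dist_eq_norm]
  simp only [h1]
  rw [integral_ballMeasure, setIntegral_indicator measurableSet_ball,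
    Set.inter_eq_right.mpr h2, ← h3,
    (measurePreserving_add_right volume t).setIntegral_preimage_emb
      (Homeomorph.addRight t).measurableEmbedding]

/-- The second difference quotient of indicator functions: integration against it is
integration of `g (y + t) + g (y - t) - 2 * g y` over a small ball around the origin. -/
noncomputable def secondDiff (t : Euc (n + 1)) (r : ℝ) (y : Euc (n + 1)) : ℝ :=
  (ball t r).indicator 1 y + (ball (-t) r).indicator 1 y - 2 * (ball 0 r).indicator 1 y

lemma abs_secondDiff_le (t : Euc (n + 1)) (r : ℝ) (y : Euc (n + 1)) : |secondDiff t r y| ≤ 2 := by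
  have h : ∀ s : Set (Euc (n + 1)), 0 ≤ s.indicator (1 : Euc (n + 1) → ℝ) y ∧
      s.indicator (1 : Euc (n + 1) → ℝ) y ≤ 1 := fun s =>
    ⟨Set.indicator_nonneg (fun _ _ => zero_le_one) y,
      Set.indicator_le_self' (fun _ _ => zero_le_one) y⟩
  have h1 := h (ball t r)
  have h2 := h (ball (-t) r)
  have h3 := h (ball 0 r)
  rw [secondDiff, abs_le]
  constructor <;> linarith [h1.1, h1.2, h2.1, h2.2, h3.1, h3.2]

lemma measurable_secondDiff (t : Euc (n + 1)) (r : ℝ) : Measurable (secondDiff t r) := by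
  have h : ∀ x : Euc (n + 1), Measurable ((ball x r).indicator (1 : Euc (n + 1) → ℝ)) := fun x =>
    measurable_one.indicator measurableSet_ball
  exact ((h t).add (h (-t))).sub ((h 0).const_mul 2)

lemma integral_secondDiff_mul {t : Euc (n + 1)} {r : ℝ} (h : ‖t‖ + r < 1) {g : Euc (n + 1) → ℝ}
    (hg : ContinuousOn g (ball 0 1)) :
    ∫ y, secondDiff t r y * g y ∂(ballMeasure n) =
      (volume (ball (0 : Euc (n + 1)) 1)).toReal⁻¹ *
        ∫ y in ball 0 r, (g (y + t) + g (y + -t) - 2 * g y) := by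
  have hsub : ∀ x : Euc (n + 1), ‖x‖ ≤ ‖t‖ → closedBall x r ⊆ ball 0 1 := by
    intro x hx
    refine closedBall_subset_ball' ?_
    rw [dist_zero_right]
    linarith
  have hi : ∀ x : Euc (n + 1), ‖x‖ ≤ ‖t‖ →
      Integrable (fun y => (ball x r).indicator 1 y * g y) (ballMeasure n) := by
    intro x hx
    have h1 : (fun y => (ball x r).indicator 1 y * g y) = (ball x r).indicator g := by
      funext y
      by_cases hy : y ∈ ball x r <;> simp [hy]
    rw [h1, ballMeasure]
    refine Integrable.smul_measure ?_ (ENNReal.inv_ne_top.mpr (measure_ball_pos _ _ one_pos).ne')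
    refine Integrable.mono_measure ?_ Measure.restrict_le_self
    rw [integrable_indicator_iff measurableSet_ball]
    exact ((hg.mono (hsub x hx)).integrableOn_compact (isCompact_closedBall x r)).mono_set
      ball_subset_closedBall
  have hj : ∀ x : Euc (n + 1), ‖x‖ ≤ ‖t‖ → IntegrableOn (fun y => g (y + x)) (ball 0 r) := by
    intro x hx
    have h1 : ContinuousOn (fun y => g (y + x)) (closedBall 0 r) := by
      refine hg.comp (by fun_prop) fun y hy => hsub x hx ?_
      rw [mem_closedBall_zero_iff] at hy
      simpa [dist_eq_norm] using hy
    exact (h1.integrableOn_compact (isCompact_closedBall 0 r)).mono_set ball_subset_closedBall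
  have hz : ‖(0 : Euc (n + 1))‖ ≤ ‖t‖ := by simp
  have e1 : ∀ y, secondDiff t r y * g y = (ball t r).indicator 1 y * g y +
      (ball (-t) r).indicator 1 y * g y - 2 * ((ball 0 r).indicator 1 y * g y) := by
    intro y
    rw [secondDiff]
    ring
  have ht : ‖t‖ ≤ ‖t‖ := le_rfl
  have ht' : ‖-t‖ ≤ ‖t‖ := (norm_neg t).le
  have i1 : Integrable (fun y => (ball t r).indicator 1 y * g y +
      (ball (-t) r).indicator 1 y * g y) (ballMeasure n) := (hi t ht).add (hi _ ht')
  have j0 : IntegrableOn g (ball 0 r) := by simpa using hj 0 hz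
  have j1 : IntegrableOn (fun y => g (y + t) + g (y + -t)) (ball 0 r) := (hj t ht).add (hj _ ht')
  simp only [e1]
  rw [integral_sub i1 ((hi 0 hz).const_mul 2), integral_add (hi t ht) (hi _ ht'),
    integral_const_mul, integral_indicator_ball_mul h.le,
    integral_indicator_ball_mul (by rw [norm_neg]; exact h.le),
    integral_indicator_ball_mul (by linarith [norm_nonneg t, norm_zero (E := Euc (n + 1))]),
    integral_sub j1 (j0.const_mul 2), integral_add (hj t ht) (hj _ ht'), integral_const_mul]
  simp only [add_zero]
  ring

/-- A bounded function which is orthogonal to the affine functions, but not to the bubble. -/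
lemma exists_secondDiff {η : Euc (n + 1)} (hη : ‖η‖ < 1) (hη0 : η ≠ 0) :
    ∃ h : Euc (n + 1) → ℝ, Measurable h ∧ (∀ y, |h y| ≤ 2) ∧ ∫ y, h y ∂(ballMeasure n) = 0 ∧
      (∀ b, ∫ y, h y * inner ℝ b y ∂(ballMeasure n) = 0) ∧
      ∫ y, h y * ballAct n (phiEta n η) (fun _ => 1) y ∂(ballMeasure n) ≠ 0 := by
  set f := ballAct n (phiEta n η) fun _ => 1 with hf
  set t := (1 / 2 : ℝ) • η with ht
  have htn : ‖t‖ < 1 / 2 := by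
    rw [ht, norm_smul]
    norm_num
    linarith
  have hfc : ContinuousOn f (ball 0 1) := continuousOn_ballAct_phiEta_one hη
  have hcat : ∀ x : Euc (n + 1), ‖x‖ < 1 → ContinuousAt (fun y => f (y + x)) 0 := by
    intro x hx
    have h1 : ContinuousAt f (0 + x) := hfc.continuousAt
      (isOpen_ball.mem_nhds (by rw [zero_add]; exact mem_ball_zero_iff.mpr hx))
    exact ContinuousAt.comp (f := fun y : Euc (n + 1) => y + x) h1 (by fun_prop)
  set F : Euc (n + 1) → ℝ := fun y => f (y + t) + f (y + -t) - 2 * f y with hF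
  have hFc : ContinuousAt F 0 := by
    have h0 := hcat 0 (by simp)
    simp only [add_zero] at h0
    exact ((hcat t (by linarith)).add (hcat (-t) (by rw [norm_neg]; linarith))).sub (h0.const_mul 2)
  have hF0 : 0 < F 0 := by
    have := ballAct_phiEta_one_midpoint hη hη0
    rw [hF]
    simp only [zero_add]
    linarith
  obtain ⟨r', hr'0, hr'⟩ := Metric.eventually_nhds_iff_ball.mp
    (hFc.eventually_const_lt (half_lt_self hF0))
  set r := min r' (1 / 4) with hr
  have hr0 : 0 < r := by positivity
  have htr : ‖t‖ + r < 1 := by linarith [min_le_right r' (1 / 4)]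
  have hvol : 0 < (volume (ball (0 : Euc (n + 1)) 1)).toReal :=
    ENNReal.toReal_pos (measure_ball_pos _ _ one_pos).ne' measure_ball_lt_top.ne
  refine ⟨secondDiff t r, measurable_secondDiff t r, abs_secondDiff_le t r, ?_, fun b => ?_, ?_⟩
  · have h1 := integral_secondDiff_mul (g := fun _ => 1) htr continuousOn_const
    simp only [mul_one] at h1
    rw [h1]
    norm_num
  · rw [integral_secondDiff_mul htr (by fun_prop)]
    have h1 : ∀ y : Euc (n + 1),
        inner ℝ b (y + t) + inner ℝ b (y + -t) - 2 * inner ℝ b y = (0 : ℝ) := by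
      intro y
      rw [inner_add_right, inner_add_right, inner_neg_right]
      ring
    simp only [h1, integral_zero, mul_zero]
  · rw [integral_secondDiff_mul htr hfc]
    have h1 : ∫ _ in ball (0 : Euc (n + 1)) r, F 0 / 2 ≤ ∫ y in ball 0 r, F y := by
      refine integral_mono_of_nonneg (Eventually.of_forall fun _ => by positivity) ?_ ?_
      · have hi : ∀ x : Euc (n + 1), ‖x‖ ≤ ‖t‖ →
            ContinuousOn (fun y => f (y + x)) (closedBall 0 r) := by
          refine fun x hx => hfc.comp (by fun_prop) fun y hy => ?_
          rw [mem_closedBall_zero_iff] at hy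
          rw [mem_ball_zero_iff]
          linarith [norm_add_le y x]
        have h0 := hi 0 (by simp)
        simp only [add_zero] at h0
        exact (((hi t le_rfl).add (hi (-t) (norm_neg t).le)).sub
          (h0.const_mul 2)).integrableOn_compact (isCompact_closedBall 0 r) |>.mono_set
          ball_subset_closedBall
      · filter_upwards [ae_restrict_mem measurableSet_ball] with y hy
        exact (hr' y (ball_subset_ball (min_le_left _ _) hy)).le
    rw [setIntegral_const, smul_eq_mul] at h1
    have h2 : 0 < volume.real (ball (0 : Euc (n + 1)) r) :=
      ENNReal.toReal_pos (measure_ball_pos _ _ hr0).ne' measure_ball_lt_top.ne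
    have h3 : 0 < ∫ y in ball 0 r, F y := lt_of_lt_of_le (by positivity) h1
    exact (mul_pos (inv_pos.mpr hvol) h3).ne'

end BallBubble

section BallSharp

variable {n : ℕ}

/-- Two bubbles in the ball show that the exponent `2` is sharp in the dual inequality. -/
theorem ballSharp_ballTwoBubble (hn : 2 ≤ n) {η : Euc (n + 1)} (hη : ‖η‖ < 1) (hη0 : η ≠ 0)
    {δ : ℕ → ℝ} (hδ : ∀ j, 0 < δ j) (hδ0 : Tendsto δ atTop (𝓝 0)) :
    BallSharp n (fun j => ballTwoBubble n (δ j) η) := by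
  set f := ballAct n (phiEta n η) fun _ => 1 with hf
  have hq := one_lt_expQ' hn
  have hfc : ContinuousOn f (ball 0 1) := continuousOn_ballAct_phiEta_one hη
  have hfm : AEStronglyMeasurable f (ballMeasure n) := aestronglyMeasurable_of_continuousOn_ball hfc
  obtain ⟨M₁, hM₁0, hM₁⟩ := exists_ballAct_phiEta_one_le hη
  set M := max M₁ 2 with hM
  have hM0 : 0 < M := by positivity
  have hfM' : ∀ y ∈ ball (0 : Euc (n + 1)) 1, |f y| ≤ M := fun y hy =>
    (hM₁ y hy).trans (le_max_left _ _)
  have hfM : ∀ᵐ y ∂(ballMeasure n), |f y| ≤ M := by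
    filter_upwards [ae_mem_ball n] with y hy using hfM' y hy
  have hf0 : 0 ≤ ∫ y, f y ∂(ballMeasure n) := by
    refine integral_nonneg_of_ae ?_
    filter_upwards [ae_mem_ball n] with y hy
    exact ballAct_phiEta_one_nonneg hη (mem_ball_zero_iff.mp hy)
  have hδf : ∀ j, 0 ≤ δ j * ∫ y, f y ∂(ballMeasure n) := fun j => mul_nonneg (hδ j).le hf0
  set l : ℕ → ℝ := fun j => (ballNorm n (expQ' n) fun y => 1 + δ j * f y)⁻¹ with hl
  have hu : ∀ j, ballTwoBubble n (δ j) η = fun y => l j * (1 + δ j * f y) := fun j => rfl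
  have hN : ∀ j, 1 ≤ ballNorm n (expQ' n) fun y => 1 + δ j * f y := fun j =>
    one_le_lpNorm_one_add_mul hq.le hfm hfM (hδf j)
  have hl1 : ∀ j, |l j - 1| ≤ M * |δ j| := fun j =>
    abs_inv_lpNorm_sub_one_le hq.le hfm hM0.le hfM (hδf j)
  refine ⟨fun j => ⟨?_, ?_⟩, ?_, ?_⟩
  · change MemLp (fun y => l j * (1 + δ j * f y)) _ _
    exact (memLp_one_add_mul hfm hfM _).const_mul _
  · exact ballNorm_normalize (by linarith [hN j])
  · have hlim : Tendsto (fun j => 2 * M * |δ j|) atTop (𝓝 0) := by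
      have := hδ0.abs.const_mul (2 * M)
      rwa [abs_zero, mul_zero] at this
    refine squeeze_zero (fun j => ballDist_nonneg _ _ _) (fun j => ?_) hlim
    exact (ballDist_one_le _ _).trans (lpNorm_normalized_sub_one_le hq.le hfm hM0.le hfM (hδf j))
  · obtain ⟨h, hh, hh2, hh0, hhι, hhf⟩ := exists_secondDiff hη hη0
    obtain ⟨c, hc, ε₀, hε₀, hlow⟩ := exists_le_integral_abs_sub_confPow (m := ballMeasure n)
      (ι := fun y => y) aemeasurable_id
      (by filter_upwards [ae_mem_ball n] with y hy using (mem_ball_zero_iff.mp hy).le)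
      (c₀ := (1 / 4) ^ (n + 1)) (by positivity) cap_ballMeasure_le (k := ((n : ℝ) + 3) / 2)
      (by linarith [(Nat.cast_nonneg n : (0 : ℝ) ≤ n)]) hM0 hfm hh.aestronglyMeasurable hfM
      (Eventually.of_forall fun y => (hh2 y).trans (le_max_right _ _)) hh0 hhι hhf
    have hsmall : ∀ᶠ j in atTop, δ j < ε₀ := hδ0.eventually_lt_const hε₀
    have hsmall' : ∀ᶠ j in atTop, δ j < 1 / (expQ' n * M) :=
      hδ0.eventually_lt_const (by positivity)
    refine exponentSharp_of_le (C := (expQ' n * M) ^ 2) two_pos hc (by positivity) hδ hδ0 ?_ ?_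
    · filter_upwards [hsmall] with j hj s hs
      refine rpow_le_ballDist hs.le (mul_nonneg hc.le (hδ j).le) fun Φ hΦ => ?_
      obtain ⟨b, hb⟩ := hΦ.exists_le_ballNorm hn
      have h1 := hlow (δ j) (l j) (by rw [abs_of_pos (hδ j)]; exact hj.le) (hl1 j) b
      rw [abs_of_pos (hδ j)] at h1
      refine h1.trans ?_
      rw [hu]
      refine hb _ (continuousOn_const.mul (continuousOn_const.add (continuousOn_const.mul hfc)))
        (|l j| * (1 + |δ j| * M)) fun y hy => ?_
      rw [abs_mul]
      refine mul_le_mul_of_nonneg_left ((abs_add_le _ _).trans ?_) (abs_nonneg _)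
      rw [abs_one, abs_mul]
      have := hfM' y hy
      gcongr
    · filter_upwards [hsmall'] with j hj
      rw [lt_div_iff₀ (by positivity)] at hj
      rw [Real.rpow_two]
      refine ballDeficit_normalize_le hn (memLp_one_add_mul hfm hfM 1).aestronglyMeasurable
        (M := 1 + |δ j| * M) (fun y hy => ?_) (by positivity) ?_ ?_
      · refine (abs_add_le _ _).trans ?_
        rw [abs_one, abs_mul]
        have := hfM' y hy
        gcongr
      · rw [integral_one_add_mul hfm hfM]
        linarith [hδf j]
      · refine integral_one_add_mul_rpow_le hq.le hfm hfM (hδf j) ?_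
        rw [abs_of_pos (hδ j)]
        linarith

end BallSharp

/-! ### Second order perturbations on the sphere -/

section Admissible

variable {n : ℕ}

lemma integral_coord_mul_coord_eq_zero {i j : Fin (n + 1)} (hij : i ≠ j) :
    ∫ ω : Sph n, (ω : Euc (n + 1)) i * (ω : Euc (n + 1)) j ∂(sphereMeasure n) = 0 := by
  classical
  -- the reflection in the `i`-th coordinate changes the sign
  set U : Euc (n + 1) ≃ₗᵢ[ℝ] Euc (n + 1) := LinearIsometryEquiv.piLpCongrRight 2 fun k =>
    if k = i then LinearIsometryEquiv.neg ℝ else LinearIsometryEquiv.refl ℝ ℝ with hU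
  have h := integral_comp_isometry (n := n) U (G := fun x => x i * x j) (by fun_prop)
  have hi : ∀ x : Euc (n + 1), U x i = -x i := fun x => by simp [hU]
  have hj : ∀ x : Euc (n + 1), U x j = x j := fun x => by simp [hU, hij.symm]
  simp only [hi, hj, neg_mul, integral_neg] at h
  linarith

lemma integral_coord_mul_coord_mul_coord_eq_zero (i j k : Fin (n + 1)) :
    ∫ ω : Sph n, (ω : Euc (n + 1)) i * (ω : Euc (n + 1)) j * (ω : Euc (n + 1)) k
      ∂(sphereMeasure n) = 0 := by
  have h := integral_comp_isometry (n := n) (LinearIsometryEquiv.neg ℝ)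
    (G := fun x => x i * x j * x k) (by fun_prop)
  simp only [LinearIsometryEquiv.coe_neg, PiLp.neg_apply, mul_neg, neg_mul, neg_neg, integral_neg] at h
  linarith

/-- The product of two coordinates is an admissible direction. -/
theorem exists_isAdmissible (hn : 2 ≤ n) : ∃ φ, IsAdmissible n φ := by
  have h01 : (0 : Fin (n + 1)) ≠ Fin.last n := by
    intro h
    have := congrArg Fin.val h
    simp at this
    omega
  refine ⟨fun ω => (ω : Euc (n + 1)) 0 * (ω : Euc (n + 1)) (Fin.last n), ?_, ?_,
    integral_coord_mul_coord_eq_zero h01, fun i => integral_coord_mul_coord_mul_coord_eq_zero _ _ i⟩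
  · have h1 : ContDiff ℝ ((⊤ : ℕ∞) : WithTop ℕ∞)
        fun x : Euc (n + 1) => x 0 * x (Fin.last n) := by fun_prop
    have := Fact.mk (finrank_euclideanSpace_fin (𝕜 := ℝ) (n := n + 1))
    exact h1.contMDiff.comp contMDiff_coe_sphere
  · intro h
    set x : Euc (n + 1) := EuclideanSpace.single 0 1 + EuclideanSpace.single (Fin.last n) 1 with hx
    have hx0 : x 0 = 1 := by simp [hx, h01]
    have hx1 : x (Fin.last n) = 1 := by simp [hx, h01.symm]
    have hne : x ≠ 0 := by
      intro h0
      rw [h0] at hx0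
      simp at hx0
    have h2 := congrFun h (sphereDir n x)
    simp [coe_sphereDir hne, hx0, hx1, hne] at h2

end Admissible

section Perturbation

variable {n : ℕ}

/-- On the sphere, powers of a conformal factor are powers of the Jacobian factor of some `Ψ_ζ`. -/
lemma exists_confPow_eq_etaFactor (b : Euc (n + 1)) : ∃ ζ : Euc (n + 1), ‖ζ‖ < 1 ∧
    1 - ‖ζ‖ ^ 2 = 2 / (1 + √(1 + ‖b‖ ^ 2)) ∧
    ∀ s (ω : Sph n), confPow s b ω = etaFactor n ζ ω ^ s := by
  set γ := √(1 + ‖b‖ ^ 2) with hγ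
  have hγ1 : 1 ≤ γ := one_le_sqrt_one_add b
  have hγ2 : γ ^ 2 = 1 + ‖b‖ ^ 2 := sq_sqrt_one_add b
  have hζ : ‖-((1 + γ)⁻¹ • b)‖ ^ 2 = (γ - 1) / (1 + γ) := by
    rw [norm_neg, norm_smul, mul_pow, show ‖b‖ ^ 2 = (γ - 1) * (1 + γ) by linarith,
      Real.norm_of_nonneg (by positivity)]
    field_simp
  have hζ' : 1 - ‖-((1 + γ)⁻¹ • b)‖ ^ 2 = 2 / (1 + γ) := by
    rw [hζ]
    field_simp
    ring
  have hpos : 0 < 2 / (1 + γ) := by positivity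
  refine ⟨-((1 + γ)⁻¹ • b), ?_, hζ', fun s ω => ?_⟩
  · by_contra! h
    nlinarith
  · have hω : ‖(ω : Euc (n + 1))‖ = 1 := norm_eq_of_mem_sphere ω
    have h1 : etaFactor n (-((1 + γ)⁻¹ • b)) ω = (confFactor b (ω : Euc (n + 1)))⁻¹ := by
      rw [etaFactor, hζ', norm_sub_sq_sphere, hζ, confFactor_of_norm_eq_one b hω, ← hγ,
        inner_neg_left, real_inner_smul_left]
      have h2 : 1 - 2 * -((1 + γ)⁻¹ * inner ℝ b (ω : Euc (n + 1))) + (γ - 1) / (1 + γ) =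
          2 / (1 + γ) * (γ + inner ℝ b (ω : Euc (n + 1))) := by
        field_simp
        ring
      rw [h2, ← div_div, div_self hpos.ne', one_div]
    rw [h1, confPow, Real.rpow_neg (confFactor_pos b hω.le).le,
      Real.inv_rpow (confFactor_pos b hω.le).le]

lemma integral_confPow_mul (b : Euc (n + 1)) :
    ∫ ω : Sph n, confPow (((n : ℝ) - 1) / 2) b (ω : Euc (n + 1)) *
      confPow (((n : ℝ) + 1) / 2) b ω ∂(sphereMeasure n) = 1 := by
  obtain ⟨ζ, hζ, -, h⟩ := exists_confPow_eq_etaFactor b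
  refine Eq.trans (integral_congr_ae (Eventually.of_forall fun ω => ?_))
    (integral_etaFactor_pow hζ)
  beta_reduce
  rw [h, h, ← Real.rpow_add (etaFactor_pos hζ ω), ← Real.rpow_natCast]
  ring_nf

lemma integral_confPow_half_add (hn : 1 ≤ n) (b : Euc (n + 1)) :
    ∫ ω : Sph n, confPow (((n : ℝ) + 1) / 2) b (ω : Euc (n + 1)) ∂(sphereMeasure n) =
      (2 / (1 + √(1 + ‖b‖ ^ 2))) ^ (((n : ℝ) - 1) / 2) := by
  obtain ⟨ζ, hζ, hζ', h⟩ := exists_confPow_eq_etaFactor b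
  simp only [h]
  rw [integral_etaFactor_rpow_half_add hn hζ, hζ']

/-- For `b` bounded away from `0`, the bubble `confPow k b` is so concentrated that the weighted
distance of any function `u ≤ 1 + a` from it has a positive lower bound. -/
lemma le_integral_abs_sub_mul_confPow (hn : 2 ≤ n) {b : Euc (n + 1)} (hb : 1 ≤ ‖b‖)
    {u : Sph n → ℝ} (hu : Continuous u) {a : ℝ} (ha : 0 ≤ a) (hua : ∀ ω, u ω ≤ 1 + a) :
    1 - (1 + a) * (2 / (1 + √2)) ^ (((n : ℝ) - 1) / 2) ≤
      ∫ ω : Sph n, |u ω - confPow (((n : ℝ) - 1) / 2) b ω| * confPow (((n : ℝ) + 1) / 2) b ω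
        ∂(sphereMeasure n) := by
  have hn' : (2 : ℝ) ≤ n := by exact_mod_cast hn
  have hw := continuous_confPow_sphere (n := n) (((n : ℝ) - 1) / 2) b
  have hw' := continuous_confPow_sphere (n := n) (((n : ℝ) + 1) / 2) b
  have h1 : ∫ ω : Sph n, (confPow (((n : ℝ) - 1) / 2) b (ω : Euc (n + 1)) *
        confPow (((n : ℝ) + 1) / 2) b (ω : Euc (n + 1)) -
        (1 + a) * confPow (((n : ℝ) + 1) / 2) b (ω : Euc (n + 1))) ∂(sphereMeasure n) ≤
      ∫ ω : Sph n, |u ω - confPow (((n : ℝ) - 1) / 2) b ω| * confPow (((n : ℝ) + 1) / 2) b ω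
        ∂(sphereMeasure n) := by
    refine integral_mono (integrable_of_continuous_sphere (by fun_prop))
      (integrable_of_continuous_sphere (by fun_prop)) fun ω => ?_
    have hp := confPow_pos (((n : ℝ) + 1) / 2) b (y := (ω : Euc (n + 1))) (by simp)
    have h2 := neg_abs_le (u ω - confPow (((n : ℝ) - 1) / 2) b (ω : Euc (n + 1)))
    have h3 := hua ω
    beta_reduce
    rw [← sub_mul]
    exact mul_le_mul_of_nonneg_right (by linarith) hp.le
  rw [integral_sub (integrable_of_continuous_sphere (by fun_prop))
    (integrable_of_continuous_sphere (by fun_prop)), integral_confPow_mul, integral_const_mul,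
    integral_confPow_half_add (by omega)] at h1
  refine le_trans (sub_le_sub_left (mul_le_mul_of_nonneg_left ?_ (by linarith)) 1) h1
  refine Real.rpow_le_rpow (by positivity) ?_ (by linarith)
  have h4 : √2 ≤ √(1 + ‖b‖ ^ 2) := Real.sqrt_le_sqrt (by nlinarith)
  gcongr

/-- Second order perturbations of `1` show that the exponent `2` is sharp for the `L²`-distance. -/
theorem sphereSharp_perturbation (hn : 2 ≤ n) {φ : Sph n → ℝ} (hφ : IsAdmissible n φ) {ε : ℕ → ℝ}
    (hε : ∀ j, ε j ≠ 0) (hε0 : Tendsto ε atTop (𝓝 0)) :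
    SphereSharp n 2 (fun j => perturbation n φ (ε j)) := by
  obtain ⟨hsmooth, hφ0, hφi, hφι⟩ := hφ
  have hn' : (2 : ℝ) ≤ n := by exact_mod_cast hn
  have hφc : Continuous φ := hsmooth.continuous
  have hφm : AEStronglyMeasurable φ (sphereMeasure n) := hφc.aestronglyMeasurable
  have hp : 1 ≤ expP n := by linarith [two_lt_expP hn]
  obtain ⟨M, hM0, hM⟩ := exists_bound_of_continuous_sphere hφc
  have hMae : ∀ᵐ ω ∂(sphereMeasure n), |φ ω| ≤ M := Eventually.of_forall hM
  have hε' : ∀ j, 0 ≤ ε j * ∫ ω, φ ω ∂(sphereMeasure n) := fun j => by rw [hφi, mul_zero]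
  set l : ℕ → ℝ := fun j => (sphereNorm n (expP n) fun ω => 1 + ε j * φ ω)⁻¹ with hl
  have hu : ∀ j, perturbation n φ (ε j) = fun ω => l j * (1 + ε j * φ ω) := fun j => rfl
  have huc : ∀ j, Continuous (perturbation n φ (ε j)) := fun j => by
    rw [hu]
    fun_prop
  have hN : ∀ j, 1 ≤ sphereNorm n (expP n) fun ω => 1 + ε j * φ ω := fun j =>
    one_le_lpNorm_one_add_mul hp hφm hMae (hε' j)
  have hl1 : ∀ j, |l j - 1| ≤ M * |ε j| := fun j =>
    abs_inv_lpNorm_sub_one_le hp hφm hM0.le hMae (hε' j)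
  have hlpos : ∀ j, 0 ≤ l j := fun j => inv_nonneg.mpr (by linarith [hN j])
  have hlle : ∀ j, l j ≤ 1 := fun j => inv_le_one_of_one_le₀ (hN j)
  refine ⟨fun j => ⟨memLp_of_continuous_sphere (huc j) _, ?_⟩, ?_, ?_⟩
  · exact sphereNorm_normalize (by linarith [hN j])
  · have hlim : Tendsto (fun j => 2 * M * |ε j|) atTop (𝓝 0) := by
      have := hε0.abs.const_mul (2 * M)
      rwa [abs_zero, mul_zero] at this
    refine squeeze_zero (fun j => sphereDist_nonneg _ _ _) (fun j => ?_) hlim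
    exact (sphereDist_one_le hn _ _).trans
      (lpNorm_normalized_sub_one_le hp hφm hM0.le hMae (hε' j))
  · have hφφ : ∫ ω, φ ω * φ ω ∂(sphereMeasure n) ≠ 0 := by
      intro h0
      rw [integral_eq_zero_iff_of_nonneg (fun ω => mul_self_nonneg (φ ω))
        (integrable_of_continuous_sphere (by fun_prop))] at h0
      have h1 := (Continuous.ae_eq_iff_eq (sphereMeasure n) (by fun_prop) continuous_zero).mp h0
      exact hφ0 (funext fun ω => mul_self_eq_zero.mp (congrFun h1 ω))
    have hφb : ∀ b : Euc (n + 1), ∫ ω : Sph n, φ ω * inner ℝ b (ω : Euc (n + 1))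
        ∂(sphereMeasure n) = 0 := by
      intro b
      have h1 : ∀ ω : Sph n, φ ω * inner ℝ b (ω : Euc (n + 1)) =
          ∑ i, b i * (φ ω * (ω : Euc (n + 1)) i) := by
        intro ω
        rw [PiLp.inner_apply, Finset.mul_sum]
        refine Finset.sum_congr rfl fun i _ => ?_
        simp
        ring
      simp only [h1]
      rw [integral_finsetSum _ fun i _ => integrable_of_continuous_sphere (by fun_prop)]
      refine Finset.sum_eq_zero fun i _ => ?_
      rw [integral_const_mul, hφι, mul_zero]
    set k := ((n : ℝ) - 1) / 2 with hk
    obtain ⟨c, hc, ε₀, hε₀, hlow⟩ := exists_le_integral_abs_sub_confPow (m := sphereMeasure n)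
      (ι := fun ω : Sph n => (ω : Euc (n + 1))) (by fun_prop)
      (Eventually.of_forall fun ω => by simp) (c₀ := (1 / 4) ^ (n + 1)) (by positivity)
      cap_sphereMeasure_le (k := k) (by linarith) hM0 hφm hφm hMae hMae hφi hφb hφφ
    set θ := (2 / (1 + √2)) ^ k with hθ
    have hθ0 : 0 < θ := by positivity
    have hθ1 : θ < 1 := by
      refine Real.rpow_lt_one (by positivity) ?_ (by linarith)
      rw [div_lt_one (by positivity)]
      linarith [Real.lt_sqrt_of_sq_lt (show (1 : ℝ) ^ 2 < 2 by norm_num)]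
    set w₀ : ℝ := 3 ^ (-(((n : ℝ) + 1) / 2)) with hw₀
    have hw₀0 : 0 < w₀ := by positivity
    set c' := min (w₀ * c) ((1 - θ) / 2) with hc'
    have hc'0 : 0 < c' := lt_min (mul_pos hw₀0 hc) (by linarith)
    have hev : ∀ {a : ℝ}, 0 < a → ∀ᶠ j in atTop, |ε j| < a := fun ha => by
      have h1 := hε0.abs
      rw [abs_zero] at h1
      exact h1.eventually_lt_const ha
    refine exponentSharp_of_le (C := (expP n * M) ^ 2) (δ := fun j => |ε j|) two_pos hc'0
      (by positivity) (fun j => abs_pos.mpr (hε j)) (by simpa using hε0.abs) ?_ ?_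
    · filter_upwards [hev hε₀, hev one_pos, hev (a := (1 - θ) / (2 * M)) (div_pos (by linarith) (by positivity))]
        with j hj hj1 hj2 s hs
      refine rpow_le_sphereDist hs.le (by positivity) fun Ψ hΨ => ?_
      obtain ⟨b, hb⟩ := hΨ.exists_sphereNorm_eq hn
      refine le_trans ?_ ((hb _ (huc j)).2 2 (by norm_num))
      rcases le_total ‖b‖ 1 with hb1 | hb1
      · -- the weight is bounded below
        have hwt : ∀ ω : Sph n, w₀ ≤ confPow (((n : ℝ) + 1) / 2) b (ω : Euc (n + 1)) := by
          intro ω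
          have hω : ‖(ω : Euc (n + 1))‖ ≤ 1 := by simp
          refine Real.rpow_le_rpow_of_nonpos (confFactor_pos b hω) ?_ (by linarith)
          refine (confFactor_le b hω).trans ?_
          have : √(1 + ‖b‖ ^ 2) ≤ 2 := Real.sqrt_le_iff.mpr ⟨by norm_num, by nlinarith [norm_nonneg b]⟩
          linarith
        have h1 := hlow (ε j) (l j) hj.le (hl1 j) b
        have hwc := continuous_confPow_sphere (n := n) k b
        have hwc' := continuous_confPow_sphere (n := n) (((n : ℝ) + 1) / 2) b
        have huj := huc j
        calc c' * |ε j| ≤ w₀ * c * |ε j| :=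
              mul_le_mul_of_nonneg_right (min_le_left _ _) (abs_nonneg _)
          _ = w₀ * (c * |ε j|) := by ring
          _ ≤ w₀ * ∫ ω : Sph n, |l j * (1 + ε j * φ ω) - confPow k b (ω : Euc (n + 1))|
                ∂(sphereMeasure n) := mul_le_mul_of_nonneg_left h1 hw₀0.le
          _ = ∫ ω : Sph n, |perturbation n φ (ε j) ω - confPow k b (ω : Euc (n + 1))| * w₀
                ∂(sphereMeasure n) := by
              rw [integral_mul_const, mul_comm]
              rfl
          _ ≤ _ := by
              refine integral_mono (integrable_of_continuous_sphere (by fun_prop))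
                (integrable_of_continuous_sphere (by fun_prop)) fun ω => ?_
              exact mul_le_mul_of_nonneg_left (hwt ω) (abs_nonneg _)
      · have h1 := le_integral_abs_sub_mul_confPow hn hb1 (huc j) (a := |ε j| * M) (by positivity)
          fun ω => by
            rw [hu]
            have h2 : |ε j * φ ω| ≤ |ε j| * M := by
              rw [abs_mul]
              exact mul_le_mul_of_nonneg_left (hM ω) (abs_nonneg _)
            have h3 := (le_abs_self _).trans h2
            have h4 : l j * (1 + ε j * φ ω) ≤ l j * (1 + |ε j| * M) :=
              mul_le_mul_of_nonneg_left (by linarith) (hlpos j)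
            have h5 : l j * (1 + |ε j| * M) ≤ 1 * (1 + |ε j| * M) :=
              mul_le_mul_of_nonneg_right (hlle j) (by positivity)
            linarith
        refine le_trans ?_ h1
        rw [lt_div_iff₀ (by positivity)] at hj2
        have h6 : c' * |ε j| ≤ (1 - θ) / 2 * 1 :=
          mul_le_mul (min_le_right _ _) hj1.le (abs_nonneg _) (by linarith)
        have h7 : |ε j| * M * θ ≤ |ε j| * M * 1 :=
          mul_le_mul_of_nonneg_left hθ1.le (by positivity)
        linarith
    · filter_upwards [hev (a := 1 / (expP n * M)) (by positivity)] with j hj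
      rw [lt_div_iff₀ (by positivity)] at hj
      rw [Real.rpow_two, sq_abs]
      refine sphereDeficit_normalize_le hn (by fun_prop) (by positivity) ?_ ?_
      · rw [integral_one_add_mul hφm hMae, hφi, mul_zero, add_zero]
      · exact integral_one_add_mul_rpow_le hp hφm hMae (hε' j) (by linarith)

end Perturbation

/-! ### Two bubbles on the sphere -/

section SphereBubble

variable {n : ℕ}

lemma one_add_rpow_le_of_nonneg {p x : ℝ} (hp : 1 ≤ p) (hx : 0 ≤ x) :
    (1 + x) ^ p ≤ 1 + p * 2 ^ (p - 1) * (x + x ^ p) := by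
  have hx1 : 0 < 1 + x := by linarith
  have h1 : (1 + x) ^ p - 1 ≤ p * x * (1 + x) ^ (p - 1) := by
    have h2 : -1 ≤ -x / (1 + x) := by
      rw [le_div_iff₀ hx1]
      linarith
    have h3 := one_add_mul_self_le_rpow_one_add h2 hp
    have h4 : 1 + -x / (1 + x) = (1 + x)⁻¹ := by
      field_simp
      ring
    rw [h4, Real.inv_rpow hx1.le] at h3
    have h6 := mul_le_mul_of_nonneg_right h3 (Real.rpow_nonneg hx1.le p)
    have h7 : (1 + x) ^ p = (1 + x) * (1 + x) ^ (p - 1) := by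
      rw [← Real.rpow_one_add' hx1.le (by linarith), add_sub_cancel]
    rw [inv_mul_cancel₀ (by positivity)] at h6
    have h8 : (1 + p * (-x / (1 + x))) * (1 + x) ^ p =
        (1 + x) ^ p - p * x * (1 + x) ^ (p - 1) := by
      rw [h7]
      field_simp
      ring
    linarith
  have h5 : (1 + x) ^ (p - 1) ≤ 2 ^ (p - 1) * (1 + x ^ (p - 1)) := by
    rcases le_total x 1 with h | h
    · calc (1 + x) ^ (p - 1) ≤ 2 ^ (p - 1) :=
            Real.rpow_le_rpow hx1.le (by linarith) (by linarith)
        _ ≤ _ := le_mul_of_one_le_right (by positivity) (by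
            linarith [Real.rpow_nonneg hx (p - 1)])
    · calc (1 + x) ^ (p - 1) ≤ (2 * x) ^ (p - 1) :=
            Real.rpow_le_rpow hx1.le (by linarith) (by linarith)
        _ = 2 ^ (p - 1) * x ^ (p - 1) := Real.mul_rpow (by norm_num) hx
        _ ≤ _ := mul_le_mul_of_nonneg_left (by linarith) (by positivity)
  have h6 : x * x ^ (p - 1) = x ^ p := by
    rcases hx.eq_or_lt with h | h
    · rw [← h, zero_mul, Real.zero_rpow (by linarith)]
    · rw [← Real.rpow_one_add' hx (by linarith), add_sub_cancel]
  have h7 := mul_le_mul_of_nonneg_left h5 (show 0 ≤ p * x by positivity)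
  have h8 : p * x * (2 ^ (p - 1) * (1 + x ^ (p - 1))) = p * 2 ^ (p - 1) * (x + x ^ p) := by
    rw [← h6]
    ring
  linarith

lemma half_sub_mul_expP (hn : 2 ≤ n) : ((n : ℝ) - 1) / 2 * expP n = n := by
  have hn' : (2 : ℝ) ≤ n := by exact_mod_cast hn
  rw [expP_eq]
  field_simp [show (n : ℝ) - 1 ≠ 0 by linarith]

/-- The bubble `(1)_{Ψ_η}` as a power of the Jacobian factor of `Ψ_η`. -/
noncomputable def sphereBubble (n : ℕ) (η : Euc (n + 1)) (ω : Sph n) : ℝ :=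
  etaFactor n η ω ^ (((n : ℝ) - 1) / 2)

lemma sphereAct_psiEta_one (hn : 2 ≤ n) (η : ball (0 : Euc (n + 1)) 1) :
    sphereAct n (psiEta n η) (fun _ => 1) = sphereBubble n η := by
  funext ω
  rw [(isConformal_psiEta η).sphereAct_eq hn, mul_one, sphereBubble]

variable {η : Euc (n + 1)}

lemma sphereBubble_pos (hη : ‖η‖ < 1) (ω : Sph n) : 0 < sphereBubble n η ω :=
  Real.rpow_pos_of_pos (etaFactor_pos hη ω) _

lemma continuous_sphereBubble (hη : ‖η‖ < 1) : Continuous (sphereBubble n η) :=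
  (continuous_etaFactor hη).rpow_const fun ω => Or.inl (etaFactor_pos hη ω).ne'

lemma integral_sphereBubble (hn : 2 ≤ n) (hη : ‖η‖ < 1) :
    ∫ ω, sphereBubble n η ω ∂(sphereMeasure n) = (1 - ‖η‖ ^ 2) ^ (((n : ℝ) - 1) / 2) :=
  integral_etaFactor_rpow_half_sub (by omega) hη

lemma integral_sphereBubble_rpow_expP_sub_one (hn : 2 ≤ n) (hη : ‖η‖ < 1) :
    ∫ ω, sphereBubble n η ω ^ (expP n - 1) ∂(sphereMeasure n) =
      (1 - ‖η‖ ^ 2) ^ (((n : ℝ) - 1) / 2) := by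
  rw [← integral_etaFactor_rpow_half_add (by omega) hη]
  refine integral_congr_ae (Eventually.of_forall fun ω => ?_)
  have h1 := half_sub_mul_expP hn
  beta_reduce
  rw [sphereBubble, ← Real.rpow_mul (etaFactor_pos hη ω).le]
  congr 1
  linarith

lemma integral_sphereBubble_rpow_expP (hn : 2 ≤ n) (hη : ‖η‖ < 1) :
    ∫ ω, sphereBubble n η ω ^ expP n ∂(sphereMeasure n) = 1 := by
  refine Eq.trans (integral_congr_ae (Eventually.of_forall fun ω => ?_))
    (integral_etaFactor_pow hη)
  beta_reduce
  rw [sphereBubble, ← Real.rpow_mul (etaFactor_pos hη ω).le, half_sub_mul_expP hn,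
    Real.rpow_natCast]

lemma sphereNorm_sphereBubble (hn : 2 ≤ n) (hη : ‖η‖ < 1) :
    sphereNorm n (expP n) (sphereBubble n η) = 1 := by
  rw [sphereNorm, lpNorm_ofReal_eq (by linarith [two_lt_expP hn])
    (continuous_sphereBubble hη).aestronglyMeasurable]
  simp only [abs_of_pos (sphereBubble_pos hη _)]
  rw [integral_sphereBubble_rpow_expP hn hη, Real.one_rpow]

/-- Hölder's inequality against the `L^{p'}`-normalized function `w^{p-1}`, where `w` is a bubble. -/
lemma integral_abs_mul_sphereBubble_le (hn : 2 ≤ n) (hη : ‖η‖ < 1) {G : Sph n → ℝ}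
    (hG : Continuous G) :
    ∫ ω, |G ω| * sphereBubble n η ω ^ (expP n - 1) ∂(sphereMeasure n) ≤
      sphereNorm n (expP n) G := by
  have hp := two_lt_expP hn
  have hw := continuous_sphereBubble (n := n) hη
  have hw' : Continuous fun ω => sphereBubble n η ω ^ (expP n - 1) :=
    hw.rpow_const fun ω => Or.inl (sphereBubble_pos hη ω).ne'
  have h := integral_mul_le_Lp_mul_Lq_of_nonneg (μ := sphereMeasure n)
    (Real.HolderConjugate.conjExponent (by linarith : 1 < expP n))
    (Eventually.of_forall fun ω => abs_nonneg (G ω))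
    (Eventually.of_forall fun ω => Real.rpow_nonneg (sphereBubble_pos hη ω).le (expP n - 1))
    (memLp_of_continuous_sphere hG.abs _) (memLp_of_continuous_sphere hw' _)
  have h1 : ∀ ω, (sphereBubble n η ω ^ (expP n - 1)) ^ (Real.conjExponent (expP n)) =
      sphereBubble n η ω ^ expP n := by
    intro ω
    rw [← Real.rpow_mul (sphereBubble_pos hη ω).le, Real.conjExponent,
      mul_div_cancel₀ _ (by linarith)]
  simp only [h1] at h
  rw [integral_sphereBubble_rpow_expP hn hη, Real.one_rpow, mul_one, one_div] at h
  rwa [sphereNorm, lpNorm_ofReal_eq (by linarith) hG.aestronglyMeasurable]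

section TwoBubble

variable {δ : ℝ}

lemma integral_one_add_mul_sphereBubble (hn : 2 ≤ n) (hη : ‖η‖ < 1) :
    ∫ ω, (1 + δ * sphereBubble n η ω) ∂(sphereMeasure n) =
      1 + δ * (1 - ‖η‖ ^ 2) ^ (((n : ℝ) - 1) / 2) := by
  have hw := continuous_sphereBubble (n := n) hη
  rw [integral_add (integrable_const _) (integrable_of_continuous_sphere (by fun_prop)),
    integral_const_mul, integral_sphereBubble hn hη, integral_const, probReal_univ, one_smul]

lemma one_le_integral_one_add_mul_sphereBubble (hn : 2 ≤ n) (hη : ‖η‖ < 1) (hδ : 0 ≤ δ) :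
    1 ≤ ∫ ω, (1 + δ * sphereBubble n η ω) ∂(sphereMeasure n) := by
  rw [integral_one_add_mul_sphereBubble hn hη]
  have := Real.rpow_nonneg (one_sub_norm_sq_pos hη).le (((n : ℝ) - 1) / 2)
  nlinarith [mul_nonneg hδ this]

lemma one_le_sphereNorm_twoBubble (hn : 2 ≤ n) (hη : ‖η‖ < 1) (hδ : 0 ≤ δ) :
    1 ≤ sphereNorm n (expP n) (fun ω => 1 + δ * sphereBubble n η ω) := by
  have hw := continuous_sphereBubble (n := n) hη
  exact (one_le_integral_one_add_mul_sphereBubble hn hη hδ).trans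
    (integral_le_sphereNorm (by linarith [two_lt_expP hn]) (by fun_prop))

lemma sphereNorm_const_add_mul_sphereBubble_le (hn : 2 ≤ n) (hη : ‖η‖ < 1) (a c : ℝ) :
    sphereNorm n (expP n) (fun ω => a + c * sphereBubble n η ω) ≤ |a| + |c| := by
  have hp := two_lt_expP hn
  have h1 : lpNorm ((fun _ => a) + fun ω => c * sphereBubble n η ω) (ENNReal.ofReal (expP n))
      (sphereMeasure n) ≤ _ :=
    lpNorm_add_le (memLp_const a) (ENNReal.one_le_ofReal.mpr (by linarith))
  have h2 : lpNorm (fun _ : Sph n => a) (ENNReal.ofReal (expP n)) (sphereMeasure n) = |a| := by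
    rw [lpNorm_const' (by simp; linarith) ENNReal.ofReal_ne_top, probReal_univ, Real.one_rpow,
      mul_one, Real.norm_eq_abs]
  have h3 := sphereNorm_const_mul (expP n) c (sphereBubble n η)
  rw [sphereNorm_sphereBubble hn hη, mul_one, sphereNorm] at h3
  rw [h2, h3] at h1
  exact h1

lemma inv_sphereNorm_twoBubble_mem (hn : 2 ≤ n) (hη : ‖η‖ < 1) (hδ : 0 ≤ δ) :
    (sphereNorm n (expP n) fun ω => 1 + δ * sphereBubble n η ω)⁻¹ ∈ Set.Icc (1 - δ) 1 := by
  have h1 := one_le_sphereNorm_twoBubble hn hη hδ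
  have h2 := sphereNorm_const_add_mul_sphereBubble_le hn hη 1 δ
  rw [abs_one, abs_of_nonneg hδ] at h2
  set N := sphereNorm n (expP n) fun ω => 1 + δ * sphereBubble n η ω
  have hN : 0 < N := by linarith
  have h3 : N⁻¹ ≤ 1 := inv_le_one_of_one_le₀ h1
  refine ⟨?_, h3⟩
  have h4 : 1 - N⁻¹ = (N - 1) * N⁻¹ := by field_simp
  nlinarith

/-- If the second bubble is sufficiently concentrated, the defect in Jensen's inequality for two
bubbles is of order `δ ^ p`, since the bubbles hardly interact. -/
lemma integral_twoBubble_rpow_le (hn : 2 ≤ n) (hη : ‖η‖ < 1) (hδ : 0 < δ)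
    (hm : (1 - ‖η‖ ^ 2) ^ (((n : ℝ) - 1) / 2) ≤ δ ^ (expP n - 1)) :
    ∫ ω, |1 + δ * sphereBubble n η ω| ^ expP n ∂(sphereMeasure n) ≤
      1 + 2 * (expP n * 2 ^ (expP n - 1)) * δ ^ expP n := by
  have hp := two_lt_expP hn
  have hw := continuous_sphereBubble (n := n) hη
  set C := expP n * 2 ^ (expP n - 1) with hC
  have hC0 : 0 < C := by positivity
  have hwp : Continuous fun ω => sphereBubble n η ω ^ expP n :=
    hw.rpow_const fun ω => Or.inr (by linarith)
  have h1 : ∫ ω, |1 + δ * sphereBubble n η ω| ^ expP n ∂(sphereMeasure n) ≤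
      ∫ ω, (1 + C * (δ * sphereBubble n η ω + δ ^ expP n * sphereBubble n η ω ^ expP n))
        ∂(sphereMeasure n) := by
    refine integral_mono (integrable_of_continuous_sphere ?_)
      (integrable_of_continuous_sphere (by fun_prop)) fun ω => ?_
    · have : Continuous fun ω => |1 + δ * sphereBubble n η ω| := by fun_prop
      exact this.rpow_const fun ω => Or.inr (by linarith)
    · have hx : 0 ≤ δ * sphereBubble n η ω := (mul_pos hδ (sphereBubble_pos hη ω)).le
      beta_reduce
      rw [abs_of_nonneg (by linarith), ← Real.mul_rpow hδ.le (sphereBubble_pos hη ω).le]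
      exact one_add_rpow_le_of_nonneg (by linarith) hx
  rw [integral_add (integrable_const _) (integrable_of_continuous_sphere (by fun_prop)),
    integral_const_mul, integral_add (integrable_of_continuous_sphere (by fun_prop))
    (integrable_of_continuous_sphere (by fun_prop)), integral_const_mul, integral_const_mul,
    integral_sphereBubble hn hη, integral_sphereBubble_rpow_expP hn hη, integral_const,
    probReal_univ, one_smul, mul_one] at h1
  have h2 : δ * (1 - ‖η‖ ^ 2) ^ (((n : ℝ) - 1) / 2) ≤ δ ^ expP n := by
    have h3 := mul_le_mul_of_nonneg_left hm hδ.le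
    rwa [← Real.rpow_one_add' hδ.le (by linarith), add_sub_cancel] at h3
  have h4 := mul_le_mul_of_nonneg_left (add_le_add_left h2 (δ ^ expP n)) hC0.le
  linarith

/-- Lower bound for the distance of two bubbles `l (1 + δ w)` to a single bubble `confPow k b`. If
`b` is not of order `δ`, then `confPow k b` is too far from `1`. Otherwise `l - confPow k b` is of
order `δ` in the supremum norm, hence small in the region where `w` is concentrated, and testing
with `w ^ (p - 1)` sees the second bubble. -/
lemma exists_le_sphereNorm_twoBubble_sub (hn : 2 ≤ n) : ∃ δ₀ > 0, ∃ C > 0, ∀ δ l : ℝ,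
    ∀ η : Euc (n + 1), ‖η‖ < 1 → 0 < δ → δ ≤ δ₀ → l ∈ Set.Icc (1 - δ) 1 →
    C * (1 - ‖η‖ ^ 2) ^ (((n : ℝ) - 1) / 2) ≤ 1 / 4 → ∀ b : Euc (n + 1), δ / 4 ≤
      sphereNorm n (expP n)
        (fun ω => l * (1 + δ * sphereBubble n η ω) - confPow (((n : ℝ) - 1) / 2) b ω) := by
  have hn' : (2 : ℝ) ≤ n := by exact_mod_cast hn
  have hp := two_lt_expP hn
  set k := ((n : ℝ) - 1) / 2 with hk
  have hk1 : 1 / 2 ≤ k := by linarith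
  set c₁ : ℝ := (1 / 4) ^ (n + 1) / 8 with hc₁
  have hc₁0 : 0 < c₁ := by positivity
  set C₁ := 10 * k + 16 * k ^ 2 with hC₁
  have hC₁0 : 0 < C₁ := by positivity
  set b₀ := 1 / (4 * k + 4) with hb₀
  have hb₀0 : 0 < b₀ := by positivity
  set C := 1 + C₁ * (3 / c₁) with hC
  refine ⟨min (1 / 2) (c₁ * min 1 b₀ / 3), by positivity, C, by positivity,
    fun δ l η hη hδ hδ₀ hl hm b => ?_⟩
  have hw := continuous_sphereBubble (n := n) hη
  have hwp : Continuous fun ω => sphereBubble n η ω ^ (expP n - 1) :=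
    hw.rpow_const fun ω => Or.inl (sphereBubble_pos hη ω).ne'
  have hv := continuous_confPow_sphere (n := n) k b
  have hδ1 : δ ≤ 1 / 2 := hδ₀.trans (min_le_left _ _)
  have hδ2 : 3 * δ ≤ c₁ * min 1 b₀ := by
    have := hδ₀.trans (min_le_right _ _)
    linarith
  obtain ⟨hl1, hl2⟩ := hl
  set mk := (1 - ‖η‖ ^ 2) ^ k with hmk
  have hmk0 : 0 ≤ mk := Real.rpow_nonneg (one_sub_norm_sq_pos hη).le _
  have hmk1 : mk ≤ 1 := Real.rpow_le_one (one_sub_norm_sq_pos hη).le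
    (by linarith [sq_nonneg ‖η‖]) (by linarith)
  have hG : Continuous fun ω : Sph n => l * (1 + δ * sphereBubble n η ω) - confPow k b ω := by
    fun_prop
  rcases le_or_gt (3 * δ) (c₁ * min 1 ‖b‖) with hb | hb
  · have h1 : ∫ ω : Sph n, |l * (1 + δ * sphereBubble n η ω) - confPow k b ω| ∂(sphereMeasure n) ≤
        sphereNorm n (expP n)
          (fun ω => l * (1 + δ * sphereBubble n η ω) - confPow k b ω) :=
      integral_abs_le_lpNorm (by linarith) (memLp_of_continuous_sphere hG _)
    have h2 := le_integral_abs_one_sub_confPow (m := sphereMeasure n)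
      (ι := fun ω : Sph n => (ω : Euc (n + 1))) (by fun_prop)
      (Eventually.of_forall fun ω => by simp) cap_sphereMeasure_le hk1 b
    have h3 : ∫ ω : Sph n, |1 - confPow k b (ω : Euc (n + 1))| ∂(sphereMeasure n) ≤
        ∫ ω : Sph n, (|l * (1 + δ * sphereBubble n η ω) - confPow k b ω| +
          (δ + δ * sphereBubble n η ω)) ∂(sphereMeasure n) := by
      refine integral_mono (integrable_of_continuous_sphere (by fun_prop))
        (integrable_of_continuous_sphere (by fun_prop)) fun ω => ?_
      have hwω := mul_pos hδ (sphereBubble_pos hη ω)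
      have h4 : |1 - l * (1 + δ * sphereBubble n η ω)| ≤ δ + δ * sphereBubble n η ω := by
        rw [abs_le]
        constructor <;> nlinarith
      have h5 := abs_sub_le 1 (l * (1 + δ * sphereBubble n η ω)) (confPow k b (ω : Euc (n + 1)))
      beta_reduce
      linarith
    rw [integral_add (integrable_of_continuous_sphere (by fun_prop))
      (integrable_of_continuous_sphere (by fun_prop)), integral_add (integrable_const _)
      (integrable_of_continuous_sphere (by fun_prop)), integral_const_mul,
      integral_sphereBubble hn hη, integral_const, probReal_univ, one_smul] at h3
    rw [← hk, ← hmk] at h3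
    rw [← hc₁] at h2
    nlinarith
  · have hmin : min 1 ‖b‖ < min 1 b₀ := lt_of_mul_lt_mul_left (hb.trans_le hδ2) hc₁0.le
    have hb1 : ‖b‖ < 1 := by
      by_contra! h
      rw [min_eq_left h] at hmin
      exact absurd hmin (not_lt.mpr (min_le_left _ _))
    rw [min_eq_right hb1.le] at hb hmin
    have hb2 : ‖b‖ ≤ b₀ := hmin.le.trans (min_le_right _ _)
    have hb3 : ‖b‖ ≤ 3 / c₁ * δ := by
      rw [div_mul_eq_mul_div, le_div_iff₀ hc₁0]
      linarith
    refine le_trans ?_ (integral_abs_mul_sphereBubble_le hn hη hG)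
    have h1 : ∫ ω : Sph n, (l * δ * sphereBubble n η ω ^ expP n -
          C * δ * sphereBubble n η ω ^ (expP n - 1)) ∂(sphereMeasure n) ≤
        ∫ ω : Sph n, |l * (1 + δ * sphereBubble n η ω) - confPow k b ω| *
          sphereBubble n η ω ^ (expP n - 1) ∂(sphereMeasure n) := by
      have hwp' : Continuous fun ω => sphereBubble n η ω ^ expP n :=
        hw.rpow_const fun ω => Or.inr (by linarith)
      refine integral_mono (integrable_of_continuous_sphere (by fun_prop))
        (integrable_of_continuous_sphere (by fun_prop)) fun ω => ?_
      have hwω := sphereBubble_pos hη ω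
      have h2 := abs_confPow_sub_one_le (by linarith : 0 ≤ k) hb2
        (y := (ω : Euc (n + 1))) (by simp)
      have h3 : C₁ * ‖b‖ ≤ C₁ * (3 / c₁ * δ) := mul_le_mul_of_nonneg_left hb3 hC₁0.le
      have h4 := (abs_le.mp h2).2
      have h5 : l * δ * sphereBubble n η ω - C * δ ≤
          |l * (1 + δ * sphereBubble n η ω) - confPow k b (ω : Euc (n + 1))| := by
        refine le_trans ?_ (le_abs_self _)
        rw [hC]
        linarith
      have h6 : sphereBubble n η ω ^ expP n =
          sphereBubble n η ω * sphereBubble n η ω ^ (expP n - 1) := by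
        rw [← Real.rpow_one_add' hwω.le (by linarith), add_sub_cancel]
      beta_reduce
      rw [h6]
      refine le_trans (le_of_eq ?_)
        (mul_le_mul_of_nonneg_right h5 (Real.rpow_nonneg hwω.le (expP n - 1)))
      ring
    have hwp' : Continuous fun ω => sphereBubble n η ω ^ expP n :=
      hw.rpow_const fun ω => Or.inr (by linarith)
    rw [integral_sub (integrable_of_continuous_sphere (by fun_prop))
      (integrable_of_continuous_sphere (by fun_prop)), integral_const_mul, integral_const_mul,
      integral_sphereBubble_rpow_expP hn hη, integral_sphereBubble_rpow_expP_sub_one hn hη,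
      ← hk, ← hmk] at h1
    refine le_trans ?_ h1
    nlinarith

end TwoBubble

/-- Two bubbles, one of which concentrates sufficiently fast, show that the exponent `p` is sharp
for the `L^p`-distance. -/
theorem sphereSharp_sphereTwoBubble (hn : 2 ≤ n) {δ : ℕ → ℝ} (hδ : ∀ j, 0 < δ j)
    (hδ0 : Tendsto δ atTop (𝓝 0)) (η : ℕ → ball (0 : Euc (n + 1)) 1)
    (hη : ∀ j, (1 - ‖(η j : Euc (n + 1))‖ ^ 2) ^ (((n : ℝ) - 1) / 2) ≤ δ j ^ (expP n - 1)) :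
    SphereSharp n (expP n) (fun j => sphereTwoBubble n (δ j) (η j)) := by
  have hp := two_lt_expP hn
  have hη1 : ∀ j, ‖(η j : Euc (n + 1))‖ < 1 := fun j => mem_ball_zero_iff.mp (η j).2
  have hw := fun j => continuous_sphereBubble (n := n) (hη1 j)
  set l : ℕ → ℝ := fun j =>
    (sphereNorm n (expP n) fun ω => 1 + δ j * sphereBubble n (η j) ω)⁻¹ with hl
  have hl1 : ∀ j, l j ∈ Set.Icc (1 - δ j) 1 := fun j =>
    inv_sphereNorm_twoBubble_mem hn (hη1 j) (hδ j).le
  have hlpos : ∀ j, 0 ≤ l j := fun j => inv_nonneg.mpr lpNorm_nonneg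
  have hN := fun j => one_le_sphereNorm_twoBubble hn (hη1 j) (hδ j).le
  have hu : ∀ j, sphereTwoBubble n (δ j) (η j) =
      sphereNormalize n fun ω => 1 + δ j * sphereBubble n (η j) ω := fun j => by
    rw [sphereTwoBubble, sphereAct_psiEta_one hn]
  have hu' : ∀ j, sphereTwoBubble n (δ j) (η j) =
      fun ω => l j * (1 + δ j * sphereBubble n (η j) ω) := fun j => by
    rw [hu]
    rfl
  have huc : ∀ j, Continuous (sphereTwoBubble n (δ j) (η j)) := fun j => by
    have := hw j
    rw [hu']
    fun_prop
  refine ⟨fun j => ⟨memLp_of_continuous_sphere (huc j) _, ?_⟩, ?_, ?_⟩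
  · beta_reduce
    rw [hu]
    exact sphereNorm_normalize (by linarith [hN j])
  · have hlim : Tendsto (fun j => 2 * δ j) atTop (𝓝 0) := by
      have := hδ0.const_mul 2
      rwa [mul_zero] at this
    refine squeeze_zero (fun j => sphereDist_nonneg _ _ _) (fun j => ?_) hlim
    refine (sphereDist_one_le hn _ _).trans ?_
    have h1 : (fun ω => sphereTwoBubble n (δ j) (η j) ω - 1) =
        fun ω => (l j - 1) + l j * δ j * sphereBubble n (η j) ω := by
      rw [hu']
      funext ω
      ring
    rw [h1]
    refine (sphereNorm_const_add_mul_sphereBubble_le hn (hη1 j) _ _).trans ?_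
    obtain ⟨h2, h3⟩ := hl1 j
    rw [abs_of_nonpos (by linarith), abs_of_nonneg (mul_nonneg (hlpos j) (hδ j).le)]
    nlinarith [hδ j]
  · obtain ⟨δ₀, hδ₀, C, hC, hlow⟩ := exists_le_sphereNorm_twoBubble_sub hn
    have hlim : Tendsto (fun j => C * δ j ^ (expP n - 1)) atTop (𝓝 0) := by
      have h1 := (hδ0.rpow_const (p := expP n - 1) (Or.inr (by linarith))).const_mul C
      rwa [Real.zero_rpow (by linarith), mul_zero] at h1
    refine exponentSharp_of_le (c₀ := 1 / 4) (C := 2 * (expP n * 2 ^ (expP n - 1)))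
      (by linarith) (by norm_num) (by positivity) hδ hδ0 ?_ (Eventually.of_forall fun j => ?_)
    · filter_upwards [hδ0.eventually_lt_const hδ₀,
        hlim.eventually_lt_const (show (0 : ℝ) < 1 / 4 by norm_num)] with j hj hj' s hs
      refine rpow_le_sphereDist hs.le (by linarith [hδ j]) fun Ψ hΨ => ?_
      obtain ⟨b, hb⟩ := hΨ.exists_sphereNorm_eq hn
      rw [(hb _ (huc j)).1, hu', one_div_mul_eq_div]
      exact hlow (δ j) (l j) (η j) (hη1 j) (hδ j) hj.le (hl1 j)
        ((mul_le_mul_of_nonneg_left (hη j) hC.le).trans hj'.le) b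
    · have hwj := hw j
      have h1 := one_le_integral_one_add_mul_sphereBubble hn (hη1 j) (hδ j).le
      have hpos := Real.rpow_nonneg (hδ j).le (expP n)
      beta_reduce
      rw [hu]
      refine sphereDeficit_normalize_le hn (by fun_prop) (by positivity) h1 ?_
      refine (integral_twoBubble_rpow_le hn (hη1 j) (hδ j) (hη j)).trans ?_
      have h2 := Real.one_le_rpow h1 (by linarith : 0 ≤ expP n)
      linarith

/-- Points of the ball that converge to `ηs` at a rate prescribed by the sequence `δ`. -/
lemma exists_tendsto_concentrating (hn : 2 ≤ n) (ηs : Sph n) {δ : ℕ → ℝ} (hδ : ∀ j, 0 < δ j)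
    (hδ0 : Tendsto δ atTop (𝓝 0)) : ∃ η : ℕ → ball (0 : Euc (n + 1)) 1,
      Tendsto (fun j => (η j : Euc (n + 1))) atTop (𝓝 (ηs : Euc (n + 1))) ∧
      ∀ j, (1 - ‖(η j : Euc (n + 1))‖ ^ 2) ^ (((n : ℝ) - 1) / 2) ≤ δ j ^ (expP n - 1) := by
  have hn' : (2 : ℝ) ≤ n := by exact_mod_cast hn
  have hp := two_lt_expP hn
  set k := ((n : ℝ) - 1) / 2 with hk
  have hk0 : 0 < k := by linarith
  set a := (expP n - 1) / k with ha
  have ha0 : 0 < a := div_pos (by linarith) hk0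
  set m : ℕ → ℝ := fun j => min (1 / 2) (δ j ^ a) with hm
  have hm0 : ∀ j, 0 < m j := fun j => lt_min (by norm_num) (Real.rpow_pos_of_pos (hδ j) a)
  have hm1 : ∀ j, m j ≤ 1 / 2 := fun j => min_le_left _ _
  have hmlim : Tendsto m atTop (𝓝 0) := by
    have h1 := hδ0.rpow_const (p := a) (Or.inr ha0.le)
    rw [Real.zero_rpow ha0.ne'] at h1
    exact squeeze_zero (fun j => (hm0 j).le) (fun j => min_le_right _ _) h1
  have hnorm : ∀ j, ‖√(1 - m j) • (ηs : Euc (n + 1))‖ ^ 2 = 1 - m j := fun j => by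
    rw [norm_smul, norm_eq_of_mem_sphere, mul_one, Real.norm_of_nonneg (Real.sqrt_nonneg _),
      Real.sq_sqrt (by linarith [hm1 j])]
  refine ⟨fun j => ⟨√(1 - m j) • (ηs : Euc (n + 1)), ?_⟩, ?_, fun j => ?_⟩
  · rw [mem_ball_zero_iff]
    have h1 := hnorm j
    have h2 := hm0 j
    by_contra! h
    nlinarith
  · have h1 : Tendsto (fun j => √(1 - m j) • (ηs : Euc (n + 1))) atTop
        (𝓝 (√(1 - 0) • (ηs : Euc (n + 1)))) :=
      ((tendsto_const_nhds.sub hmlim).sqrt).smul_const _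
    rwa [sub_zero, Real.sqrt_one, one_smul] at h1
  · beta_reduce
    rw [hnorm, sub_sub_cancel]
    refine (Real.rpow_le_rpow (hm0 j).le (min_le_right _ _) hk0.le).trans ?_
    rw [← Real.rpow_mul (hδ j).le, ha, div_mul_cancel₀ _ hk0.ne']

end SphereBubble

end HWY

theorem mainTheorem5 (n : ℕ) (hn : 2 ≤ n) :
    -- exponent 2 of the L²-distance: second-order perturbations
    ((∃ φ, HWY.IsAdmissible n φ) ∧
      ∀ φ, HWY.IsAdmissible n φ → ∀ ε : ℕ → ℝ, (∀ j, ε j ≠ 0) → Tendsto ε atTop (𝓝 0) →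
        HWY.SphereSharp n 2 (fun j => HWY.perturbation n φ (ε j))) ∧
    -- exponent p of the L^p-distance: two bubbles, one concentrating at a boundary point
    (∀ ηs : HWY.Sph n, ∀ δ : ℕ → ℝ, (∀ j, 0 < δ j) → Tendsto δ atTop (𝓝 0) →
      ∃ η : ℕ → ball (0 : HWY.Euc (n + 1)) 1,
        Tendsto (fun j => (η j : HWY.Euc (n + 1))) atTop (𝓝 (ηs : HWY.Euc (n + 1))) ∧
        HWY.SphereSharp n (HWY.expP n) (fun j => HWY.sphereTwoBubble n (δ j) (η j))) ∧
    -- exponent 2 of the L^{q'}-distance in the dual inequality: two bubbles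
    (∀ η ∈ ball (0 : HWY.Euc (n + 1)) 1, η ≠ 0 →
      ∀ δ : ℕ → ℝ, (∀ j, 0 < δ j) → Tendsto δ atTop (𝓝 0) →
        HWY.BallSharp n (fun j => HWY.ballTwoBubble n (δ j) η)) := by
  refine ⟨⟨HWY.exists_isAdmissible hn, fun φ hφ ε hε hε0 =>
    HWY.sphereSharp_perturbation hn hφ hε hε0⟩, fun ηs δ hδ hδ0 => ?_, fun η hη hη0 δ hδ hδ0 =>
    HWY.ballSharp_ballTwoBubble hn (mem_ball_zero_iff.mp hη) hη0 hδ hδ0⟩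
  obtain ⟨η, hlim, hη⟩ := HWY.exists_tendsto_concentrating hn ηs hδ hδ0
  exact ⟨η, hlim, HWY.sphereSharp_sphereTwoBubble hn hδ hδ0 η hη⟩
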